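/- Let $N\ge 1$ be an integer, $p>1$, $A>0$, and let $\phi(x):=(1+|x|)^{-A}$ for $x\in\mathbb{R}^N$. For $0<\alpha<1$ consider the Cauchy problem $$\partial_t^\alpha u-\Delta u=u^p\ \text{ in }(0,T)\times\mathbb{R}^N,\qquad u(0)=\mu\ \text{ in }\mathbb{R}^N, \qquad (\ast)$$ where $\partial_t^\alpha$ is the Caputo derivative and $\mu\ge0$ is a Radon measure. Let $G(t,x)=(4\pi t)^{-N/2}e^{-|x|^2/(4t)}$, $e^{t\Delta}\mu(x)=\int G(t,x-y)\,d\mu(y)$, and let $h_\alpha\ge0$ be the probability density on $(0,\infty)$ with $\int_0^\infty h_\alpha(\theta)e^{z\theta}\,d\theta=\sum_{k\ge0}\frac{z^k}{\Gamma(\alpha k+1)}$ for all $z\in\mathbb{C}$; put $P_\alpha(t)=\int_0^\infty h_\alpha(\theta)e^{t^\alpha\theta\Delta}\,d\theta$ and $S_\alpha(t)=\int_0^\infty\theta h_\alpha(\theta)e^{t^\alpha\theta\Delta}\,d\theta$. A solution of $(\ast)$ in $[0,T]\times\mathbb{R}^N$ is a nonnegative measurable function $u$ with $$\infty>u(t,x)=[P_\alpha(t)\mu](x)+\alpha\int_0^t(t-s)^{\alpha-1}[S_\alpha(t-s)u(s)^p](x)\,ds$$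 for almost all $t\in(0,T]$ and $x\in\mathbb{R}^N$; it is the minimal solution if it is $\le$ every solution in $[0,T]\times\mathbb{R}^N$ almost everywhere. The life span $T_\alpha[\mu]$ is the supremum of all $T'>0$ such that the minimal solution exists in $[0,T']\times\mathbb{R}^N$. Functions $f\ge 0$ are identified with the measures $f\,dx$. Theorem. Suppose that $p<p_F:=1+\frac2N$ or $A<\frac{2}{p-1}$. Then there exist $\kappa_0\in(0,1)$, independent of $\alpha$, and $c(\alpha),C(\alpha)>0$ $(0<\alpha<1)$, independent of $\kappa$, with $\liminf_{\alpha\to1-0}c(\alpha)>0$ and $\limsup_{\alpha\to1-0}C(\alpha)<\infty$, such that for all $\alpha\in(0,1)$ and all $\kappa\in(0,\kappa_0)$ $$c(\alpha)\,F_\alpha(\kappa)\le T_\alpha[\kappa\phi]\le C(\alpha)\,F_\alpha(\kappa),$$ where $$F_\alpha(\kappa)=\begin{cases}\kappa^{-\left(\frac{\alpha}{p-1}-\frac{\alpha}{2}\min(A,N)\right)^{-1}}&\text{if }A\ne N,\\[4pt]\left(\dfrac{\kappa^{-1}}{\log\kappa^{-1}}\right)^{\left(\frac{\alpha}{p-1}-\frac{\alpha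 N}{2}\right)^{-1}}&\text{if }A=N.\end{cases}$$ -/

import Mathlib

open MeasureTheory Set Filter Topology
open scoped ENNReal

namespace TimeFractional

noncomputable section

/-- The Zolotarev kernel
`a_α(φ) = sin((1-α)φ) sin(αφ)^{α/(1-α)} / sin(φ)^{1/(1-α)}`, `0 < φ < π`. -/
def zolotarev (α φ : ℝ) : ℝ :=
  Real.sin ((1 - α) * φ) * Real.sin (α * φ) ^ (α / (1 - α)) / Real.sin φ ^ (1 / (1 - α))

/-- The probability density `h_α` on `(0,∞)` (the M-Wright function), written through the
positive integral representation
`h_α(θ) = θ^{α/(1-α)} / (π(1-α)) ∫_0^π a_α(φ) exp(-a_α(φ) θ^{1/(1-α)}) dφ`.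
The theorems `wrightDensity_nonneg` and `integral_wrightDensity_mul_cexp` below show that it is the
nonnegative function with `∫_0^∞ h_α(θ) e^{zθ} dθ = E_{α,1}(z)` for all `z ∈ ℂ`; this identity
determines `h_α` up to null sets. -/
def wrightDensity (α θ : ℝ) : ℝ :=
  1 / (Real.pi * (1 - α)) * θ ^ (α / (1 - α)) *
    ∫ φ in Ioo 0 Real.pi, zolotarev α φ * Real.exp (-zolotarev α φ * θ ^ (1 / (1 - α)))

/-- The Mittag-Leffler function `E_{α,β}(z) = ∑ z^k / Γ(αk + β)`. -/
def mittagLeffler (α β : ℝ) (z : ℂ) : ℂ :=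
  ∑' k : ℕ, z ^ k / (Real.Gamma (α * k + β) : ℂ)

lemma sin_mul_pos {α φ : ℝ} (hα : α ∈ Ioo (0 : ℝ) 1) (hφ : φ ∈ Ioo 0 Real.pi) :
    0 < Real.sin (α * φ) := by
  obtain ⟨h0, h1⟩ := hα
  obtain ⟨p0, p1⟩ := hφ
  exact Real.sin_pos_of_pos_of_lt_pi (by positivity) (by nlinarith)

lemma one_sub_mem {α : ℝ} (hα : α ∈ Ioo (0 : ℝ) 1) : 1 - α ∈ Ioo (0 : ℝ) 1 :=
  ⟨by linarith [hα.2], by linarith [hα.1]⟩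

lemma zolotarev_pos {α φ : ℝ} (hα : α ∈ Ioo (0 : ℝ) 1) (hφ : φ ∈ Ioo 0 Real.pi) :
    0 < zolotarev α φ := by
  have h1 := sin_mul_pos hα hφ
  have h2 := sin_mul_pos (one_sub_mem hα) hφ
  have h3 := Real.sin_pos_of_pos_of_lt_pi hφ.1 hφ.2
  unfold zolotarev; positivity

lemma inv_Gamma_eq (y : ℝ) : (Real.Gamma y)⁻¹ = y * (Real.Gamma (y + 1))⁻¹ := by
  rcases eq_or_ne y 0 with rfl | h
  · simp [Real.Gamma_zero]
  · rw [Real.Gamma_add_one h, mul_inv]; field_simp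

/-- auxiliary: the continuous extension of `sin(πs)/s` -/
def tau (s : ℝ) : ℝ := if s = 0 then Real.pi else Real.sin (s * Real.pi) / s

lemma sum_choose_tau (k : ℕ) (x : ℝ) :
    ∑ j ∈ Finset.range (k + 1), (k.choose j : ℝ) * tau (j - x) =
      Real.pi * k.factorial * ((Real.Gamma (1 + x))⁻¹ * (Real.Gamma (1 + k - x))⁻¹) := by
  induction k generalizing x with
  | zero =>
    rcases eq_or_ne x 0 with rfl | h
    · simp [tau]
    · have := Real.Gamma_mul_Gamma_one_sub x
      have e : (Real.Gamma (1 + x))⁻¹ * (Real.Gamma (1 - x))⁻¹ = 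
          (Real.pi * x)⁻¹ * Real.sin (Real.pi * x) := by
        rw [add_comm, Real.Gamma_add_one h, mul_inv, mul_assoc, ← mul_inv, this]
        field_simp
      simp [tau, h, e, mul_comm x]
      field_simp
  | succ k ih =>
    have key : ∑ j ∈ Finset.range (k + 2), ((k + 1).choose j : ℝ) * tau (j - x) =
      ∑ j ∈ Finset.range (k + 1), (k.choose j : ℝ) * tau (j - x) +
      ∑ j ∈ Finset.range (k + 1), (k.choose j : ℝ) * tau (j - (x - 1)) := by
      rw [Finset.sum_range_succ']
      rw [Finset.sum_range_succ' (fun j => (k.choose j : ℝ) * tau (j - x))]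
      have : ∑ j ∈ Finset.range k, (k.choose (j + 1) : ℝ) * tau ((j + 1 : ℕ) - x)
        = ∑ j ∈ Finset.range (k + 1), (k.choose (j + 1) : ℝ) * tau ((j + 1 : ℕ) - x) := by
        rw [Finset.sum_range_succ]; simp
      rw [this]
      have e2 : ∀ j : ℕ, ((j + 1 : ℕ) : ℝ) - x = j - (x - 1) := fun j => by push_cast; ring
      simp only [Nat.choose_succ_succ', e2]
      push_cast
      simp only [add_mul, Finset.sum_add_distrib]
      simp
      ring
    rw [key, ih, ih]
    have g1 := inv_Gamma_eq (1 + (x - 1))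
    have g2 := inv_Gamma_eq (1 + k - x)
    rw [g1, g2]
    rw [Nat.factorial_succ]
    push_cast
    rw [show 1 + (x - 1) + 1 = 1 + x by ring, show 1 + (k : ℝ) - (x - 1) = 1 + k - x + 1 by ring,
      show 1 + ((k : ℝ) + 1) - x = 1 + k - x + 1 by ring]
    ring

/-- auxiliary: `a_α(φ)^{-(1-α)}` -/
def bfun (α φ : ℝ) : ℝ :=
  Real.sin φ / Real.sin ((1 - α) * φ) *
    (Real.sin (α * φ) / Real.sin ((1 - α) * φ)) ^ (-α)

lemma bfun_eq {α φ : ℝ} (hα : α ∈ Ioo (0 : ℝ) 1) (hφ : φ ∈ Ioo 0 Real.pi) :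
    zolotarev α φ ^ (-(1 - α)) = bfun α φ := by
  have h1 := sin_mul_pos hα hφ
  have h2 := sin_mul_pos (one_sub_mem hα) hφ
  have h3 := Real.sin_pos_of_pos_of_lt_pi hφ.1 hφ.2
  have ha : 1 - α ≠ 0 := by linarith [hα.2]
  unfold zolotarev bfun
  rw [Real.div_rpow (by positivity) (by positivity), Real.mul_rpow (by positivity) (by positivity),
    ← Real.rpow_mul h1.le, ← Real.rpow_mul h3.le, Real.div_rpow h1.le h2.le]
  rw [show α / (1 - α) * -(1 - α) = -α by field_simp,
    show 1 / (1 - α) * -(1 - α) = -1 by field_simp, Real.rpow_neg_one,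
    show -(1 - α) = -1 + α by ring, Real.rpow_add h2, Real.rpow_neg_one, Real.rpow_neg h2.le]
  have := Real.rpow_pos_of_pos h2 α
  field_simp

/-- auxiliary: `sin(αφ)/sin((1-α)φ)`, extended continuously to `φ = 0` -/
def rfun (α φ : ℝ) : ℝ :=
  α / (1 - α) * (Real.sinc (α * φ) / Real.sinc ((1 - α) * φ))

lemma sinc_mul_pos {α φ : ℝ} (hα : α ∈ Ioo (0 : ℝ) 1) (hφ : φ ∈ Icc 0 Real.pi) :
    0 < Real.sinc (α * φ) := by
  rcases eq_or_lt_of_le hφ.1 with h | h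
  · simp [← h]
  · rw [Real.sinc_of_ne_zero (mul_pos hα.1 h).ne']
    refine div_pos (Real.sin_pos_of_pos_of_lt_pi (mul_pos hα.1 h) ?_) (mul_pos hα.1 h)
    nlinarith [hα.2, hφ.2]

lemma rfun_pos {α φ : ℝ} (hα : α ∈ Ioo (0 : ℝ) 1) (hφ : φ ∈ Icc 0 Real.pi) :
    0 < rfun α φ := by
  have h1 := sinc_mul_pos hα hφ
  have h2 := sinc_mul_pos (one_sub_mem hα) hφ
  have := hα.1
  have := (one_sub_mem hα).1
  unfold rfun; positivity

lemma rfun_eq {α φ : ℝ} (hα : α ∈ Ioo (0 : ℝ) 1) (hφ : 0 < φ) :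
    rfun α φ = Real.sin (α * φ) / Real.sin ((1 - α) * φ) := by
  have h1 := hα.1
  have h2 := (one_sub_mem hα).1
  unfold rfun
  rw [Real.sinc_of_ne_zero (by positivity), Real.sinc_of_ne_zero (by positivity)]
  field_simp

lemma rfun_continuousOn {α : ℝ} (hα : α ∈ Ioo (0 : ℝ) 1) :
    ContinuousOn (rfun α) (Icc 0 Real.pi) := by
  unfold rfun
  refine continuousOn_const.mul (ContinuousOn.div ?_ ?_ ?_)
  · exact (Real.continuous_sinc.comp (by fun_prop)).continuousOn
  · exact (Real.continuous_sinc.comp (by fun_prop)).continuousOn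
  · exact fun φ hφ => (sinc_mul_pos (one_sub_mem hα) hφ).ne'

lemma rfun_hasDerivAt {α φ : ℝ} (hα : α ∈ Ioo (0 : ℝ) 1) (hφ : φ ∈ Ioo 0 Real.pi) :
    ∃ r', HasDerivAt (rfun α) r' φ := by
  have h2 := sin_mul_pos (one_sub_mem hα) hφ
  have : DifferentiableAt ℝ (fun φ => Real.sin (α * φ) / Real.sin ((1 - α) * φ)) φ := by
    refine DifferentiableAt.div ?_ ?_ h2.ne' <;> fun_prop
  refine ⟨_, (this.hasDerivAt).congr_of_eventuallyEq ?_⟩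
  filter_upwards [lt_mem_nhds hφ.1] with x hx using rfun_eq hα hx

lemma complex_sum {α φ : ℝ} (k : ℕ) (hα : α ∈ Ioo (0 : ℝ) 1) (hφ : φ ∈ Ioo 0 Real.pi) :
    ∑ j ∈ Finset.range (k + 1), ((k.choose j : ℝ) : ℂ) *
      ((rfun α φ ^ ((j : ℝ) - α * k) : ℝ) : ℂ) * Complex.exp ((((j : ℝ) - α * k) * φ : ℝ) * Complex.I) =
    ((bfun α φ ^ k : ℝ) : ℂ) := by
  have hr := rfun_pos hα (Ioo_subset_Icc_self hφ)
  have h1 := sin_mul_pos hα hφ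
  have h2 := sin_mul_pos (one_sub_mem hα) hφ
  set r := rfun α φ with hrdef
  have hb : bfun α φ = Real.sin φ / Real.sin ((1 - α) * φ) * r ^ (-α) := by
    rw [hrdef, rfun_eq hα hφ.1, bfun]
  have hbase : (1 : ℂ) + (r : ℂ) * Complex.exp (φ * Complex.I) =
      ((Real.sin φ / Real.sin ((1 - α) * φ) : ℝ) : ℂ) * Complex.exp ((α * φ : ℝ) * Complex.I) := by
    have hs : Real.sin φ = Real.sin (α * φ) * Real.cos ((1 - α) * φ) +
        Real.cos (α * φ) * Real.sin ((1 - α) * φ) := by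
      rw [← Real.sin_add]; ring_nf
    have hs3 : Real.sin ((1 - α) * φ) = Real.sin φ * Real.cos (α * φ) - Real.cos φ * Real.sin (α * φ) := by
      rw [← Real.sin_sub]; ring_nf
    rw [hrdef, rfun_eq hα hφ.1]
    rw [Complex.exp_mul_I, Complex.exp_mul_I, ← Complex.ofReal_cos, ← Complex.ofReal_sin,
      ← Complex.ofReal_cos, ← Complex.ofReal_sin]
    apply Complex.ext
    · simp only [Complex.add_re, Complex.one_re, Complex.mul_re, Complex.ofReal_re,
        Complex.ofReal_im, Complex.add_im, Complex.mul_im, Complex.I_re, Complex.I_im]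
      generalize Real.sin ((1 - α) * φ) = S at *
      field_simp
      linear_combination hs3
    · simp only [Complex.add_re, Complex.one_im, Complex.mul_re, Complex.ofReal_re,
        Complex.ofReal_im, Complex.add_im, Complex.mul_im, Complex.I_re, Complex.I_im]
      field_simp
      ring
  have term : ∀ j ∈ Finset.range (k + 1), ((k.choose j : ℝ) : ℂ) *
      ((r ^ ((j : ℝ) - α * k) : ℝ) : ℂ) * Complex.exp ((((j : ℝ) - α * k) * φ : ℝ) * Complex.I) =
      (((r : ℂ) * Complex.exp (φ * Complex.I)) ^ j * 1 ^ (k - j) * (k.choose j : ℂ)) *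
        (((r ^ (-α)) ^ k : ℝ) * Complex.exp (-(k * ((α * φ : ℝ) * Complex.I)))) := by
    intro j _
    have : r ^ ((j : ℝ) - α * k) = r ^ j * (r ^ (-α)) ^ k := by
      rw [sub_eq_add_neg, Real.rpow_add hr, Real.rpow_natCast, ← Real.rpow_natCast (r ^ (-α)),
        ← Real.rpow_mul hr.le]; ring_nf
    have he : Complex.exp ((((j : ℝ) - α * k) * φ : ℝ) * Complex.I) =
        Complex.exp (φ * Complex.I) ^ j * Complex.exp (-(k * ((α * φ : ℝ) * Complex.I))) := by
      rw [← Complex.exp_nat_mul, ← Complex.exp_add]; congr 1; push_cast; ring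
    rw [this, he]; push_cast; ring
  rw [Finset.sum_congr rfl term, ← Finset.sum_mul, ← add_pow, add_comm, hbase, mul_pow,
    ← Complex.exp_nat_mul, hb]
  have : Complex.exp (k * ((α * φ : ℝ) * Complex.I)) * Complex.exp (-(k * ((α * φ : ℝ) * Complex.I))) = 1 := by
    rw [← Complex.exp_add]; simp
  push_cast at this ⊢
  linear_combination (((Complex.sin φ / Complex.sin ((1 - α) * φ)) ^ k) * ((r ^ (-α) : ℝ) : ℂ) ^ k) * this

lemma sum_cos {α φ : ℝ} (k : ℕ) (hα : α ∈ Ioo (0 : ℝ) 1) (hφ : φ ∈ Ioo 0 Real.pi) :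
    ∑ j ∈ Finset.range (k + 1), (k.choose j : ℝ) *
      rfun α φ ^ ((j : ℝ) - α * k) * Real.cos (((j : ℝ) - α * k) * φ) = bfun α φ ^ k := by
  have := congrArg Complex.re (complex_sum k hα hφ)
  rw [Complex.re_sum, Complex.ofReal_re] at this
  rw [← this]
  refine Finset.sum_congr rfl fun j _ => ?_
  rw [← Complex.ofReal_mul, Complex.re_ofReal_mul, Complex.exp_ofReal_mul_I_re]

lemma sum_sin {α φ : ℝ} (k : ℕ) (hα : α ∈ Ioo (0 : ℝ) 1) (hφ : φ ∈ Ioo 0 Real.pi) :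
    ∑ j ∈ Finset.range (k + 1), (k.choose j : ℝ) *
      rfun α φ ^ ((j : ℝ) - α * k) * Real.sin (((j : ℝ) - α * k) * φ) = 0 := by
  have := congrArg Complex.im (complex_sum k hα hφ)
  rw [Complex.im_sum, Complex.ofReal_im] at this
  rw [← this]
  refine Finset.sum_congr rfl fun j _ => ?_
  rw [← Complex.ofReal_mul, Complex.im_ofReal_mul, Complex.exp_ofReal_mul_I_im]

/-- auxiliary primitive -/
def prim (α s φ : ℝ) : ℝ := if s = 0 then φ else rfun α φ ^ s * Real.sin (s * φ) / s

lemma prim_continuousOn {α : ℝ} (s : ℝ) (hα : α ∈ Ioo (0 : ℝ) 1) :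
    ContinuousOn (prim α s) (Icc 0 Real.pi) := by
  unfold prim
  split_ifs
  · exact continuousOn_id
  · refine ContinuousOn.div_const (ContinuousOn.mul ?_ (by fun_prop)) _
    exact (rfun_continuousOn hα).rpow_const fun φ hφ => Or.inl (rfun_pos hα hφ).ne'

lemma prim_hasDerivAt {α φ r' : ℝ} (s : ℝ) (hα : α ∈ Ioo (0 : ℝ) 1) (hφ : φ ∈ Ioo 0 Real.pi)
    (hr' : HasDerivAt (rfun α) r' φ) :
    HasDerivAt (prim α s) (rfun α φ ^ s * Real.cos (s * φ) +
      r' / rfun α φ * (rfun α φ ^ s * Real.sin (s * φ))) φ := by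
  have hr := rfun_pos hα (Ioo_subset_Icc_self hφ)
  unfold prim
  split_ifs with h
  · subst h; simpa using hasDerivAt_id' φ
  · have h1 := hr'.rpow_const (p := s) (Or.inl hr.ne')
    have h2 : HasDerivAt (fun x => Real.sin (s * x)) (Real.cos (s * φ) * s) φ := by
      simpa using ((hasDerivAt_id φ).const_mul s).sin
    convert! (h1.mul h2).div_const s using 1
    rw [Real.rpow_sub_one hr.ne']
    field_simp
    ring

lemma integral_bfun_pow {α : ℝ} (k : ℕ) (hα : α ∈ Ioo (0 : ℝ) 1) :
    IntegrableOn (fun φ => bfun α φ ^ k) (Ioo 0 Real.pi) ∧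
    ∫ φ in Ioo 0 Real.pi, bfun α φ ^ k =
      Real.pi * k.factorial * ((Real.Gamma (1 + α * k))⁻¹ * (Real.Gamma (1 + k - α * k))⁻¹) := by
  have hπ := Real.pi_pos
  set D : ℝ → ℝ := fun φ => ∑ j ∈ Finset.range (k + 1), (k.choose j : ℝ) *
      rfun α φ ^ ((j : ℝ) - α * k) * Real.cos (((j : ℝ) - α * k) * φ) with hD
  have hDc : ContinuousOn D (Icc 0 Real.pi) := by
    refine continuousOn_finsetSum _ fun j _ => ?_
    refine ContinuousOn.mul (continuousOn_const.mul ?_) (by fun_prop)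
    exact (rfun_continuousOn hα).rpow_const fun φ hφ => Or.inl (rfun_pos hα hφ).ne'
  have hDi : IntegrableOn D (Ioo 0 Real.pi) :=
    (hDc.integrableOn_Icc).mono_set Ioo_subset_Icc_self
  have hEq : EqOn D (fun φ => bfun α φ ^ k) (Ioo 0 Real.pi) := fun φ hφ => sum_cos k hα hφ
  refine ⟨hDi.congr_fun hEq measurableSet_Ioo, ?_⟩
  rw [← setIntegral_congr_fun measurableSet_Ioo hEq, ← integral_Ioc_eq_integral_Ioo,
    ← intervalIntegral.integral_of_le hπ.le]
  rw [intervalIntegral.integral_eq_sub_of_hasDerivAt_of_le hπ.le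
    (f := fun φ => ∑ j ∈ Finset.range (k + 1), (k.choose j : ℝ) * prim α ((j : ℝ) - α * k) φ)]
  · have : rfun α Real.pi = 1 := by
      rw [rfun_eq hα hπ]
      have := sinc_mul_pos hα ⟨hπ.le, le_refl _⟩
      rw [Real.sinc_of_ne_zero (mul_pos hα.1 hπ).ne'] at this
      rw [show (1 - α) * Real.pi = Real.pi - α * Real.pi by ring, Real.sin_pi_sub, div_self]
      intro h; simp [h] at this
    rw [← sum_choose_tau, ← Finset.sum_sub_distrib]
    refine Finset.sum_congr rfl fun j _ => ?_
    rw [← mul_sub]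
    congr 1
    unfold prim tau
    rw [this]
    split_ifs <;> simp
  · exact continuousOn_finsetSum _ fun j _ => continuousOn_const.mul (prim_continuousOn _ hα)
  · intro φ hφ
    obtain ⟨r', hr'⟩ := rfun_hasDerivAt hα hφ
    have := HasDerivAt.fun_sum (u := Finset.range (k + 1)) fun j _ =>
      (prim_hasDerivAt ((j : ℝ) - α * k) hα hφ hr').const_mul (k.choose j : ℝ)
    convert! this using 1
    have h0 := sum_sin k hα hφ
    simp only [mul_add, Finset.sum_add_distrib, hD, ← mul_assoc]
    simp only [mul_comm _ (r' / rfun α φ), mul_assoc] at h0 ⊢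
    rw [← Finset.mul_sum, h0]; simp
  · rw [intervalIntegrable_iff_integrableOn_Icc_of_le hπ.le]
    exact hDc.integrableOn_Icc

/-- the integrand of the moment of order `k`, as a function of both variables -/
def jointDensity (α : ℝ) (k : ℕ) (z : ℝ × ℝ) : ℝ :=
  z.1 ^ k * (1 / (Real.pi * (1 - α)) * z.1 ^ (α / (1 - α)) *
    (zolotarev α z.2 * Real.exp (-zolotarev α z.2 * z.1 ^ (1 / (1 - α)))))

lemma integral_jointDensity_left {α φ : ℝ} (k : ℕ) (hα : α ∈ Ioo (0 : ℝ) 1)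
    (hφ : φ ∈ Ioo 0 Real.pi) :
    IntegrableOn (fun θ => jointDensity α k (θ, φ)) (Ioi 0) ∧
    ∫ θ in Ioi 0, jointDensity α k (θ, φ) =
      Real.Gamma (1 + k - α * k) / Real.pi * bfun α φ ^ k := by
  have ha := (one_sub_mem hα).1
  have hz := zolotarev_pos hα hφ
  have hq : 0 < 1 / (1 - α) := by positivity
  have hs : -1 < (k : ℝ) + α / (1 - α) := by
    have := div_pos hα.1 ha
    have : (0 : ℝ) ≤ k := Nat.cast_nonneg k
    linarith
  have hEq : EqOn (fun θ => zolotarev α φ / (Real.pi * (1 - α)) *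
      (θ ^ ((k : ℝ) + α / (1 - α)) * Real.exp (-zolotarev α φ * θ ^ (1 / (1 - α)))))
      (fun θ => jointDensity α k (θ, φ)) (Ioi 0) := by
    intro θ hθ
    simp only [jointDensity]
    rw [Real.rpow_add hθ, Real.rpow_natCast]
    ring
  constructor
  · exact IntegrableOn.congr_fun
      ((integrableOn_rpow_mul_exp_neg_mul_rpow hs hq hz).const_mul _) hEq measurableSet_Ioi
  · rw [← setIntegral_congr_fun measurableSet_Ioi hEq, integral_const_mul,
      integral_rpow_mul_exp_neg_mul_rpow hq hs hz, ← bfun_eq hα hφ, ← Real.rpow_natCast,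
      ← Real.rpow_mul hz.le]
    have e1 : ((k : ℝ) + α / (1 - α) + 1) / (1 / (1 - α)) = 1 + k - α * k := by
      field_simp; ring
    have e2 : -((k : ℝ) + α / (1 - α) + 1) / (1 / (1 - α)) = -(1 - α) * k - 1 := by
      field_simp; ring
    rw [e1, e2, Real.rpow_sub_one hz.ne']
    field_simp

lemma measurable_zolotarev (α : ℝ) : Measurable (zolotarev α) := by
  unfold zolotarev; fun_prop

lemma measurable_jointDensity (α : ℝ) (k : ℕ) : Measurable (jointDensity α k) := by
  have := measurable_zolotarev α
  unfold jointDensity; fun_prop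

lemma jointDensity_nonneg {α θ φ : ℝ} (k : ℕ) (hα : α ∈ Ioo (0 : ℝ) 1)
    (hφ : φ ∈ Ioo 0 Real.pi) (hθ : 0 < θ) : 0 ≤ jointDensity α k (θ, φ) := by
  have ha := (one_sub_mem hα).1
  have hz := zolotarev_pos hα hφ
  simp only [jointDensity]
  positivity

lemma jointDensity_integrable {α : ℝ} (k : ℕ) (hα : α ∈ Ioo (0 : ℝ) 1) :
    Integrable (jointDensity α k)
      ((volume.restrict (Ioi 0)).prod (volume.restrict (Ioo 0 Real.pi))) := by
  rw [integrable_prod_iff' (measurable_jointDensity α k).aestronglyMeasurable]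
  constructor
  · filter_upwards [ae_restrict_mem measurableSet_Ioo] with φ hφ
    exact (integral_jointDensity_left k hα hφ).1
  · refine IntegrableOn.congr_fun ((integral_bfun_pow k hα).1.const_mul
      (Real.Gamma (1 + k - α * k) / Real.pi)) ?_ measurableSet_Ioo
    intro φ hφ
    beta_reduce
    rw [← (integral_jointDensity_left k hα hφ).2]
    refine setIntegral_congr_fun measurableSet_Ioi fun θ hθ => ?_
    exact (Real.norm_of_nonneg (jointDensity_nonneg k hα hφ hθ)).symm

lemma pow_mul_wrightDensity (α θ : ℝ) (k : ℕ) :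
    θ ^ k * wrightDensity α θ = ∫ φ in Ioo 0 Real.pi, jointDensity α k (θ, φ) := by
  simp only [wrightDensity, jointDensity]
  rw [integral_const_mul, integral_const_mul]

/-- `∫_0^∞ θ^k h_α(θ) dθ = k! / Γ(1 + αk)`; for `k = 0`, the total mass is one. -/
theorem wrightDensity_moment {α : ℝ} (hα : α ∈ Ioo (0 : ℝ) 1) (k : ℕ) :
    IntegrableOn (fun θ => θ ^ k * wrightDensity α θ) (Ioi 0) ∧
    ∫ θ in Ioi 0, θ ^ k * wrightDensity α θ = k.factorial / Real.Gamma (1 + α * k) := by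
  have hi := jointDensity_integrable k hα
  simp only [pow_mul_wrightDensity]
  refine ⟨hi.integral_prod_left, ?_⟩
  rw [integral_integral_swap (f := fun θ φ => jointDensity α k (θ, φ)) hi,
    setIntegral_congr_fun measurableSet_Ioo
      (fun φ hφ => (integral_jointDensity_left k hα hφ).2), integral_const_mul,
    (integral_bfun_pow k hα).2]
  have hG : Real.Gamma (1 + k - α * k) ≠ 0 := by
    refine (Real.Gamma_pos_of_pos ?_).ne'
    have := mul_nonneg (Nat.cast_nonneg (α := ℝ) k) (one_sub_mem hα).1.le
    linarith
  have := Real.pi_pos.ne'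
  generalize Real.Gamma (1 + k - α * k) = X at *
  field_simp

theorem wrightDensity_nonneg {α θ : ℝ} (hα : α ∈ Ioo (0 : ℝ) 1) (hθ : 0 < θ) :
    0 ≤ wrightDensity α θ := by
  have := pow_mul_wrightDensity α θ 0
  rw [pow_zero, one_mul] at this
  rw [this]
  exact setIntegral_nonneg measurableSet_Ioo fun φ hφ => jointDensity_nonneg 0 hα hφ hθ

lemma Gamma_lower {s R : ℝ} (hs : 0 ≤ s) (hR : 0 ≤ R) :
    R ^ s * Real.exp (-R) ≤ Real.Gamma (1 + s) := by
  rw [Real.Gamma_eq_integral (by linarith), show 1 + s - 1 = s by ring,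
    ← integral_exp_neg_Ioi, ← integral_const_mul]
  have hI := Real.GammaIntegral_convergent (s := 1 + s) (by linarith)
  rw [show 1 + s - 1 = s by ring] at hI
  refine (setIntegral_mono_on ?_ (hI.mono_set (Ioi_subset_Ioi hR)) measurableSet_Ioi ?_).trans
    (setIntegral_mono_set hI ?_ (Ioi_subset_Ioi hR).eventuallyLE)
  · exact (integrableOn_exp_neg_Ioi R).const_mul _
  · intro x hx
    rw [mul_comm]
    exact mul_le_mul_of_nonneg_left (Real.rpow_le_rpow hR (le_of_lt hx) hs) (Real.exp_pos _).le
  · filter_upwards [ae_restrict_mem measurableSet_Ioi] with x hx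
    have : (0 : ℝ) < x := hx
    simp only [Pi.zero_apply]; positivity

lemma summable_mittagLeffler {α : ℝ} (hα : 0 < α) (y : ℝ) (hy : 0 ≤ y) :
    Summable fun k : ℕ => y ^ k / Real.Gamma (1 + α * k) := by
  set R : ℝ := (2 * y + 1) ^ (1 / α) with hR
  have hR0 : 0 ≤ R := by positivity
  have hgeo : Summable fun k : ℕ => Real.exp R * (1 / 2 : ℝ) ^ k :=
    (summable_geometric_of_lt_one (by norm_num) (by norm_num)).mul_left _
  refine Summable.of_nonneg_of_le (fun k => ?_) (fun k => ?_) hgeo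
  · have := Real.Gamma_pos_of_pos (s := 1 + α * k) (by positivity)
    positivity
  · have hG := Real.Gamma_pos_of_pos (s := 1 + α * k) (by positivity)
    have hl := Gamma_lower (s := α * k) (R := R) (by positivity) hR0
    have hRk : R ^ (α * k) = (2 * y + 1) ^ k := by
      rw [hR, ← Real.rpow_mul (by positivity), ← Real.rpow_natCast]
      congr 1; field_simp
    rw [hRk] at hl
    rw [div_le_iff₀ hG]
    have h1 : y ^ k ≤ (1 / 2 : ℝ) ^ k * (2 * y + 1) ^ k := by
      rw [← mul_pow]; exact pow_le_pow_left₀ hy (by linarith) k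
    calc y ^ k ≤ (1 / 2 : ℝ) ^ k * (2 * y + 1) ^ k := h1
      _ = Real.exp R * (1 / 2 : ℝ) ^ k * ((2 * y + 1) ^ k * Real.exp (-R)) := by
        rw [Real.exp_neg]; field_simp
      _ ≤ _ := by gcongr

/-- The identity that characterizes `h_α`. -/
theorem integral_wrightDensity_mul_cexp {α : ℝ} (hα : α ∈ Ioo (0 : ℝ) 1) (z : ℂ) :
    ∫ θ in Ioi 0, (wrightDensity α θ : ℂ) * Complex.exp (z * θ) = mittagLeffler α 1 z := by
  set F : ℕ → ℝ → ℂ := fun k θ =>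
    (z ^ k / (k.factorial : ℂ)) * ((θ ^ k * wrightDensity α θ : ℝ) : ℂ) with hF
  have hFi : ∀ k, Integrable (F k) (volume.restrict (Ioi 0)) := fun k =>
    ((wrightDensity_moment hα k).1.ofReal).const_mul _
  have hFn : ∀ k, ∫ θ in Ioi 0, ‖F k θ‖ = ‖z‖ ^ k / Real.Gamma (1 + α * k) := by
    intro k
    have : EqOn (fun θ => ‖F k θ‖)
        (fun θ => (‖z‖ ^ k / k.factorial) * (θ ^ k * wrightDensity α θ)) (Ioi 0) := by
      intro θ hθ
      have h0 : (0 : ℝ) < θ := hθ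
      have h1 := wrightDensity_nonneg hα h0
      simp only [hF, norm_mul, norm_div, norm_pow, Complex.norm_real, Complex.norm_natCast,
        Real.norm_of_nonneg h0.le, Real.norm_of_nonneg h1]
    rw [setIntegral_congr_fun measurableSet_Ioi this, integral_const_mul,
      (wrightDensity_moment hα k).2]
    have := Nat.cast_ne_zero (R := ℝ).2 k.factorial_ne_zero
    field_simp
  have hsum := hasSum_integral_of_summable_integral_norm hFi
    (by simpa only [hFn] using summable_mittagLeffler hα.1 ‖z‖ (norm_nonneg z))
  have hpt : ∀ θ : ℝ, ∑' k, F k θ = (wrightDensity α θ : ℂ) * Complex.exp (z * θ) := by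
    intro θ
    have := (NormedSpace.expSeries_div_hasSum_exp (z * θ : ℂ)).mul_left (wrightDensity α θ : ℂ)
    rw [← Complex.exp_eq_exp_ℂ] at this
    rw [← this.tsum_eq]
    refine tsum_congr fun k => ?_
    simp only [hF]; push_cast; ring
  simp only [hpt] at hsum
  rw [← hsum.tsum_eq, mittagLeffler]
  refine tsum_congr fun k => ?_
  simp only [hF]
  rw [integral_const_mul, integral_complex_ofReal, (wrightDensity_moment hα k).2, add_comm (α * (k : ℝ)) 1]
  have := Nat.cast_ne_zero (R := ℂ).2 k.factorial_ne_zero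
  push_cast
  field_simp

/-- The Gauss kernel `G(t,x) = (4πt)^{-N/2} exp(-|x|²/(4t))` on `ℝ^N`. -/
def heatKernel {N : ℕ} (t : ℝ) (x : EuclideanSpace ℝ (Fin N)) : ℝ :=
  1 / (4 * Real.pi * t) ^ ((N : ℝ) / 2) * Real.exp (-‖x‖ ^ 2 / (4 * t))

/-- `(e^{tΔ} μ)(x) = ∫ G(t, x - y) dμ(y)`, with values in `[0,∞]`. -/
def heat {N : ℕ} (t : ℝ) (μ : Measure (EuclideanSpace ℝ (Fin N)))
    (x : EuclideanSpace ℝ (Fin N)) : ℝ≥0∞ :=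
  ∫⁻ y, ENNReal.ofReal (heatKernel t (x - y)) ∂μ

/-- `P_α(t) μ = ∫_0^∞ h_α(θ) e^{t^α θ Δ} μ dθ`. -/
def opP {N : ℕ} (α t : ℝ) (μ : Measure (EuclideanSpace ℝ (Fin N)))
    (x : EuclideanSpace ℝ (Fin N)) : ℝ≥0∞ :=
  ∫⁻ θ in Ioi (0 : ℝ), ENNReal.ofReal (wrightDensity α θ) * heat (t ^ α * θ) μ x

/-- `S_α(t) μ = ∫_0^∞ θ h_α(θ) e^{t^α θ Δ} μ dθ`. -/
def opS {N : ℕ} (α t : ℝ) (μ : Measure (EuclideanSpace ℝ (Fin N)))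
    (x : EuclideanSpace ℝ (Fin N)) : ℝ≥0∞ :=
  ∫⁻ θ in Ioi (0 : ℝ), ENNReal.ofReal (θ * wrightDensity α θ) * heat (t ^ α * θ) μ x

/-- `u` is a solution in `[0,T] × ℝ^N` of `∂_t^α u - Δu = u^p`, `u(0) = μ`: a nonnegative measurable
function such that, for almost all `(t,x) ∈ (0,T] × ℝ^N`,
`∞ > u(t,x) = [P_α(t)μ](x) + α ∫_0^t (t-s)^{α-1} [S_α(t-s) u(s)^p](x) ds`.
A nonnegative function `f` is identified with the measure `f dx`. Only the values of `u` on
`(0,T] × ℝ^N` matter. -/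
def IsSolution {N : ℕ} (α p T : ℝ) (μ : Measure (EuclideanSpace ℝ (Fin N)))
    (u : ℝ × EuclideanSpace ℝ (Fin N) → ℝ≥0∞) : Prop :=
  Measurable u ∧
  ∀ᵐ z ∂(volume.restrict (Ioc (0 : ℝ) T ×ˢ (univ : Set (EuclideanSpace ℝ (Fin N))))),
    u z < ∞ ∧
    u z = opP α z.1 μ z.2 + ENNReal.ofReal α *
      ∫⁻ s in Ioo (0 : ℝ) z.1, ENNReal.ofReal ((z.1 - s) ^ (α - 1)) *
        opS α (z.1 - s) (volume.withDensity fun y => u (s, y) ^ p) z.2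

/-- The minimal solution in `[0,T] × ℝ^N`: a solution below every other one almost everywhere. -/
def IsMinimalSolution {N : ℕ} (α p T : ℝ) (μ : Measure (EuclideanSpace ℝ (Fin N)))
    (u : ℝ × EuclideanSpace ℝ (Fin N) → ℝ≥0∞) : Prop :=
  IsSolution α p T μ u ∧
  ∀ v, IsSolution α p T μ v →
    ∀ᵐ z ∂(volume.restrict (Ioc (0 : ℝ) T ×ˢ (univ : Set (EuclideanSpace ℝ (Fin N))))), u z ≤ v z

/-- The life span
`T_α[μ] = sup {T' > 0 : the minimal solution exists in [0,T'] × ℝ^N} ∈ [0,∞]`. -/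
def lifespan {N : ℕ} (α p : ℝ) (μ : Measure (EuclideanSpace ℝ (Fin N))) : ℝ≥0∞ :=
  sSup {τ | ∃ T' : ℝ, 0 < T' ∧ τ = ENNReal.ofReal T' ∧ ∃ u, IsMinimalSolution α p T' μ u}

/-- The initial value `κφ` with `φ(x) = (1+|x|)^{-A}`, as a measure on `ℝ^N`. -/
def decayData (N : ℕ) (A κ : ℝ) : Measure (EuclideanSpace ℝ (Fin N)) :=
  volume.withDensity fun x => ENNReal.ofReal (κ * (1 + ‖x‖) ^ (-A))

/-- `T(α,κ) ≃ F(α,κ)` for all sufficiently small `κ > 0`: there are `c(α), C(α) > 0`, bounded away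
from `0` and `∞` as `α → 1-0`, such that `c(α) F(α,κ) ≤ T(α,κ) ≤ C(α) F(α,κ)`
for all `α ∈ (0,1)` and `κ ∈ (0,κ₀)`, with `κ₀` independent of `α`. -/
def SimeqSmall (T : ℝ → ℝ → ℝ≥0∞) (F : ℝ → ℝ → ℝ) : Prop :=
  ∃ κ₀ ∈ Ioo (0 : ℝ) 1, ∃ c C : ℝ → ℝ,
    (∀ α ∈ Ioo (0 : ℝ) 1, 0 < c α ∧ 0 < C α) ∧
    (∃ m M : ℝ, 0 < m ∧ ∀ᶠ α in 𝓝[<] (1 : ℝ), m ≤ c α ∧ C α ≤ M) ∧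
    ∀ α ∈ Ioo (0 : ℝ) 1, ∀ κ ∈ Ioo (0 : ℝ) κ₀,
      ENNReal.ofReal (c α * F α κ) ≤ T α κ ∧ T α κ ≤ ENNReal.ofReal (C α * F α κ)

end

end TimeFractional

namespace TimeFractional

noncomputable section

/-! Averaging over `h_α` turns the time-fractional problem at time `t` into heat problems at the
random times `t^α θ`, so `T^α` plays the role of parabolic time and `R = T^(α/2)` that of the length
scale. Put `β = 1/(p-1) - min(A,N)/2`; either alternative in the hypothesis makes it positive. The
heat flow of `κφ` decays like `κ τ^(-min(A,N)/2)`, and solvability up to parabolic time `τ` requires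
its size to be at most of order `τ^(-1/(p-1))`. The threshold is `τ^β ~ κ⁻¹`. If `A = N`, the mass
of `φ` in a ball of radius `R` grows like `log R`, and `κ⁻¹` is replaced by `κ⁻¹ / log κ⁻¹`.

Upper bound (`IsSolution.mul_rpow_lt`, `exists_mul_le_of_isSolution`): on the cylinder over the ball
of radius `R`, the linear part gives a lower bound `m` of any solution for times after `T/2`.
Inserting a lower bound into the Duhamel term (`IsSolution.amplify`) yields a better one at slightly
later times. If `R² m^(p-1)` is too large, the iterated bounds grow geometrically while the starting
times stay below `3T/4`, against the finiteness of the solution.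

Lower bound (`le_lifespan`): by `exists_isMinimalSolution` a finite supersolution is enough. The
candidate is the superposition `∫ h_α(θ) G(t^α θ) e^(t^α θ Δ) μ dθ`. The composition rule
`lintegral_duhamel` shows that a source of the same form with weight `F` contributes a superposition
with weight `∫_0^τ F`, so that `F = G'`, `G(0) = 1` is the right choice (`mildMap_subordinate_le`).
The power `p` does not commute with the superposition; a weighted Jensen inequality moves it inside
at the price of an exponential moment of `h_α`.

The composition rule is an identity between two measures on the quadrant, proved by comparing mixed
moments (`duhamelMeasure_eq_splitMeasure`). Uniformity as `α → 1` comes from the moments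
`k!/Γ(1+αk)`: the first is at least 1, the second at most 6, and exponential moments have bounds
continuous in `α` at 1. The bounds are assembled in `simeqSmall_lifespan`. -/

/-! ### Moments of the Wright density -/

theorem measurable_wrightDensity (α : ℝ) : Measurable (wrightDensity α) := by
  have h := (measurable_jointDensity α 0).stronglyMeasurable.integral_prod_right'
    (ν := volume.restrict (Ioo 0 Real.pi))
  have e : wrightDensity α = fun θ => ∫ φ in Ioo 0 Real.pi, jointDensity α 0 (θ, φ) := by
    funext θ
    rw [← pow_mul_wrightDensity, pow_zero, one_mul]
  rw [e]
  exact h.measurable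

/-- The probability measure on `(0,∞)` with density `h_α`. -/
def wrightMeasure (α : ℝ) : Measure ℝ :=
  (volume.restrict (Ioi 0)).withDensity fun θ => ENNReal.ofReal (wrightDensity α θ)

theorem lintegral_wrightMeasure (α : ℝ) (f : ℝ → ℝ≥0∞) :
    ∫⁻ θ, f θ ∂wrightMeasure α =
      ∫⁻ θ in Ioi (0 : ℝ), ENNReal.ofReal (wrightDensity α θ) * f θ := by
  rw [wrightMeasure, lintegral_withDensity_eq_lintegral_mul_non_measurable _
    (measurable_wrightDensity α).ennreal_ofReal (ae_of_all _ fun _ => ENNReal.ofReal_lt_top)]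
  rfl

theorem ae_pos_wrightMeasure (α : ℝ) : ∀ᵐ θ ∂wrightMeasure α, 0 < θ :=
  (withDensity_absolutelyContinuous _ _).ae_le (ae_restrict_mem measurableSet_Ioi)

theorem lintegral_pow_wrightMeasure {α : ℝ} (hα : α ∈ Ioo (0 : ℝ) 1) (k : ℕ) :
    ∫⁻ θ, ENNReal.ofReal (θ ^ k) ∂wrightMeasure α =
      ENNReal.ofReal (k.factorial / Real.Gamma (1 + α * k)) := by
  rw [lintegral_wrightMeasure, ← (wrightDensity_moment hα k).2,
    ofReal_integral_eq_lintegral_ofReal (wrightDensity_moment hα k).1]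
  · refine setLIntegral_congr_fun measurableSet_Ioi fun θ hθ => ?_
    have h0 : (0 : ℝ) < θ := hθ
    rw [ENNReal.ofReal_mul (by positivity), mul_comm]
  · filter_upwards [ae_restrict_mem measurableSet_Ioi] with θ hθ
    have h0 : (0 : ℝ) < θ := hθ
    exact mul_nonneg (by positivity) (wrightDensity_nonneg hα h0)

theorem wrightMeasure_univ {α : ℝ} (hα : α ∈ Ioo (0 : ℝ) 1) : wrightMeasure α univ = 1 := by
  have := lintegral_pow_wrightMeasure hα 0
  simpa using this

instance sigmaFinite_wrightMeasure (α : ℝ) : SigmaFinite (wrightMeasure α) :=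
  SigmaFinite.withDensity_ofReal _

theorem opP_eq {N : ℕ} (α t : ℝ) (μ : Measure (EuclideanSpace ℝ (Fin N)))
    (x : EuclideanSpace ℝ (Fin N)) :
    opP α t μ x = ∫⁻ θ, heat (t ^ α * θ) μ x ∂wrightMeasure α := by
  rw [lintegral_wrightMeasure, opP]

theorem opS_eq {N : ℕ} (α t : ℝ) (μ : Measure (EuclideanSpace ℝ (Fin N)))
    (x : EuclideanSpace ℝ (Fin N)) :
    opS α t μ x = ∫⁻ θ, ENNReal.ofReal θ * heat (t ^ α * θ) μ x ∂wrightMeasure α := by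
  rw [lintegral_wrightMeasure, opS]
  refine setLIntegral_congr_fun measurableSet_Ioi fun θ hθ => ?_
  rw [mul_comm θ, ENNReal.ofReal_mul' (le_of_lt hθ), mul_assoc]

/-- Convexity of `Γ` on `[1,2]`, with the value 1 at both ends. -/
theorem Gamma_one_add_le {α : ℝ} (hα : α ∈ Ioo (0 : ℝ) 1) : Real.Gamma (1 + α) ≤ 1 := by
  have := Real.convexOn_Gamma.2 (mem_Ioi.2 one_pos) (mem_Ioi.2 two_pos)
    (sub_nonneg.2 hα.2.le) hα.1.le (sub_add_cancel 1 α)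
  simp only [smul_eq_mul, Real.Gamma_one, Real.Gamma_two] at this
  calc Real.Gamma (1 + α) = Real.Gamma ((1 - α) * 1 + α * 2) := by ring_nf
    _ ≤ _ := this
    _ = 1 := by ring

theorem lintegral_id_wrightMeasure_ge {α : ℝ} (hα : α ∈ Ioo (0 : ℝ) 1) :
    1 ≤ ∫⁻ θ, ENNReal.ofReal θ ∂wrightMeasure α := by
  have h := lintegral_pow_wrightMeasure hα 1
  simp only [pow_one, Nat.factorial_one, Nat.cast_one, mul_one] at h
  rw [h, ← ENNReal.ofReal_one]
  apply ENNReal.ofReal_le_ofReal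
  rw [le_div_iff₀ (Real.Gamma_pos_of_pos (by linarith [hα.1])), one_mul]
  exact Gamma_one_add_le hα

/-- The moment is `2/Γ(1+2α)`, and cutting Euler's integral at 1 gives `Γ(1+2α) ≥ e⁻¹ ≥ 1/3`. -/
theorem lintegral_sq_wrightMeasure_le {α : ℝ} (hα : α ∈ Ioo (0 : ℝ) 1) :
    ∫⁻ θ, ENNReal.ofReal (θ ^ 2) ∂wrightMeasure α ≤ ENNReal.ofReal 6 := by
  rw [lintegral_pow_wrightMeasure hα 2]
  apply ENNReal.ofReal_le_ofReal
  have hG := Gamma_lower (s := α * 2) (R := 1) (by linarith [hα.1]) (by norm_num)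
  rw [Real.one_rpow, one_mul] at hG
  have he : (1 : ℝ) / 3 ≤ Real.exp (-1) := by
    rw [Real.exp_neg, ← one_div]
    exact one_div_le_one_div_of_le (Real.exp_pos 1) (by linarith [Real.exp_one_lt_d9])
  push_cast
  rw [div_le_iff₀ (lt_of_lt_of_le (Real.exp_pos _) hG)]
  norm_num [Nat.factorial]
  linarith

/-- A part of the first moment of `h_α`, bounded below uniformly in `α`, lives on `(1/2, 24]`. -/
theorem lintegral_id_Ioc_wrightMeasure_ge {α : ℝ} (hα : α ∈ Ioo (0 : ℝ) 1) :
    ENNReal.ofReal (1 / 4) ≤ ∫⁻ θ in Ioc (1 / 2) 24, ENNReal.ofReal θ ∂wrightMeasure α := by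
  set I := ∫⁻ θ in Ioc (1 / 2) 24, ENNReal.ofReal θ ∂wrightMeasure α with hI
  have h : (1 : ℝ≥0∞) ≤ ENNReal.ofReal (1 / 2) + I + ENNReal.ofReal (1 / 4) := by
    calc (1 : ℝ≥0∞) ≤ ∫⁻ θ, ENNReal.ofReal θ ∂wrightMeasure α := lintegral_id_wrightMeasure_ge hα
      -- Below 1/2 the part of the first moment is at most 1/2, as the total mass is one. Above 24
      -- one has `θ ≤ θ²/24`, so the second moment bounds this part by `6/24 = 1/4`. At least 1/4 of
      -- the first moment remains.
      _ ≤ ∫⁻ θ, (ENNReal.ofReal (1 / 2) + (Ioc (1 / 2) 24).indicator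
            (fun θ => ENNReal.ofReal θ) θ) +
            ENNReal.ofReal (1 / 24) * ENNReal.ofReal (θ ^ 2) ∂wrightMeasure α := by
          refine lintegral_mono fun θ => ?_
          rcases le_or_gt θ (1 / 2) with h1 | h1
          · exact (ENNReal.ofReal_le_ofReal h1).trans (le_add_right le_self_add)
          · rcases le_or_gt θ 24 with h2 | h2
            · rw [indicator_of_mem (show θ ∈ Ioc (1 / 2) 24 from ⟨h1, h2⟩)]
              exact le_add_right le_add_self
            · rw [← ENNReal.ofReal_mul (by norm_num)]
              refine le_add_left (ENNReal.ofReal_le_ofReal ?_)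
              nlinarith
      _ = ENNReal.ofReal (1 / 2) + I +
            ENNReal.ofReal (1 / 24) * ∫⁻ θ, ENNReal.ofReal (θ ^ 2) ∂wrightMeasure α := by
          rw [lintegral_add_right _ (by fun_prop), lintegral_add_left (by fun_prop),
            lintegral_const, wrightMeasure_univ hα, mul_one, lintegral_const_mul _ (by fun_prop),
            lintegral_indicator measurableSet_Ioc]
      _ ≤ ENNReal.ofReal (1 / 2) + I + ENNReal.ofReal (1 / 24) * ENNReal.ofReal 6 := by
          gcongr
          exact lintegral_sq_wrightMeasure_le hα
      _ = _ := by
          rw [← ENNReal.ofReal_mul (by norm_num)]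
          norm_num
  by_contra! hlt
  have h2 : ENNReal.ofReal (1 / 2) + I + ENNReal.ofReal (1 / 4) <
      ENNReal.ofReal (1 / 2) + ENNReal.ofReal (1 / 4) + ENNReal.ofReal (1 / 4) :=
    ENNReal.add_lt_add_right ENNReal.ofReal_ne_top
      (ENNReal.add_lt_add_left ENNReal.ofReal_ne_top hlt)
  have h3 := h.trans_lt h2
  rw [← ENNReal.ofReal_add (by norm_num) (by norm_num),
    ← ENNReal.ofReal_add (by norm_num) (by norm_num)] at h3
  norm_num at h3

theorem wrightMeasure_Ioc_ge {α : ℝ} (hα : α ∈ Ioo (0 : ℝ) 1) :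
    ENNReal.ofReal (1 / 96) ≤ wrightMeasure α (Ioc (1 / 2) 24) := by
  have h := lintegral_id_Ioc_wrightMeasure_ge hα
  have h2 : ∫⁻ θ in Ioc (1 / 2) 24, ENNReal.ofReal θ ∂wrightMeasure α ≤
      ENNReal.ofReal 24 * wrightMeasure α (Ioc (1 / 2) 24) := by
    rw [← setLIntegral_const]
    exact setLIntegral_mono (by fun_prop) fun θ hθ => ENNReal.ofReal_le_ofReal hθ.2
  calc ENNReal.ofReal (1 / 96) = ENNReal.ofReal (1 / 24) * ENNReal.ofReal (1 / 4) := by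
        rw [← ENNReal.ofReal_mul (by norm_num)]; norm_num
    _ ≤ ENNReal.ofReal (1 / 24) * (ENNReal.ofReal 24 * wrightMeasure α (Ioc (1 / 2) 24)) := by
        gcongr; exact h.trans h2
    _ = _ := by
        rw [← mul_assoc, ← ENNReal.ofReal_mul (by norm_num)]; norm_num

/-- Exponential moments of `h_α`. -/
theorem lintegral_exp_wrightMeasure_le {α : ℝ} (hα : α ∈ Ioo (0 : ℝ) 1) {b : ℝ} (hb : 0 ≤ b) :
    ∫⁻ θ, ENNReal.ofReal (Real.exp (b * θ)) ∂wrightMeasure α ≤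
      ENNReal.ofReal (2 * Real.exp ((2 * b + 1) ^ (1 / α))) := by
  have e : ∀ᵐ θ ∂wrightMeasure α, ENNReal.ofReal (Real.exp (b * θ)) =
      ∑' k : ℕ, ENNReal.ofReal (b ^ k / k.factorial) * ENNReal.ofReal (θ ^ k) := by
    filter_upwards [ae_pos_wrightMeasure α] with θ hθ
    have hs := NormedSpace.expSeries_div_hasSum_exp (b * θ)
    rw [← Real.exp_eq_exp_ℝ] at hs
    rw [← hs.tsum_eq, ENNReal.ofReal_tsum_of_nonneg (fun k => by positivity) hs.summable]
    refine tsum_congr fun k => ?_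
    rw [← ENNReal.ofReal_mul (by positivity), mul_pow, mul_div_right_comm]
  rw [lintegral_congr_ae e, lintegral_tsum fun k => by fun_prop]
  -- The `k`-th term of the series is `b^k/Γ(1+αk)`. This `R` makes `R^(αk) = (2b+1)^k`, so
  -- `Gamma_lower` bounds the term by `e^R (b/(2b+1))^k ≤ e^R 2^(-k)`.
  set R : ℝ := (2 * b + 1) ^ (1 / α) with hR
  have hR0 : 0 ≤ R := by positivity
  have hα0 := hα.1
  have hgeo : HasSum (fun k : ℕ => Real.exp R * (1 / 2 : ℝ) ^ k) (Real.exp R * 2) :=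
    hasSum_geometric_two.mul_left _
  rw [mul_comm 2, ← hgeo.tsum_eq,
    ENNReal.ofReal_tsum_of_nonneg (fun k => by positivity) hgeo.summable]
  refine ENNReal.tsum_le_tsum fun k => ?_
  rw [lintegral_const_mul _ (by fun_prop), lintegral_pow_wrightMeasure hα,
    ← ENNReal.ofReal_mul (by positivity)]
  apply ENNReal.ofReal_le_ofReal
  have hl := Gamma_lower (s := α * k) (R := R) (by positivity) hR0
  have hRk : R ^ (α * k) = (2 * b + 1) ^ k := by
    rw [hR, ← Real.rpow_mul (by positivity), ← Real.rpow_natCast]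
    congr 1; field_simp
  rw [hRk] at hl
  have hG := Real.Gamma_pos_of_pos (s := 1 + α * k) (by positivity)
  rw [div_mul_div_cancel₀ (by positivity), div_le_iff₀ hG]
  have h1 : b ^ k ≤ (1 / 2 : ℝ) ^ k * (2 * b + 1) ^ k := by
    rw [← mul_pow]; exact pow_le_pow_left₀ hb (by linarith) k
  calc b ^ k ≤ (1 / 2 : ℝ) ^ k * (2 * b + 1) ^ k := h1
    _ = Real.exp R * (1 / 2 : ℝ) ^ k * ((2 * b + 1) ^ k * Real.exp (-R)) := by
      rw [Real.exp_neg]; field_simp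
    _ ≤ _ := by gcongr

/-! ### Beta integrals and measures determined by mixed moments -/

theorem lintegral_Ioo_zero_eq {t : ℝ} (ht : 0 < t) (f : ℝ → ℝ≥0∞) :
    ∫⁻ s in Ioo 0 t, f s = ENNReal.ofReal t * ∫⁻ ρ in Ioo (0 : ℝ) 1, f (t * ρ) := by
  have him : (fun ρ => t * ρ) '' Ioo (0 : ℝ) 1 = Ioo 0 t := by
    rw [image_mul_left_Ioo ht]; simp
  rw [← him, lintegral_image_eq_lintegral_abs_deriv_mul measurableSet_Ioo (f' := fun _ => t)
    (fun x _ => by simpa using ((hasDerivAt_id x).const_mul t).hasDerivWithinAt)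
    (fun x _ y _ hxy => mul_left_cancel₀ ht.ne' hxy), abs_of_pos ht,
    lintegral_const_mul' _ _ ENNReal.ofReal_ne_top]

theorem lintegral_beta {a b : ℝ} (ha : 0 < a) (hb : 0 < b) :
    ∫⁻ ρ in Ioo (0 : ℝ) 1, ENNReal.ofReal ((1 - ρ) ^ (a - 1) * ρ ^ (b - 1)) =
      ENNReal.ofReal (Real.Gamma a * Real.Gamma b / Real.Gamma (a + b)) := by
  have h := ProbabilityTheory.lintegral_betaPDF_eq_one hb ha
  rw [ProbabilityTheory.lintegral_betaPDF] at h
  have hpos := ProbabilityTheory.beta_pos hb ha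
  have e : ∫⁻ ρ in Ioo (0 : ℝ) 1,
      ENNReal.ofReal (1 / ProbabilityTheory.beta b a * ρ ^ (b - 1) * (1 - ρ) ^ (a - 1)) =
      ENNReal.ofReal (1 / ProbabilityTheory.beta b a) *
        ∫⁻ ρ in Ioo (0 : ℝ) 1, ENNReal.ofReal ((1 - ρ) ^ (a - 1) * ρ ^ (b - 1)) := by
    rw [← lintegral_const_mul' _ _ ENNReal.ofReal_ne_top]
    refine lintegral_congr fun ρ => ?_
    rw [← ENNReal.ofReal_mul (by positivity)]
    congr 1; ring
  rw [e] at h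
  have h2 : Real.Gamma a * Real.Gamma b / Real.Gamma (a + b) = ProbabilityTheory.beta b a := by
    rw [ProbabilityTheory.beta, mul_comm, add_comm]
  rw [h2]
  calc _ = ENNReal.ofReal (ProbabilityTheory.beta b a) *
        (ENNReal.ofReal (1 / ProbabilityTheory.beta b a) *
        ∫⁻ ρ in Ioo (0 : ℝ) 1, ENNReal.ofReal ((1 - ρ) ^ (a - 1) * ρ ^ (b - 1))) := by
        rw [← mul_assoc, ← ENNReal.ofReal_mul hpos.le, mul_one_div_cancel hpos.ne']
        simp
    _ = _ := by rw [h, mul_one]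

/-- Exponential moments depend on the mixed moments alone, since all terms are nonnegative and no
convergence is needed. This carries their finiteness from one measure to another with equal mixed
moments. -/
theorem lintegral_exp_add_eq_tsum {μ : Measure (ℝ × ℝ)} (h0 : ∀ᵐ z ∂μ, 0 ≤ z.1 ∧ 0 ≤ z.2)
    {c : ℝ} (hc : 0 ≤ c) :
    ∫⁻ z, ENNReal.ofReal (Real.exp (c * (z.1 + z.2))) ∂μ =
      ∑' n : ℕ, ENNReal.ofReal (c ^ n / n.factorial) * ∑ m ∈ Finset.range (n + 1),
        ENNReal.ofReal (n.choose m) * ∫⁻ z, ENNReal.ofReal (z.1 ^ m * z.2 ^ (n - m)) ∂μ := by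
  have e : ∀ᵐ z ∂μ, ENNReal.ofReal (Real.exp (c * (z.1 + z.2))) =
      ∑' n : ℕ, ENNReal.ofReal (c ^ n / n.factorial) * ∑ m ∈ Finset.range (n + 1),
        ENNReal.ofReal (n.choose m) * ENNReal.ofReal (z.1 ^ m * z.2 ^ (n - m)) := by
    filter_upwards [h0] with z hz
    obtain ⟨h1, h2⟩ := hz
    have hs := NormedSpace.expSeries_div_hasSum_exp (c * (z.1 + z.2))
    rw [← Real.exp_eq_exp_ℝ] at hs
    rw [← hs.tsum_eq, ENNReal.ofReal_tsum_of_nonneg (fun k => by positivity) hs.summable]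
    refine tsum_congr fun n => ?_
    have e1 : (c * (z.1 + z.2)) ^ n / n.factorial = c ^ n / n.factorial *
        ∑ m ∈ Finset.range (n + 1), (n.choose m : ℝ) * (z.1 ^ m * z.2 ^ (n - m)) := by
      rw [mul_pow, add_pow, mul_div_right_comm]
      congr 1
      exact Finset.sum_congr rfl fun m _ => by ring
    rw [e1, ENNReal.ofReal_mul (by positivity),
      ENNReal.ofReal_sum_of_nonneg fun m _ => by positivity]
    congr 1
    exact Finset.sum_congr rfl fun m _ => ENNReal.ofReal_mul (by positivity)
  rw [lintegral_congr_ae e, lintegral_tsum fun k => by fun_prop]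
  refine tsum_congr fun n => ?_
  rw [lintegral_const_mul _ (by fun_prop), lintegral_finsetSum _ fun m _ => by fun_prop]
  congr 1
  exact Finset.sum_congr rfl fun m _ => lintegral_const_mul _ (by fun_prop)

/-- The exponential series may be integrated termwise, dominated by the series of `exp (c (z₁ +
z₂))` with `c = |L(1,0)| + |L(0,1)|`. The characteristic function is thereby a function of the mixed
moments. -/
theorem hasSum_charFunDual {μ : Measure (ℝ × ℝ)} (h0 : ∀ᵐ z ∂μ, 0 ≤ z.1 ∧ 0 ≤ z.2)
    (hexp : ∀ c : ℝ, 0 ≤ c → ∫⁻ z, ENNReal.ofReal (Real.exp (c * (z.1 + z.2))) ∂μ < ∞)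
    (L : StrongDual ℝ (ℝ × ℝ)) :
    HasSum (fun n : ℕ => Complex.I ^ n / n.factorial * ∑ m ∈ Finset.range (n + 1),
      ((n.choose m * (L (1, 0)) ^ m * (L (0, 1)) ^ (n - m) *
        (∫⁻ z, ENNReal.ofReal (z.1 ^ m * z.2 ^ (n - m)) ∂μ).toReal : ℝ) : ℂ))
      (charFunDual μ L) := by
  set a := L (1, 0)
  set b := L (0, 1)
  have hL : ∀ z : ℝ × ℝ, L z = z.1 * a + z.2 * b := by
    intro z
    have : z = z.1 • ((1 : ℝ), (0 : ℝ)) + z.2 • ((0 : ℝ), (1 : ℝ)) := by ext <;> simp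
    conv_lhs => rw [this]
    simp only [map_add, map_smul, smul_eq_mul, a, b]
  have hint : ∀ c : ℝ, 0 ≤ c → Integrable (fun z : ℝ × ℝ => Real.exp (c * (z.1 + z.2))) μ := by
    intro c hc
    refine ⟨by fun_prop, ?_⟩
    rw [hasFiniteIntegral_iff_ofReal (ae_of_all _ fun z => (Real.exp_pos _).le)]
    exact hexp c hc
  have hmom : ∀ j k : ℕ, Integrable (fun z : ℝ × ℝ => z.1 ^ j * z.2 ^ k) μ ∧
      ∫ z, z.1 ^ j * z.2 ^ k ∂μ =
        (∫⁻ z, ENNReal.ofReal (z.1 ^ j * z.2 ^ k) ∂μ).toReal := by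
    intro j k
    have hnn : 0 ≤ᵐ[μ] fun z : ℝ × ℝ => z.1 ^ j * z.2 ^ k := by
      filter_upwards [h0] with z hz
      have := hz.1
      have := hz.2
      simp only [Pi.zero_apply]
      positivity
    refine ⟨?_, integral_eq_lintegral_of_nonneg_ae hnn (by fun_prop)⟩
    refine Integrable.mono' ((hint 1 zero_le_one).const_mul ((j.factorial : ℝ) * k.factorial))
      (by fun_prop) ?_
    filter_upwards [h0] with z hz
    obtain ⟨h1, h2⟩ := hz
    rw [Real.norm_of_nonneg (by positivity), one_mul, Real.exp_add]
    have e1 := Real.pow_div_factorial_le_exp z.1 h1 j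
    have e2 := Real.pow_div_factorial_le_exp z.2 h2 k
    rw [div_le_iff₀ (by positivity)] at e1 e2
    calc z.1 ^ j * z.2 ^ k ≤ (Real.exp z.1 * j.factorial) * (Real.exp z.2 * k.factorial) := by
          gcongr
      _ = _ := by ring
  set c := |a| + |b|
  have hkey := hasSum_integral_of_dominated_convergence (μ := μ)
    (F := fun (n : ℕ) (z : ℝ × ℝ) => ((L z : ℂ) * Complex.I) ^ n / (n.factorial : ℂ))
    (f := fun z => Complex.exp ((L z : ℂ) * Complex.I))
    (fun n z => (c * (z.1 + z.2)) ^ n / n.factorial)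
    (fun n => (Continuous.aestronglyMeasurable (by fun_prop))) ?_ ?_ ?_ ?_
  · rw [charFunDual_apply]
    convert! hkey using 2 with n
    have e : ∀ z : ℝ × ℝ, ((L z : ℂ) * Complex.I) ^ n / (n.factorial : ℂ) =
        Complex.I ^ n / n.factorial * ((∑ m ∈ Finset.range (n + 1),
          n.choose m * a ^ m * b ^ (n - m) * (z.1 ^ m * z.2 ^ (n - m)) : ℝ) : ℂ) := by
      intro z
      rw [mul_pow, ← Complex.ofReal_pow, hL, add_pow, mul_comm _ (Complex.I ^ n),
        mul_div_right_comm]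
      congr 2
      exact Finset.sum_congr rfl fun m _ => by ring
    simp only [e]
    rw [integral_const_mul, integral_complex_ofReal,
      integral_finsetSum _ fun m _ => (hmom m (n - m)).1.const_mul _]
    congr 1
    push_cast
    refine Finset.sum_congr rfl fun m _ => ?_
    rw [integral_const_mul, (hmom m (n - m)).2]
    push_cast
    rfl
  · intro n
    filter_upwards [h0] with z hz
    obtain ⟨h1, h2⟩ := hz
    rw [norm_div, norm_pow, norm_mul, Complex.norm_I, mul_one, Complex.norm_real,
      Complex.norm_natCast, hL, Real.norm_eq_abs]
    gcongr
    calc |z.1 * a + z.2 * b| ≤ |z.1 * a| + |z.2 * b| := abs_add_le _ _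
      _ = z.1 * |a| + z.2 * |b| := by rw [abs_mul, abs_mul, abs_of_nonneg h1, abs_of_nonneg h2]
      _ ≤ _ := by
        have := abs_nonneg a
        have := abs_nonneg b
        simp only [c]
        nlinarith [mul_nonneg h1 (abs_nonneg b), mul_nonneg h2 (abs_nonneg a)]
  · exact ae_of_all _ fun z => Real.summable_pow_div_factorial _
  · convert! hint c (by positivity) using 2 with z
    rw [Real.exp_eq_exp_ℝ, (NormedSpace.expSeries_div_hasSum_exp (c * (z.1 + z.2))).tsum_eq]
  · refine ae_of_all _ fun z => ?_
    rw [Complex.exp_eq_exp_ℂ]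
    exact NormedSpace.expSeries_div_hasSum_exp _

/-- A measure on the quadrant with exponential moments is determined by its mixed moments. -/
theorem ext_of_mixed_moments {μ ν : Measure (ℝ × ℝ)}
    (hμ : ∀ᵐ z ∂μ, 0 ≤ z.1 ∧ 0 ≤ z.2) (hν : ∀ᵐ z ∂ν, 0 ≤ z.1 ∧ 0 ≤ z.2)
    (hexp : ∀ c : ℝ, 0 ≤ c → ∫⁻ z, ENNReal.ofReal (Real.exp (c * (z.1 + z.2))) ∂ν < ∞)
    (hm : ∀ j k : ℕ, ∫⁻ z, ENNReal.ofReal (z.1 ^ j * z.2 ^ k) ∂μ =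
      ∫⁻ z, ENNReal.ofReal (z.1 ^ j * z.2 ^ k) ∂ν) : μ = ν := by
  -- Exponential moments are assumed for `ν` only; `μ` inherits them through equality of the mixed
  -- moments.
  have hexp' : ∀ c : ℝ, 0 ≤ c →
      ∫⁻ z, ENNReal.ofReal (Real.exp (c * (z.1 + z.2))) ∂μ < ∞ := by
    intro c hc
    rw [lintegral_exp_add_eq_tsum hμ hc]
    simp only [hm]
    rw [← lintegral_exp_add_eq_tsum hν hc]
    exact hexp c hc
  have hfin : ∀ ρ : Measure (ℝ × ℝ),
      (∀ c : ℝ, 0 ≤ c → ∫⁻ z, ENNReal.ofReal (Real.exp (c * (z.1 + z.2))) ∂ρ < ∞) →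
      IsFiniteMeasure ρ := by
    intro ρ h
    have := h 0 le_rfl
    simp only [zero_mul, Real.exp_zero, ENNReal.ofReal_one, lintegral_const, one_mul] at this
    exact ⟨this⟩
  have := hfin μ hexp'
  have := hfin ν hexp
  refine Measure.ext_of_charFunDual (funext fun L => ?_)
  have h1 := hasSum_charFunDual hμ hexp' L
  have h2 := hasSum_charFunDual hν hexp L
  simp only [hm] at h1
  exact h1.unique h2

/-! ### Composition rule for the subordination kernels -/

/-- The law of `((1-ρ)^α η, ρ^α θ)` under `α (1-ρ)^{α-1} η h_α(η) h_α(θ) dρ dη dθ`. -/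
def duhamelMeasure (α : ℝ) : Measure (ℝ × ℝ) :=
  (((volume.restrict (Ioo (0 : ℝ) 1)).withDensity
      fun ρ => ENNReal.ofReal (α * (1 - ρ) ^ (α - 1))).prod
    (((wrightMeasure α).withDensity fun η => ENNReal.ofReal η).prod (wrightMeasure α))).map
    fun z => ((1 - z.1) ^ α * z.2.1, z.1 ^ α * z.2.2)

/-- The law of `(θ(1-ρ), θρ)` under `θ h_α(θ) dθ dρ`. -/
def splitMeasure (α : ℝ) : Measure (ℝ × ℝ) :=
  (((wrightMeasure α).withDensity fun θ => ENNReal.ofReal θ).prod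
    (volume.restrict (Ioo (0 : ℝ) 1))).map fun z => (z.1 * (1 - z.2), z.1 * z.2)

theorem lintegral_duhamelMeasure (α : ℝ) {Φ : ℝ × ℝ → ℝ≥0∞} (hΦ : Measurable Φ) :
    ∫⁻ z, Φ z ∂duhamelMeasure α =
      ∫⁻ ρ in Ioo (0 : ℝ) 1, ENNReal.ofReal (α * (1 - ρ) ^ (α - 1)) *
        ∫⁻ η, ENNReal.ofReal η * ∫⁻ θ, Φ ((1 - ρ) ^ α * η, ρ ^ α * θ)
          ∂wrightMeasure α ∂wrightMeasure α := by
  have : SigmaFinite ((wrightMeasure α).withDensity fun η => ENNReal.ofReal η) :=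
    SigmaFinite.withDensity_ofReal _
  have hg : Measurable fun z : ℝ × ℝ × ℝ => Φ ((1 - z.1) ^ α * z.2.1, z.1 ^ α * z.2.2) := by
    fun_prop
  rw [duhamelMeasure, lintegral_map hΦ (by fun_prop), lintegral_prod _ hg.aemeasurable,
    lintegral_withDensity_eq_lintegral_mul _ (by fun_prop) hg.lintegral_prod_right']
  refine lintegral_congr fun ρ => ?_
  simp only [Pi.mul_apply]
  congr 1
  have hg' : Measurable fun z : ℝ × ℝ => Φ ((1 - ρ) ^ α * z.1, ρ ^ α * z.2) := by fun_prop
  rw [lintegral_prod _ hg'.aemeasurable,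
    lintegral_withDensity_eq_lintegral_mul _ (by fun_prop) hg'.lintegral_prod_right']
  rfl

theorem lintegral_splitMeasure (α : ℝ) {Φ : ℝ × ℝ → ℝ≥0∞} (hΦ : Measurable Φ) :
    ∫⁻ z, Φ z ∂splitMeasure α =
      ∫⁻ θ, ENNReal.ofReal θ * (∫⁻ ρ in Ioo (0 : ℝ) 1, Φ (θ * (1 - ρ), θ * ρ))
        ∂wrightMeasure α := by
  have : SigmaFinite ((wrightMeasure α).withDensity fun η => ENNReal.ofReal η) :=
    SigmaFinite.withDensity_ofReal _
  have hg : Measurable fun z : ℝ × ℝ => Φ (z.1 * (1 - z.2), z.1 * z.2) := by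
    fun_prop
  rw [splitMeasure, lintegral_map hΦ (by fun_prop), lintegral_prod _ hg.aemeasurable,
    lintegral_withDensity_eq_lintegral_mul _ (by fun_prop) hg.lintegral_prod_right']
  rfl

theorem ae_nonneg_of_lintegral_indicator {μ : Measure (ℝ × ℝ)}
    (h : ∫⁻ z, {z : ℝ × ℝ | ¬ (0 ≤ z.1 ∧ 0 ≤ z.2)}.indicator 1 z ∂μ = 0) :
    ∀ᵐ z ∂μ, 0 ≤ z.1 ∧ 0 ≤ z.2 := by
  rw [ae_iff]
  rwa [lintegral_indicator_one] at h
  exact ((measurableSet_le measurable_const measurable_fst).inter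
    (measurableSet_le measurable_const measurable_snd)).compl

theorem measurable_indicator_not_quadrant :
    Measurable ({z : ℝ × ℝ | ¬ (0 ≤ z.1 ∧ 0 ≤ z.2)}.indicator (1 : ℝ × ℝ → ℝ≥0∞)) :=
  measurable_one.indicator ((measurableSet_le measurable_const measurable_fst).inter
    (measurableSet_le measurable_const measurable_snd)).compl

/-- Both sides have the `(j,k)` moment `j! k!/Γ(1+α(j+k+1))`. On the left the factor `B(α(j+1),
αk+1)` cancels the Gamma functions of the two separate moments; on the right `B(j+1, k+1)` cancels
the factorial of the moment of order `j+k+1`. -/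
theorem duhamelMeasure_eq_splitMeasure {α : ℝ} (hα : α ∈ Ioo (0 : ℝ) 1) :
    duhamelMeasure α = splitMeasure α := by
  have hα0 := hα.1
  refine ext_of_mixed_moments ?_ ?_ ?_ ?_
  · refine ae_nonneg_of_lintegral_indicator ?_
    rw [lintegral_duhamelMeasure α measurable_indicator_not_quadrant]
    refine (setLIntegral_congr_fun measurableSet_Ioo fun ρ hρ => ?_).trans lintegral_zero
    have h1 : 0 < 1 - ρ := by linarith [hρ.2]
    have h2 := hρ.1
    have : ∫⁻ η, ENNReal.ofReal η * ∫⁻ θ, {z : ℝ × ℝ | ¬ (0 ≤ z.1 ∧ 0 ≤ z.2)}.indicator 1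
        ((1 - ρ) ^ α * η, ρ ^ α * θ) ∂wrightMeasure α ∂wrightMeasure α = 0 := by
      refine (lintegral_congr_ae ?_).trans lintegral_zero
      filter_upwards [ae_pos_wrightMeasure α] with η hη
      have : ∫⁻ θ, {z : ℝ × ℝ | ¬ (0 ≤ z.1 ∧ 0 ≤ z.2)}.indicator (1 : ℝ × ℝ → ℝ≥0∞)
        ((1 - ρ) ^ α * η, ρ ^ α * θ) ∂wrightMeasure α = 0 := by
        refine (lintegral_congr_ae ?_).trans lintegral_zero
        filter_upwards [ae_pos_wrightMeasure α] with θ hθ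
        refine indicator_of_notMem ?_ _
        simp only [mem_ofPred_eq, not_not]
        constructor <;> positivity
      rw [this, mul_zero]
    simp only [this, mul_zero]
  · refine ae_nonneg_of_lintegral_indicator ?_
    rw [lintegral_splitMeasure α measurable_indicator_not_quadrant]
    refine (lintegral_congr_ae ?_).trans lintegral_zero
    filter_upwards [ae_pos_wrightMeasure α] with θ hθ
    have : ∫⁻ ρ in Ioo (0 : ℝ) 1, {z : ℝ × ℝ | ¬ (0 ≤ z.1 ∧ 0 ≤ z.2)}.indicator
        (1 : ℝ × ℝ → ℝ≥0∞) (θ * (1 - ρ), θ * ρ) = 0 := by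
      refine (setLIntegral_congr_fun measurableSet_Ioo fun ρ hρ => ?_).trans lintegral_zero
      refine indicator_of_notMem ?_ _
      simp only [mem_ofPred_eq, not_not]
      have h1 : 0 < 1 - ρ := by linarith [hρ.2]
      have h2 := hρ.1
      constructor <;> positivity
    rw [this, mul_zero]
  · intro c hc
    rw [lintegral_splitMeasure α (by fun_prop)]
    -- The weight `θ` of the split measure is absorbed by `θ ≤ e^θ`, hence the exponent `c + 1`.
    refine lt_of_le_of_lt ?_ ((lintegral_exp_wrightMeasure_le hα
      (b := c + 1) (by positivity)).trans_lt ENNReal.ofReal_lt_top)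
    refine lintegral_mono_ae ?_
    filter_upwards [ae_pos_wrightMeasure α] with θ hθ
    have : ∫⁻ ρ in Ioo (0 : ℝ) 1, ENNReal.ofReal (Real.exp (c * (θ * (1 - ρ) + θ * ρ))) =
        ENNReal.ofReal (Real.exp (c * θ)) := by
      have e : ∀ ρ : ℝ, c * (θ * (1 - ρ) + θ * ρ) = c * θ := fun ρ => by ring
      simp only [e]
      simp
    rw [this, ← ENNReal.ofReal_mul hθ.le, add_mul, Real.exp_add, mul_comm]
    refine ENNReal.ofReal_le_ofReal (mul_le_mul_of_nonneg_left ?_ (Real.exp_pos _).le)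
    linarith [Real.add_one_le_exp (1 * θ)]
  · intro j k
    rw [lintegral_duhamelMeasure α (by fun_prop), lintegral_splitMeasure α (by fun_prop)]
    have hη : ∫⁻ η, ENNReal.ofReal (η ^ (j + 1)) ∂wrightMeasure α = _ :=
      lintegral_pow_wrightMeasure hα (j + 1)
    have hθ : ∫⁻ θ, ENNReal.ofReal (θ ^ k) ∂wrightMeasure α = _ :=
      lintegral_pow_wrightMeasure hα k
    have e1 : ∀ ρ ∈ Ioo (0 : ℝ) 1, ENNReal.ofReal (α * (1 - ρ) ^ (α - 1)) *
        ∫⁻ η, ENNReal.ofReal η * ∫⁻ θ, ENNReal.ofReal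
          (((1 - ρ) ^ α * η) ^ j * (ρ ^ α * θ) ^ k) ∂wrightMeasure α ∂wrightMeasure α =
        ENNReal.ofReal α * ENNReal.ofReal (((j + 1).factorial / Real.Gamma (1 + α * (j + 1 : ℕ))) *
          (k.factorial / Real.Gamma (1 + α * k))) * ENNReal.ofReal
            ((1 - ρ) ^ (α * (j + 1) - 1) * ρ ^ (α * k + 1 - 1)) := by
      intro ρ hρ
      have h1 : 0 < 1 - ρ := by linarith [hρ.2]
      have h2 := hρ.1
      have i1 : ∀ᵐ η ∂wrightMeasure α, ENNReal.ofReal η * ∫⁻ θ, ENNReal.ofReal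
          (((1 - ρ) ^ α * η) ^ j * (ρ ^ α * θ) ^ k) ∂wrightMeasure α =
          ENNReal.ofReal ((1 - ρ) ^ (α * j) * ρ ^ (α * k) *
            (k.factorial / Real.Gamma (1 + α * k))) * ENNReal.ofReal (η ^ (j + 1)) := by
        filter_upwards [ae_pos_wrightMeasure α] with η hη
        have : ∀ θ : ℝ, ENNReal.ofReal (((1 - ρ) ^ α * η) ^ j * (ρ ^ α * θ) ^ k) =
            ENNReal.ofReal ((1 - ρ) ^ (α * j) * ρ ^ (α * k) * η ^ j) *
              ENNReal.ofReal (θ ^ k) := by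
          intro θ
          rw [← ENNReal.ofReal_mul (by positivity), mul_pow, mul_pow,
            ← Real.rpow_mul_natCast h1.le, ← Real.rpow_mul_natCast h2.le]
          congr 1; ring
        simp only [this]
        rw [lintegral_const_mul _ (by fun_prop), hθ, ← ENNReal.ofReal_mul (by positivity),
          ← ENNReal.ofReal_mul (by positivity), ← ENNReal.ofReal_mul' (by positivity)]
        congr 1; ring
      have g1 := Real.Gamma_pos_of_pos (s := 1 + α * k) (by positivity)
      have g2 := Real.Gamma_pos_of_pos (s := 1 + α * (j + 1 : ℕ)) (by positivity)
      rw [lintegral_congr_ae i1, lintegral_const_mul _ (by fun_prop), hη,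
        ← ENNReal.ofReal_mul (by positivity), ← ENNReal.ofReal_mul (by positivity),
        ← ENNReal.ofReal_mul (by positivity), ← ENNReal.ofReal_mul (by positivity)]
      congr 1
      rw [show α * ((j : ℝ) + 1) - 1 = α - 1 + α * j by ring, Real.rpow_add h1,
        show α * (k : ℝ) + 1 - 1 = α * k by ring]
      ring
    have e2 : ∀ᵐ θ ∂wrightMeasure α, ENNReal.ofReal θ * ∫⁻ ρ in Ioo (0 : ℝ) 1,
        ENNReal.ofReal ((θ * (1 - ρ)) ^ j * (θ * ρ) ^ k) =
        ENNReal.ofReal (Real.Gamma (j + 1) * Real.Gamma (k + 1) / Real.Gamma (j + 1 + (k + 1))) *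
          ENNReal.ofReal (θ ^ (j + k + 1)) := by
      filter_upwards [ae_pos_wrightMeasure α] with θ hθ
      rw [← lintegral_beta (by positivity) (by positivity)]
      have : ∀ ρ : ℝ, ENNReal.ofReal ((θ * (1 - ρ)) ^ j * (θ * ρ) ^ k) =
          ENNReal.ofReal (θ ^ (j + k)) * ENNReal.ofReal
            ((1 - ρ) ^ ((j : ℝ) + 1 - 1) * ρ ^ ((k : ℝ) + 1 - 1)) := by
        intro ρ
        rw [← ENNReal.ofReal_mul (by positivity), add_sub_cancel_right, add_sub_cancel_right,
          Real.rpow_natCast, Real.rpow_natCast, mul_pow, mul_pow]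
        congr 1; ring
      simp only [this]
      rw [lintegral_const_mul _ (by fun_prop), ← mul_assoc, ← ENNReal.ofReal_mul hθ.le, mul_comm]
      congr 2; ring
    rw [setLIntegral_congr_fun measurableSet_Ioo e1, lintegral_congr_ae e2,
      lintegral_const_mul _ (by fun_prop), lintegral_const_mul _ (by fun_prop),
      lintegral_pow_wrightMeasure hα, lintegral_beta (by positivity) (by positivity)]
    have g1 := Real.Gamma_pos_of_pos (s := 1 + α * k) (by positivity)
    have g2 := Real.Gamma_pos_of_pos (s := α * (j + 1)) (by positivity)
    have g3 := Real.Gamma_pos_of_pos (s := 1 + α * (j + k + 1 : ℕ)) (by positivity)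
    have g4 : Real.Gamma (1 + α * (j + 1 : ℕ)) = α * (j + 1) * Real.Gamma (α * (j + 1)) := by
      rw [add_comm, Nat.cast_add, Nat.cast_one, Real.Gamma_add_one (by positivity)]
    have g5 : Real.Gamma (j + 1 + (k + 1)) = (j + k + 1).factorial := by
      rw [← Real.Gamma_nat_eq_factorial]; congr 1; push_cast; ring
    rw [g5, Real.Gamma_nat_eq_factorial, Real.Gamma_nat_eq_factorial, g4,
      ← ENNReal.ofReal_mul (by positivity), ← ENNReal.ofReal_mul (by positivity),
      ← ENNReal.ofReal_mul (by positivity)]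
    congr 1
    rw [show α * ((j : ℝ) + 1) + (α * k + 1) = 1 + α * (j + k + 1 : ℕ) by push_cast; ring,
      add_comm (α * (k : ℝ)) 1, Nat.factorial_succ j]
    have f1 : ((j + k + 1).factorial : ℝ) ≠ 0 := by positivity
    push_cast at g3 ⊢
    field_simp

/-- The composition rule for the two subordination kernels, in integrated form. -/
theorem lintegral_duhamel {α t : ℝ} (hα : α ∈ Ioo (0 : ℝ) 1) (ht : 0 < t)
    {Φ : ℝ × ℝ → ℝ≥0∞} (hΦ : Measurable Φ) :
    ENNReal.ofReal α * ∫⁻ s in Ioo 0 t, ENNReal.ofReal ((t - s) ^ (α - 1)) *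
      ∫⁻ η, ENNReal.ofReal η * ∫⁻ θ, Φ ((t - s) ^ α * η, s ^ α * θ)
        ∂wrightMeasure α ∂wrightMeasure α =
    ∫⁻ θ, (∫⁻ σ in Ioo 0 (t ^ α * θ), Φ (t ^ α * θ - σ, σ)) ∂wrightMeasure α := by
  have hα0 := hα.1
  -- The case of general `t` follows from the equality of measures by `s = tρ`: the arguments scale
  -- by `t^α`, and the factor is `t · t^(α-1) = t^α`.
  have hm : Measurable fun z : ℝ × ℝ =>
      ENNReal.ofReal (t ^ α) * Φ (t ^ α * z.1, t ^ α * z.2) := by fun_prop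
  have h := congrArg (fun μ : Measure (ℝ × ℝ) => ∫⁻ z : ℝ × ℝ,
      ENNReal.ofReal (t ^ α) * Φ (t ^ α * z.1, t ^ α * z.2) ∂μ)
    (duhamelMeasure_eq_splitMeasure hα)
  simp only [lintegral_duhamelMeasure α hm, lintegral_splitMeasure α hm] at h
  convert h using 1
  · rw [lintegral_Ioo_zero_eq ht, ← lintegral_const_mul' _ _ ENNReal.ofReal_ne_top,
      ← lintegral_const_mul' _ _ ENNReal.ofReal_ne_top]
    refine setLIntegral_congr_fun measurableSet_Ioo fun ρ hρ => ?_
    have h1 : 0 < 1 - ρ := by linarith [hρ.2]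
    have h2 := hρ.1
    simp only [lintegral_const_mul' _ _ (ENNReal.ofReal_ne_top (r := t ^ α)),
      mul_left_comm _ (ENNReal.ofReal (t ^ α))]
    rw [← mul_assoc, ← mul_assoc, ← mul_assoc, ← ENNReal.ofReal_mul hα0.le,
      ← ENNReal.ofReal_mul (by positivity), ← ENNReal.ofReal_mul (by positivity)]
    rw [show t - t * ρ = t * (1 - ρ) by ring, Real.mul_rpow ht.le h1.le, Real.mul_rpow ht.le h1.le,
      Real.mul_rpow ht.le h2.le]
    simp only [mul_assoc]
    congr 2
    rw [show t ^ (α - 1) = t ^ α / t by rw [Real.rpow_sub_one ht.ne']]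
    field_simp
  · refine lintegral_congr_ae ?_
    filter_upwards [ae_pos_wrightMeasure α] with θ hθ
    rw [lintegral_Ioo_zero_eq (by positivity), lintegral_const_mul' _ _ ENNReal.ofReal_ne_top,
      ← mul_assoc, ← ENNReal.ofReal_mul hθ.le, mul_comm θ]
    congr 1
    refine lintegral_congr fun ρ => ?_
    congr 2 <;> ring

/-! ### Heat kernel and heat semigroup -/

theorem heatKernel_nonneg {N : ℕ} {t : ℝ} (ht : 0 ≤ t) (x : EuclideanSpace ℝ (Fin N)) :
    0 ≤ heatKernel t x := by
  have := Real.pi_pos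
  unfold heatKernel; positivity

theorem measurable_heatKernel {N : ℕ} :
    Measurable fun z : ℝ × EuclideanSpace ℝ (Fin N) => heatKernel z.1 z.2 := by
  unfold heatKernel; fun_prop

theorem measurable_heatKernel_comp {N : ℕ} {X : Type*} [MeasurableSpace X] {f : X → ℝ}
    {g : X → EuclideanSpace ℝ (Fin N)} (hf : Measurable f) (hg : Measurable g) :
    Measurable fun z => heatKernel (f z) (g z) :=
  measurable_heatKernel.comp (hf.prodMk hg)

theorem lintegral_gaussian {N : ℕ} {b : ℝ} (hb : 0 < b) :
    ∫⁻ y : EuclideanSpace ℝ (Fin N), ENNReal.ofReal (Real.exp (-b * ‖y‖ ^ 2)) =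
      ENNReal.ofReal ((Real.pi / b) ^ ((N : ℝ) / 2)) := by
  have h := GaussianFourier.integral_rexp_neg_mul_sq_norm (V := EuclideanSpace ℝ (Fin N)) hb
  rw [finrank_euclideanSpace_fin] at h
  have hpos : 0 < (Real.pi / b) ^ ((N : ℝ) / 2) := by
    have := Real.pi_pos
    positivity
  rw [← h, ofReal_integral_eq_lintegral_ofReal]
  -- The integral of a non-integrable function is 0 by convention, so the positive value forces
  -- integrability.
  · exact (not_imp_comm.1 integral_undef) (by rw [h]; exact hpos.ne')
  · exact ae_of_all _ fun _ => (Real.exp_pos _).le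

theorem lintegral_heatKernel {N : ℕ} {t : ℝ} (ht : 0 < t) :
    ∫⁻ y : EuclideanSpace ℝ (Fin N), ENNReal.ofReal (heatKernel t y) = 1 := by
  have hπ := Real.pi_pos
  have e : ∀ y : EuclideanSpace ℝ (Fin N), ENNReal.ofReal (heatKernel t y) =
      ENNReal.ofReal (1 / (4 * Real.pi * t) ^ ((N : ℝ) / 2)) *
        ENNReal.ofReal (Real.exp (-(1 / (4 * t)) * ‖y‖ ^ 2)) := by
    intro y
    rw [← ENNReal.ofReal_mul (by positivity), heatKernel]
    congr 3; ring
  simp only [e]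
  rw [lintegral_const_mul _ (by fun_prop), lintegral_gaussian (by positivity),
    ← ENNReal.ofReal_mul (by positivity), show Real.pi / (1 / (4 * t)) = 4 * Real.pi * t by
      field_simp, one_div_mul_cancel (by positivity), ENNReal.ofReal_one]

theorem lintegral_heatKernel_sub {N : ℕ} {t : ℝ} (ht : 0 < t) (x : EuclideanSpace ℝ (Fin N)) :
    ∫⁻ y, ENNReal.ofReal (heatKernel t (x - y)) = 1 := by
  rw [lintegral_sub_left_eq_self (fun y => ENNReal.ofReal (heatKernel t y)),
    lintegral_heatKernel ht]

/-- Completing the square in `z`, around the mean of `x` and `y` with weights `s` and `r`. It makes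
the product of two heat kernels a Gaussian in `z` times the heat kernel at time `r + s`. -/
theorem norm_sq_div_add_norm_sq_div {N : ℕ} {r s : ℝ} (hr : 0 < r) (hs : 0 < s)
    (x y z : EuclideanSpace ℝ (Fin N)) :
    ‖x - z‖ ^ 2 / (4 * r) + ‖z - y‖ ^ 2 / (4 * s) =
      ‖x - y‖ ^ 2 / (4 * (r + s)) +
        (r + s) / (4 * r * s) * ‖z - ((s / (r + s)) • x + (r / (r + s)) • y)‖ ^ 2 := by
  have e1 : x - z = (r / (r + s)) • (x - y) - (z - ((s / (r + s)) • x + (r / (r + s)) • y)) := by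
    have : r / (r + s) = 1 - s / (r + s) := by field_simp; ring
    rw [this]; module
  have e2 : z - y = (s / (r + s)) • (x - y) + (z - ((s / (r + s)) • x + (r / (r + s)) • y)) := by
    have : r / (r + s) = 1 - s / (r + s) := by field_simp; ring
    rw [this]; module
  generalize z - ((s / (r + s)) • x + (r / (r + s)) • y) = w at *
  generalize x - y = v at *
  rw [e1, e2, norm_sub_sq_real, norm_add_sq_real, norm_smul, norm_smul, inner_smul_left,
    inner_smul_left, Real.norm_of_nonneg (by positivity), Real.norm_of_nonneg (by positivity)]
  simp only [conj_trivial]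
  field_simp
  ring

theorem lintegral_heatKernel_mul_heatKernel {N : ℕ} {r s : ℝ} (hr : 0 < r) (hs : 0 < s)
    (x y : EuclideanSpace ℝ (Fin N)) :
    ∫⁻ z, ENNReal.ofReal (heatKernel r (x - z)) * ENNReal.ofReal (heatKernel s (z - y)) =
      ENNReal.ofReal (heatKernel (r + s) (x - y)) := by
  have hπ := Real.pi_pos
  set b := (r + s) / (4 * r * s) with hb
  set m := (s / (r + s)) • x + (r / (r + s)) • y with hm
  have hb0 : 0 < b := by positivity
  set K := 1 / (4 * Real.pi * r) ^ ((N : ℝ) / 2) * (1 / (4 * Real.pi * s) ^ ((N : ℝ) / 2)) *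
    Real.exp (-‖x - y‖ ^ 2 / (4 * (r + s))) with hK
  have e : ∀ z : EuclideanSpace ℝ (Fin N),
      ENNReal.ofReal (heatKernel r (x - z)) * ENNReal.ofReal (heatKernel s (z - y)) =
      ENNReal.ofReal K * ENNReal.ofReal (Real.exp (-b * ‖z - m‖ ^ 2)) := by
    intro z
    rw [← ENNReal.ofReal_mul (heatKernel_nonneg hr.le _), ← ENNReal.ofReal_mul (by positivity)]
    congr 1
    have h1 : Real.exp (-‖x - z‖ ^ 2 / (4 * r)) * Real.exp (-‖z - y‖ ^ 2 / (4 * s)) =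
        Real.exp (-‖x - y‖ ^ 2 / (4 * (r + s))) * Real.exp (-b * ‖z - m‖ ^ 2) := by
      rw [← Real.exp_add, ← Real.exp_add]
      congr 1
      have := norm_sq_div_add_norm_sq_div hr hs x y z
      rw [← hm, ← hb] at this
      rw [neg_div, neg_div, neg_div]
      linarith
    unfold heatKernel
    rw [hK]
    linear_combination (1 / (4 * Real.pi * r) ^ ((N : ℝ) / 2) *
      (1 / (4 * Real.pi * s) ^ ((N : ℝ) / 2))) * h1
  simp only [e]
  rw [lintegral_const_mul _ (by fun_prop),
    lintegral_sub_right_eq_self (fun z => ENNReal.ofReal (Real.exp (-b * ‖z‖ ^ 2))),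
    lintegral_gaussian hb0, ← ENNReal.ofReal_mul (by positivity)]
  congr 1
  have h2 : (Real.pi / b) ^ ((N : ℝ) / 2) = (4 * Real.pi * r) ^ ((N : ℝ) / 2) *
      (4 * Real.pi * s) ^ ((N : ℝ) / 2) * (1 / (4 * Real.pi * (r + s)) ^ ((N : ℝ) / 2)) := by
    rw [mul_one_div, ← Real.mul_rpow (by positivity) (by positivity),
      ← Real.div_rpow (by positivity) (by positivity)]
    congr 1
    rw [hb]; field_simp
  rw [h2, hK, heatKernel]
  have p1 : 0 < (4 * Real.pi * r) ^ ((N : ℝ) / 2) := by positivity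
  have p2 : 0 < (4 * Real.pi * s) ^ ((N : ℝ) / 2) := by positivity
  field_simp

theorem heat_withDensity {N : ℕ} (t : ℝ) {f : EuclideanSpace ℝ (Fin N) → ℝ≥0∞}
    (hf : Measurable f) (x : EuclideanSpace ℝ (Fin N)) :
    heat t (volume.withDensity f) x = ∫⁻ y, ENNReal.ofReal (heatKernel t (x - y)) * f y := by
  rw [heat, lintegral_withDensity_eq_lintegral_mul _ hf
    ((measurable_heatKernel_comp measurable_const (by fun_prop)).ennreal_ofReal)]
  exact lintegral_congr fun y => mul_comm _ _

theorem measurable_heat {N : ℕ} (μ : Measure (EuclideanSpace ℝ (Fin N))) [SFinite μ] :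
    Measurable fun z : ℝ × EuclideanSpace ℝ (Fin N) => heat z.1 μ z.2 := by
  unfold heat
  exact Measurable.lintegral_prod_right'
    (f := fun z : (ℝ × EuclideanSpace ℝ (Fin N)) × EuclideanSpace ℝ (Fin N) =>
      ENNReal.ofReal (heatKernel z.1.1 (z.1.2 - z.2)))
    (measurable_heatKernel_comp (by fun_prop) (by fun_prop)).ennreal_ofReal

theorem measurable_heat_comp {N : ℕ} (μ : Measure (EuclideanSpace ℝ (Fin N))) [SFinite μ]
    {X : Type*} [MeasurableSpace X] {f : X → ℝ} {g : X → EuclideanSpace ℝ (Fin N)}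
    (hf : Measurable f) (hg : Measurable g) : Measurable fun z => heat (f z) μ (g z) := by
  have h := (measurable_heat μ).comp (hf.prodMk hg)
  exact h

/-- Tonelli and the Chapman–Kolmogorov identity for the Gauss kernel. -/
theorem heat_heat {N : ℕ} (μ : Measure (EuclideanSpace ℝ (Fin N))) [SFinite μ] {r s : ℝ}
    (hr : 0 < r) (hs : 0 < s) (x : EuclideanSpace ℝ (Fin N)) :
    heat r (volume.withDensity (heat s μ)) x = heat (r + s) μ x := by
  have hm : Measurable (heat s μ) :=
    measurable_heat_comp μ (f := fun _ => s) (g := fun y => y) measurable_const measurable_id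
  rw [heat_withDensity r hm, heat]
  unfold heat
  calc ∫⁻ z, ENNReal.ofReal (heatKernel r (x - z)) *
        ∫⁻ y, ENNReal.ofReal (heatKernel s (z - y)) ∂μ
      = ∫⁻ z, ∫⁻ y, ENNReal.ofReal (heatKernel r (x - z)) *
          ENNReal.ofReal (heatKernel s (z - y)) ∂μ := by
        refine lintegral_congr fun z => ?_
        rw [lintegral_const_mul' _ _ ENNReal.ofReal_ne_top]
    _ = ∫⁻ y, (∫⁻ z, ENNReal.ofReal (heatKernel r (x - z)) *
          ENNReal.ofReal (heatKernel s (z - y))) ∂μ := by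
        refine lintegral_lintegral_swap (Measurable.aemeasurable ?_)
        exact ((measurable_heatKernel_comp measurable_const (by fun_prop)).ennreal_ofReal).mul
          ((measurable_heatKernel_comp measurable_const (by fun_prop)).ennreal_ofReal)
    _ = _ := lintegral_congr fun y => lintegral_heatKernel_mul_heatKernel hr hs x y

/-- The Dirichlet-type loss of mass of a ball is controlled while `t ≤ 24 R²`. -/
theorem exists_lintegral_closedBall_heatKernel_ge (N : ℕ) :
    ∃ c : ℝ, 0 < c ∧ ∀ (R t : ℝ) (x : EuclideanSpace ℝ (Fin N)), 0 < R → 0 < t →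
      t ≤ 24 * R ^ 2 → ‖x‖ ≤ R →
      ENNReal.ofReal c ≤
        ∫⁻ y in Metric.closedBall 0 R, ENNReal.ofReal (heatKernel t (x - y)) := by
  have hπ := Real.pi_pos
  set ω := (volume (Metric.ball (0 : EuclideanSpace ℝ (Fin N)) 1)).toReal with hω
  have hω0 : 0 < ω := ENNReal.toReal_pos (Metric.measure_ball_pos _ _ one_pos).ne'
    measure_ball_lt_top.ne
  refine ⟨Real.exp (-(1 / 4)) * ω * (1 / (384 * Real.pi)) ^ ((N : ℝ) / 2), by positivity,
    fun R t x hR ht htR hx => ?_⟩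
  set r := min (√t) R with hr
  have hr0 : 0 < r := lt_min (Real.sqrt_pos.2 ht) hR
  have hrR : r ≤ R := min_le_right _ _
  have hrt : r ^ 2 ≤ t := by
    calc r ^ 2 ≤ (√t) ^ 2 := by gcongr; exact min_le_left _ _
      _ = t := Real.sq_sqrt ht.le
  have htr : t ≤ 24 * r ^ 2 := by
    rcases min_choice (√t) R with h | h
    · rw [hr, h, Real.sq_sqrt ht.le]; linarith
    · rw [hr, h]; exact htR
  -- Pulling `x` towards the origin by at most `r/2` gives a centre whose ball of radius `r/2` lies
  -- in the large ball and within distance `r ≤ √t` of `x`. There the Gaussian factor is at least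
  -- `e^(-1/4)`.
  set c := (1 - r / (2 * R)) • x with hc
  have hq : r / (2 * R) ≤ 1 / 2 := by
    rw [div_le_div_iff₀ (by positivity) (by positivity)]; linarith
  have hq0 : 0 < r / (2 * R) := by positivity
  have hqR : r / (2 * R) * R = r / 2 := by field_simp
  have hcn : ‖c‖ ≤ R - r / 2 := by
    rw [hc, norm_smul, Real.norm_of_nonneg (by linarith)]
    calc (1 - r / (2 * R)) * ‖x‖ ≤ (1 - r / (2 * R)) * R := by
          gcongr; linarith
      _ = R - r / 2 := by rw [sub_mul, hqR, one_mul]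
  have hxc : ‖x - c‖ ≤ r / 2 := by
    have : x - c = (r / (2 * R)) • x := by rw [hc]; module
    rw [this, norm_smul, Real.norm_of_nonneg hq0.le, ← hqR]
    gcongr
  have hsub : Metric.ball c (r / 2) ⊆ Metric.closedBall 0 R := by
    intro y hy
    rw [mem_ball_iff_norm] at hy
    rw [mem_closedBall_zero_iff]
    have := norm_add_le (y - c) c
    rw [sub_add_cancel] at this
    linarith
  have hlow : ∀ y ∈ Metric.ball c (r / 2),
      ENNReal.ofReal (1 / (4 * Real.pi * t) ^ ((N : ℝ) / 2) * Real.exp (-(1 / 4))) ≤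
        ENNReal.ofReal (heatKernel t (x - y)) := by
    intro y hy
    rw [mem_ball_iff_norm] at hy
    have h1 : ‖x - y‖ ≤ r := by
      have := norm_sub_le (x - c) (y - c)
      rw [sub_sub_sub_cancel_right] at this
      linarith
    have h2 : ‖x - y‖ ^ 2 ≤ t := le_trans (by gcongr) hrt
    apply ENNReal.ofReal_le_ofReal
    unfold heatKernel
    gcongr
    rw [neg_div, neg_le_neg_iff, div_le_div_iff₀ (by positivity) (by positivity)]
    linarith
  calc ENNReal.ofReal (Real.exp (-(1 / 4)) * ω * (1 / (384 * Real.pi)) ^ ((N : ℝ) / 2))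
      ≤ ENNReal.ofReal (1 / (4 * Real.pi * t) ^ ((N : ℝ) / 2) * Real.exp (-(1 / 4))) *
          volume (Metric.ball c (r / 2)) := by
        rw [Measure.addHaar_ball_of_pos _ _ (by positivity), finrank_euclideanSpace_fin,
          ← ENNReal.ofReal_toReal
            (measure_ball_lt_top (μ := volume) (x := (0 : EuclideanSpace ℝ (Fin N))) (r := 1)).ne,
          ← hω, ← ENNReal.ofReal_mul (by positivity), ← ENNReal.ofReal_mul (by positivity)]
        apply ENNReal.ofReal_le_ofReal
        have e1 : (r / 2) ^ N = ((r / 2) ^ 2) ^ ((N : ℝ) / 2) := by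
          rw [← Real.rpow_natCast_mul (by positivity), ← Real.rpow_natCast]
          congr 1; push_cast; ring
        -- `(r/2)²/(4πt) ≥ 1/(384π)`, because `t ≤ 24 r²` and `384 = 4 · 4 · 24`.
        have e2 : (1 / (384 * Real.pi)) ^ ((N : ℝ) / 2) ≤
            1 / (4 * Real.pi * t) ^ ((N : ℝ) / 2) * (r / 2) ^ N := by
          rw [e1, one_div_mul_eq_div, ← Real.div_rpow (by positivity) (by positivity)]
          refine Real.rpow_le_rpow (by positivity) ?_ (by positivity)
          rw [div_le_div_iff₀ (by positivity) (by positivity)]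
          nlinarith
        calc _ ≤ Real.exp (-(1 / 4)) * ω *
              (1 / (4 * Real.pi * t) ^ ((N : ℝ) / 2) * (r / 2) ^ N) := by gcongr
          _ = _ := by ring
    _ = ∫⁻ y in Metric.ball c (r / 2),
          ENNReal.ofReal (1 / (4 * Real.pi * t) ^ ((N : ℝ) / 2) * Real.exp (-(1 / 4))) := by
        rw [setLIntegral_const]
    _ ≤ ∫⁻ y in Metric.ball c (r / 2), ENNReal.ofReal (heatKernel t (x - y)) :=
        setLIntegral_mono' measurableSet_ball hlow
    _ ≤ _ := lintegral_mono_set hsub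

/-! ### Heat flow of the decaying initial value -/

/-- The integral of `(1+|y|)^{-A}` over the ball of radius `ρ`. -/
def decayMass (N : ℕ) (A ρ : ℝ) : ℝ≥0∞ :=
  ∫⁻ y in Metric.ball (0 : EuclideanSpace ℝ (Fin N)) ρ, ENNReal.ofReal ((1 + ‖y‖) ^ (-A))

theorem heat_decayData_eq {N : ℕ} (A : ℝ) {κ : ℝ} (hκ : 0 ≤ κ) (t : ℝ)
    (x : EuclideanSpace ℝ (Fin N)) :
    heat t (decayData N A κ) x = ENNReal.ofReal κ *
      ∫⁻ y, ENNReal.ofReal (heatKernel t (x - y)) * ENNReal.ofReal ((1 + ‖y‖) ^ (-A)) := by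
  rw [decayData, heat_withDensity _ (by fun_prop), ← lintegral_const_mul' _ _ ENNReal.ofReal_ne_top]
  refine lintegral_congr fun y => ?_
  rw [ENNReal.ofReal_mul hκ, mul_left_comm]

theorem heatKernel_le {N : ℕ} {t : ℝ} (ht : 0 < t) (x : EuclideanSpace ℝ (Fin N)) :
    heatKernel t x ≤ 1 / (4 * Real.pi * t) ^ ((N : ℝ) / 2) := by
  have := Real.pi_pos
  unfold heatKernel
  refine mul_le_of_le_one_right (by positivity) (Real.exp_le_one_iff.2 ?_)
  rw [neg_div]
  have : 0 ≤ ‖x‖ ^ 2 / (4 * t) := by positivity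
  linarith

/-- Split at `|y| = √t`: inside, the kernel is bounded by its maximum; outside, the data are at most
`κ(1+√t)^(-A)` and the kernel has mass one. -/
theorem heat_decayData_le {N : ℕ} {A κ t : ℝ} (hA : 0 < A) (hκ : 0 ≤ κ) (ht : 0 < t)
    (x : EuclideanSpace ℝ (Fin N)) :
    heat t (decayData N A κ) x ≤ ENNReal.ofReal κ *
      (ENNReal.ofReal (1 / (4 * Real.pi * t) ^ ((N : ℝ) / 2)) * decayMass N A (√t) +
        ENNReal.ofReal ((1 + √t) ^ (-A))) := by
  rw [heat_decayData_eq A hκ]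
  gcongr
  rw [← lintegral_add_compl _ (measurableSet_ball (x := (0 : EuclideanSpace ℝ (Fin N)))
    (ε := √t))]
  refine add_le_add ?_ ?_
  · rw [decayMass, ← lintegral_const_mul' _ _ ENNReal.ofReal_ne_top]
    refine lintegral_mono fun y => ?_
    gcongr
    exact heatKernel_le ht _
  · calc _ ≤ ∫⁻ y in (Metric.ball 0 (√t))ᶜ, ENNReal.ofReal ((1 + √t) ^ (-A)) *
          ENNReal.ofReal (heatKernel t (x - y)) := by
          refine setLIntegral_mono' measurableSet_ball.compl fun y hy => ?_
          rw [mem_compl_iff, mem_ball_zero_iff, not_lt] at hy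
          rw [mul_comm]
          gcongr ENNReal.ofReal ?_ * _
          exact Real.rpow_le_rpow_of_nonpos (by positivity) (by linarith) (by linarith)
      _ ≤ ∫⁻ y, ENNReal.ofReal ((1 + √t) ^ (-A)) * ENNReal.ofReal (heatKernel t (x - y)) :=
          setLIntegral_le_lintegral _ _
      _ = _ := by
          rw [lintegral_const_mul' _ _ ENNReal.ofReal_ne_top, lintegral_heatKernel_sub ht, mul_one]

theorem heat_decayData_le_self {N : ℕ} {A κ t : ℝ} (hA : 0 < A) (hκ : 0 ≤ κ) (ht : 0 < t)
    (x : EuclideanSpace ℝ (Fin N)) : heat t (decayData N A κ) x ≤ ENNReal.ofReal κ := by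
  rw [heat_decayData_eq A hκ]
  refine mul_le_of_le_one_right' ?_
  calc _ ≤ ∫⁻ y, ENNReal.ofReal (heatKernel t (x - y)) := by
        refine lintegral_mono fun y => mul_le_of_le_one_right' ?_
        rw [ENNReal.ofReal_le_one]
        exact Real.rpow_le_one_of_one_le_of_nonpos (by linarith [norm_nonneg y]) (by linarith)
    _ = 1 := lintegral_heatKernel_sub ht x

/-- Only the mass in the ball of radius `R` is kept; two points of it are at distance at most `2R`,
whence the factor `exp(-R²/t)`. -/
theorem heat_decayData_ge {N : ℕ} {A κ t R : ℝ} (hκ : 0 ≤ κ) (ht : 0 < t)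
    {x : EuclideanSpace ℝ (Fin N)} (hx : ‖x‖ ≤ R) :
    ENNReal.ofReal κ * (ENNReal.ofReal (1 / (4 * Real.pi * t) ^ ((N : ℝ) / 2) *
      Real.exp (-(R ^ 2 / t))) * decayMass N A R) ≤ heat t (decayData N A κ) x := by
  have hπ := Real.pi_pos
  rw [heat_decayData_eq A hκ]
  gcongr
  refine le_trans ?_ (setLIntegral_le_lintegral (Metric.ball 0 R) _)
  rw [decayMass, ← lintegral_const_mul' _ _ ENNReal.ofReal_ne_top]
  refine setLIntegral_mono' measurableSet_ball fun y hy => ?_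
  rw [mem_ball_zero_iff] at hy
  have h1 : ‖x - y‖ ≤ 2 * R := by linarith [norm_sub_le x y]
  have h2 : ‖x - y‖ ^ 2 ≤ (2 * R) ^ 2 := by gcongr
  unfold heatKernel
  gcongr
  rw [neg_div, neg_le_neg_iff, div_le_div_iff₀ (by positivity) (by positivity)]
  nlinarith

/-- The volume of the unit ball of `ℝ^N`. -/
def unitBallVolume (N : ℕ) : ℝ :=
  (volume : Measure (EuclideanSpace ℝ (Fin N))).real (Metric.ball 0 1)

theorem unitBallVolume_pos (N : ℕ) : 0 < unitBallVolume N :=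
  ENNReal.toReal_pos (Metric.measure_ball_pos _ _ one_pos).ne' measure_ball_lt_top.ne

theorem continuousOn_one_add_rpow (s : ℝ) : ContinuousOn (fun r : ℝ => (1 + r) ^ s) (Ici 0) :=
  ContinuousOn.rpow_const (by fun_prop) fun r hr => Or.inl (by
    have : (0 : ℝ) ≤ r := hr
    positivity)

theorem decayMass_eq {N : ℕ} (hN : 1 ≤ N) (A : ℝ) {ρ : ℝ} (hρ : 0 ≤ ρ) :
    decayMass N A ρ = ENNReal.ofReal (N * (unitBallVolume N *
      ∫ r in (0 : ℝ)..ρ, r ^ (N - 1) * (1 + r) ^ (-A))) := by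
  have : Nonempty (Fin N) := ⟨⟨0, hN⟩⟩
  have h := integral_fun_norm_addHaar (volume : Measure (EuclideanSpace ℝ (Fin N)))
    ((Iio ρ).indicator fun r => (1 + r) ^ (-A))
  have hc : Continuous fun y : EuclideanSpace ℝ (Fin N) => (1 + ‖y‖) ^ (-A) :=
    Continuous.rpow_const (by fun_prop) fun y => Or.inl (by positivity)
  have e1 : ∀ y : EuclideanSpace ℝ (Fin N), (Iio ρ).indicator (fun r => (1 + r) ^ (-A)) ‖y‖ =
      (Metric.ball 0 ρ).indicator (fun y : EuclideanSpace ℝ (Fin N) => (1 + ‖y‖) ^ (-A)) y := by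
    intro y
    by_cases hy : ‖y‖ < ρ
    · rw [indicator_of_mem (show ‖y‖ ∈ Iio ρ from hy), indicator_of_mem (by simpa using hy)]
    · rw [indicator_of_notMem (show ‖y‖ ∉ Iio ρ from hy), indicator_of_notMem (by simpa using hy)]
  simp only [e1] at h
  rw [integral_indicator measurableSet_ball, finrank_euclideanSpace_fin] at h
  have e2 : ∫ y in Ioi (0 : ℝ), y ^ (N - 1) • (Iio ρ).indicator (fun r => (1 + r) ^ (-A)) y =
      ∫ r in (0 : ℝ)..ρ, r ^ (N - 1) * (1 + r) ^ (-A) := by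
    rw [intervalIntegral.integral_of_le hρ, integral_Ioc_eq_integral_Ioo,
      ← Iio_inter_Ioi, inter_comm, ← setIntegral_indicator measurableSet_Iio]
    refine setIntegral_congr_fun measurableSet_Ioi fun r _ => ?_
    by_cases hr : r ∈ Iio ρ
    · simp [indicator_of_mem hr]
    · simp [indicator_of_notMem hr]
  rw [e2, nsmul_eq_mul, smul_eq_mul] at h
  rw [decayMass, ← ofReal_integral_eq_lintegral_ofReal, h, unitBallVolume]
  · exact (hc.continuousOn.integrableOn_compact (isCompact_closedBall 0 ρ)).mono_set
      Metric.ball_subset_closedBall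
  · exact ae_of_all _ fun y => by positivity

theorem integrableOn_decay (N : ℕ) (A ρ : ℝ) :
    IntegrableOn (fun r : ℝ => r ^ (N - 1) * (1 + r) ^ (-A)) (Icc 0 ρ) := by
  refine ContinuousOn.integrableOn_Icc ?_
  exact (continuous_pow _).continuousOn.mul
    ((continuousOn_one_add_rpow _).mono Icc_subset_Ici_self)

/-- Here and in the next two cases the integrand is compared with the derivative of an explicit
function: `r^(N-A)` for `A < N`, `(1+r)^(N-A)` for `A > N` (each up to a constant), and `log(1+r)`
for `A = N`. -/
theorem integral_decay_le_of_lt {N : ℕ} (hN : 1 ≤ N) {A ρ : ℝ} (hA : 0 < A) (h : A < N)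
    (hρ : 0 ≤ ρ) :
    ∫ r in (0 : ℝ)..ρ, r ^ (N - 1) * (1 + r) ^ (-A) ≤ 1 / (N - A) * ρ ^ ((N : ℝ) - A) := by
  have hNA : 0 < (N : ℝ) - A := by linarith
  have := intervalIntegral.integral_le_sub_of_hasDeriv_right_of_le hρ
    (g := fun r => 1 / (N - A) * r ^ ((N : ℝ) - A)) (g' := fun r => r ^ ((N : ℝ) - A - 1))
    (φ := fun r => r ^ (N - 1) * (1 + r) ^ (-A))
    (continuousOn_const.mul (continuousOn_id.rpow_const fun _ _ => Or.inr hNA.le))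
    (fun r hr => ?_) (integrableOn_decay N A ρ) (fun r hr => ?_)
  · simpa [Real.zero_rpow hNA.ne'] using this
  · have h1 := (Real.hasDerivAt_rpow_const (p := (N : ℝ) - A) (Or.inl hr.1.ne')).const_mul
      (1 / ((N : ℝ) - A))
    rw [← mul_assoc, one_div_mul_cancel hNA.ne', one_mul] at h1
    exact h1.hasDerivWithinAt
  · have h0 := hr.1
    have e : r ^ ((N : ℝ) - A - 1) = r ^ (N - 1) * r ^ (-A) := by
      rw [← Real.rpow_natCast, ← Real.rpow_add h0, Nat.cast_sub hN]
      congr 1; push_cast; ring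
    rw [e]
    exact mul_le_mul_of_nonneg_left
      (Real.rpow_le_rpow_of_nonpos h0 (by linarith) (by linarith)) (by positivity)

theorem pow_mul_one_add_rpow_le {N : ℕ} (hN : 1 ≤ N) (A : ℝ) {r : ℝ} (hr : 0 ≤ r) :
    r ^ (N - 1) * (1 + r) ^ (-A) ≤ (1 + r) ^ ((N : ℝ) - A - 1) := by
  have e : (1 + r) ^ ((N : ℝ) - A - 1) = (1 + r) ^ (N - 1) * (1 + r) ^ (-A) := by
    rw [← Real.rpow_natCast, ← Real.rpow_add (by positivity), Nat.cast_sub hN]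
    congr 1; push_cast; ring
  rw [e]
  gcongr
  linarith

theorem integral_decay_le_of_gt {N : ℕ} (hN : 1 ≤ N) {A ρ : ℝ} (h : N < A) (hρ : 0 ≤ ρ) :
    ∫ r in (0 : ℝ)..ρ, r ^ (N - 1) * (1 + r) ^ (-A) ≤ 1 / (A - N) := by
  have hNA : (N : ℝ) - A < 0 := by linarith
  have := intervalIntegral.integral_le_sub_of_hasDeriv_right_of_le hρ
    (g := fun r => 1 / (N - A) * (1 + r) ^ ((N : ℝ) - A))
    (g' := fun r => (1 + r) ^ ((N : ℝ) - A - 1))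
    (φ := fun r => r ^ (N - 1) * (1 + r) ^ (-A))
    (continuousOn_const.mul ((continuousOn_one_add_rpow _).mono Icc_subset_Ici_self))
    (fun r hr => ?_) (integrableOn_decay N A ρ)
    (fun r hr => pow_mul_one_add_rpow_le hN A hr.1.le)
  · refine this.trans ?_
    have h1 : 0 ≤ (1 + ρ) ^ ((N : ℝ) - A) := by positivity
    have h2 : 1 / ((N : ℝ) - A) = -(1 / (A - N)) := by rw [← neg_sub A, one_div_neg_eq_neg_one_div]
    have h3 : 0 < 1 / (A - N) := by
      have : 0 < A - N := by linarith
      positivity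
    rw [h2, add_zero, Real.one_rpow]
    nlinarith
  · have h0 : (1 + r) ≠ 0 := by linarith [hr.1]
    have h1 := (((hasDerivAt_id r).const_add 1).rpow_const (p := (N : ℝ) - A)
      (Or.inl h0)).const_mul (1 / ((N : ℝ) - A))
    simp only [id, one_mul] at h1
    rw [← mul_assoc, one_div_mul_cancel hNA.ne, one_mul] at h1
    exact h1.hasDerivWithinAt

theorem integral_decay_le_of_eq {N : ℕ} (hN : 1 ≤ N) {ρ : ℝ} (hρ : 0 ≤ ρ) :
    ∫ r in (0 : ℝ)..ρ, r ^ (N - 1) * (1 + r) ^ (-(N : ℝ)) ≤ Real.log (1 + ρ) := by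
  have := intervalIntegral.integral_le_sub_of_hasDeriv_right_of_le hρ
    (g := fun r => Real.log (1 + r)) (g' := fun r => 1 / (1 + r))
    (φ := fun r => r ^ (N - 1) * (1 + r) ^ (-(N : ℝ)))
    (ContinuousOn.log (by fun_prop) fun r hr => by linarith [hr.1])
    (fun r hr => ?_) (integrableOn_decay N N ρ)
    (fun r hr => ?_)
  · simpa using this
  · have h0 : (1 + r) ≠ 0 := by linarith [hr.1]
    exact (((hasDerivAt_id r).const_add 1).log h0).hasDerivWithinAt
  · have := pow_mul_one_add_rpow_le hN N hr.1.le
    rwa [sub_self, zero_sub, Real.rpow_neg_one, ← one_div] at this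

/-- For `r ≥ 1` one has `1 + r ≤ 2r`, so the integrand is at least `2^(-N)/r`; the part over `[0,1]`
is dropped. -/
theorem integral_decay_ge_of_eq {N : ℕ} (hN : 1 ≤ N) {ρ : ℝ} (hρ : 1 ≤ ρ) :
    (1 / 2 : ℝ) ^ N * Real.log ρ ≤
      ∫ r in (0 : ℝ)..ρ, r ^ (N - 1) * (1 + r) ^ (-(N : ℝ)) := by
  have hi := integrableOn_decay N N ρ
  have := intervalIntegral.sub_le_integral_of_hasDeriv_right_of_le hρ
    (g := fun r => (1 / 2 : ℝ) ^ N * Real.log r) (g' := fun r => (1 / 2 : ℝ) ^ N * r⁻¹)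
    (φ := fun r => r ^ (N - 1) * (1 + r) ^ (-(N : ℝ)))
    (continuousOn_const.mul (ContinuousOn.log continuousOn_id fun r hr => by
      linarith [hr.1] ))
    (fun r hr => ?_) (hi.mono_set (Icc_subset_Icc_left zero_le_one))
    (fun r hr => ?_)
  · simp only [Real.log_one, mul_zero, sub_zero] at this
    refine this.trans ?_
    rw [intervalIntegral.integral_of_le hρ, intervalIntegral.integral_of_le (by linarith)]
    refine setIntegral_mono_set (hi.mono_set Ioc_subset_Icc_self) ?_
      (Ioc_subset_Ioc_left zero_le_one).eventuallyLE
    filter_upwards [ae_restrict_mem measurableSet_Ioc] with r hr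
    have := hr.1
    simp only [Pi.zero_apply]
    positivity
  · exact ((Real.hasDerivAt_log (by linarith [hr.1])).const_mul _).hasDerivWithinAt
  · have h0 : 0 < r := by linarith [hr.1]
    have e : (1 / 2 : ℝ) ^ N * r⁻¹ = r ^ (N - 1) * (r * 2) ^ (-(N : ℝ)) := by
      rw [Real.rpow_neg (by positivity), Real.rpow_natCast, mul_pow, ← Nat.sub_add_cancel hN,
        pow_succ r (N - 1), Nat.add_sub_cancel]
      field_simp
      rw [← mul_pow]; norm_num
    rw [e]
    gcongr ?_ * ?_
    exact Real.rpow_le_rpow_of_nonpos (by positivity) (by linarith [hr.1]) (by simp)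

theorem decayMass_ge {N : ℕ} (A : ℝ) (hA : 0 < A) {r ρ : ℝ} (hr : 0 < r) (hrρ : r ≤ ρ) :
    ENNReal.ofReal ((1 + r) ^ (-A) * (r ^ N * unitBallVolume N)) ≤ decayMass N A ρ := by
  calc _ = ∫⁻ _ in Metric.ball (0 : EuclideanSpace ℝ (Fin N)) r,
        ENNReal.ofReal ((1 + r) ^ (-A)) := by
        rw [setLIntegral_const, Measure.addHaar_ball_of_pos _ _ hr, finrank_euclideanSpace_fin,
          ENNReal.ofReal_mul (by positivity), ENNReal.ofReal_mul (by positivity), unitBallVolume,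
          measureReal_def, ENNReal.ofReal_toReal measure_ball_lt_top.ne]
    _ ≤ ∫⁻ y in Metric.ball (0 : EuclideanSpace ℝ (Fin N)) r,
        ENNReal.ofReal ((1 + ‖y‖) ^ (-A)) := by
        refine setLIntegral_mono' measurableSet_ball fun y hy => ENNReal.ofReal_le_ofReal ?_
        rw [mem_ball_zero_iff] at hy
        exact Real.rpow_le_rpow_of_nonpos (by positivity) (by linarith) (by linarith)
    _ ≤ _ := lintegral_mono_set (Metric.ball_subset_ball hrρ)

/-- For `A ≤ N` the smallest value of the density on the whole ball is enough; for `A ≥ N` the unit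
ball already carries a fixed mass. At `A = N` the logarithm is lost, and `exists_decayMass_ge_log`
replaces this bound. -/
theorem exists_decayMass_ge {N : ℕ} {A : ℝ} (hA : 0 < A) :
    ∃ c : ℝ, 0 < c ∧ ∀ ρ : ℝ, 1 ≤ ρ →
      ENNReal.ofReal (c * ρ ^ ((N : ℝ) - min A N)) ≤ decayMass N A ρ := by
  have hω := unitBallVolume_pos N
  refine ⟨2 ^ (-A) * unitBallVolume N, by positivity, fun ρ hρ => ?_⟩
  have h0 : 0 < ρ := by linarith
  rcases le_total A N with h | h
  · refine le_trans (ENNReal.ofReal_le_ofReal ?_) (decayMass_ge A hA h0 le_rfl)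
    have e : ρ ^ ((N : ℝ) - A) = ρ ^ N * ρ ^ (-A) := by
      rw [← Real.rpow_natCast, ← Real.rpow_add h0, sub_eq_add_neg]
    rw [min_eq_left h, e]
    calc _ = (2 * ρ) ^ (-A) * (ρ ^ N * unitBallVolume N) := by
          rw [Real.mul_rpow (by norm_num) h0.le]; ring
      _ ≤ _ := by
          exact mul_le_mul_of_nonneg_right (Real.rpow_le_rpow_of_nonpos (by positivity)
            (by linarith) (by linarith)) (by positivity)
  · refine le_trans (ENNReal.ofReal_le_ofReal ?_) (decayMass_ge A hA one_pos hρ)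
    rw [min_eq_right h, sub_self, Real.rpow_zero]
    norm_num

theorem exists_decayMass_ge_log {N : ℕ} (hN : 1 ≤ N) :
    ∃ c : ℝ, 0 < c ∧ ∀ ρ : ℝ, 1 ≤ ρ → ENNReal.ofReal (c * Real.log ρ) ≤ decayMass N N ρ := by
  have hω := unitBallVolume_pos N
  have hN' : (0 : ℝ) < N := by exact_mod_cast hN
  refine ⟨N * (unitBallVolume N * (1 / 2 : ℝ) ^ N), by positivity, fun ρ hρ => ?_⟩
  rw [decayMass_eq hN N (by linarith), mul_assoc, mul_assoc]
  gcongr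
  exact integral_decay_ge_of_eq hN hρ

theorem one_div_four_pi_rpow_le {N : ℕ} {t : ℝ} (ht : 0 < t) :
    1 / (4 * Real.pi * t) ^ ((N : ℝ) / 2) ≤ t ^ (-((N : ℝ) / 2)) := by
  rw [Real.rpow_neg ht.le, ← one_div]
  have hπ := Real.pi_gt_three
  gcongr
  nlinarith

theorem sqrt_rpow_neg {t : ℝ} (ht : 0 < t) (a : ℝ) : (√t) ^ (-a) = t ^ (-(a / 2)) := by
  rw [Real.sqrt_eq_rpow, ← Real.rpow_mul ht.le]
  congr 1; ring

theorem one_add_sqrt_rpow_le {A a t : ℝ} (ha : 0 ≤ a) (haA : a ≤ A) (ht : 0 < t) :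
    (1 + √t) ^ (-A) ≤ t ^ (-(a / 2)) := by
  have hs := Real.sqrt_pos.2 ht
  calc (1 + √t) ^ (-A) ≤ (1 + √t) ^ (-a) :=
        Real.rpow_le_rpow_of_exponent_le (by linarith) (by linarith)
    _ ≤ (√t) ^ (-a) := Real.rpow_le_rpow_of_nonpos hs (by linarith) (by linarith)
    _ = _ := sqrt_rpow_neg ht a

/-- The mass of the ball of radius `√t` is at most of order `(√t)^(N - min A N)`; divided by the
kernel scale `t^(N/2)` it gives the stated rate. The contribution of the exterior is no larger,
because `min A N ≤ A`. -/
theorem exists_heat_decayData_le {N : ℕ} (hN : 1 ≤ N) {A : ℝ} (hA : 0 < A) (hAN : A ≠ N) :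
    ∃ L : ℝ, 0 < L ∧ ∀ κ t : ℝ, 0 ≤ κ → 0 < t → ∀ x : EuclideanSpace ℝ (Fin N),
      heat t (decayData N A κ) x ≤ ENNReal.ofReal (κ * L * t ^ (-(min A N / 2))) := by
  have hω := unitBallVolume_pos N
  have hmain : ∃ D : ℝ, 0 < D ∧ ∀ t : ℝ, 0 < t →
      ∫ r in (0 : ℝ)..√t, r ^ (N - 1) * (1 + r) ^ (-A) ≤
        D * (√t) ^ ((N : ℝ) - min A N) := by
    rcases lt_or_gt_of_ne hAN with h | h
    · refine ⟨1 / (N - A), one_div_pos.2 (by linarith), fun t ht => ?_⟩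
      rw [min_eq_left h.le]
      exact integral_decay_le_of_lt hN hA h (Real.sqrt_nonneg t)
    · refine ⟨1 / (A - N), one_div_pos.2 (by linarith), fun t ht => ?_⟩
      rw [min_eq_right h.le, sub_self, Real.rpow_zero, mul_one]
      exact integral_decay_le_of_gt hN h (Real.sqrt_nonneg t)
  obtain ⟨D, hD, hmain⟩ := hmain
  refine ⟨N * (unitBallVolume N * D) + 1, by positivity, fun κ t hκ ht x => ?_⟩
  have hs := Real.sqrt_pos.2 ht
  refine (heat_decayData_le hA hκ ht x).trans ?_
  rw [decayMass_eq hN A hs.le, ← ENNReal.ofReal_mul (by have := Real.pi_pos; positivity),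
    mul_assoc κ, ENNReal.ofReal_mul hκ, add_mul, one_mul]
  gcongr ENNReal.ofReal κ * ?_
  rw [ENNReal.ofReal_add (by positivity) (by positivity)]
  refine add_le_add (ENNReal.ofReal_le_ofReal ?_) (ENNReal.ofReal_le_ofReal ?_)
  · calc 1 / (4 * Real.pi * t) ^ ((N : ℝ) / 2) * (N * (unitBallVolume N *
          ∫ r in (0 : ℝ)..√t, r ^ (N - 1) * (1 + r) ^ (-A)))
        ≤ t ^ (-((N : ℝ) / 2)) * (N * (unitBallVolume N *
          (D * (√t) ^ ((N : ℝ) - min A N)))) := by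
          have := one_div_four_pi_rpow_le (N := N) ht
          have : 0 ≤ ∫ r in (0 : ℝ)..√t, r ^ (N - 1) * (1 + r) ^ (-A) :=
            intervalIntegral.integral_nonneg hs.le fun r hr => by
              have := hr.1
              positivity
          gcongr
          exact hmain t ht
      _ = _ := by
          rw [← sqrt_rpow_neg ht, ← sqrt_rpow_neg ht,
            show -(min A (N : ℝ)) = -(N : ℝ) + (N - min A N) by ring, Real.rpow_add hs]
          ring
  · exact one_add_sqrt_rpow_le (le_min hA.le (Nat.cast_nonneg N)) (min_le_left _ _) ht

theorem exists_heat_decayData_le_log {N : ℕ} (hN : 1 ≤ N) :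
    ∃ L : ℝ, 0 < L ∧ ∀ κ t : ℝ, 0 ≤ κ → 0 < t → ∀ x : EuclideanSpace ℝ (Fin N),
      heat t (decayData N N κ) x ≤
        ENNReal.ofReal (κ * (L * Real.log (2 + t)) * t ^ (-((N : ℝ) / 2))) := by
  have hω := unitBallVolume_pos N
  have hN' : (0 : ℝ) < N := by exact_mod_cast hN
  refine ⟨N * unitBallVolume N + 2, by positivity, fun κ t hκ ht x => ?_⟩
  have hs := Real.sqrt_pos.2 ht
  have hlog : 0 < Real.log (2 + t) := Real.log_pos (by linarith)
  -- The shift by 2 keeps the logarithm above 1/2 for all `t > 0`, so the exterior part is absorbed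
  -- into the logarithmic term.
  have hlog1 : 1 ≤ 2 * Real.log (2 + t) := by
    have := Real.log_le_log (x := 2) (y := 2 + t) (by norm_num) (by linarith)
    have := Real.log_two_gt_d9
    linarith
  have hlog2 : Real.log (1 + √t) ≤ Real.log (2 + t) := by
    refine Real.log_le_log (by positivity) ?_
    nlinarith [Real.sq_sqrt ht.le, sq_nonneg (√t - 1)]
  refine (heat_decayData_le hN' hκ ht x).trans ?_
  rw [decayMass_eq hN N hs.le, ← ENNReal.ofReal_mul (by have := Real.pi_pos; positivity),
    mul_assoc κ, ENNReal.ofReal_mul hκ]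
  gcongr ENNReal.ofReal κ * ?_
  have hint : 0 ≤ ∫ r in (0 : ℝ)..√t, r ^ (N - 1) * (1 + r) ^ (-(N : ℝ)) :=
    intervalIntegral.integral_nonneg hs.le fun r hr => by
      have := hr.1
      positivity
  have hπ := Real.pi_pos
  rw [← ENNReal.ofReal_add (by positivity) (by positivity)]
  apply ENNReal.ofReal_le_ofReal
  have h1 : 1 / (4 * Real.pi * t) ^ ((N : ℝ) / 2) * (N * (unitBallVolume N *
      ∫ r in (0 : ℝ)..√t, r ^ (N - 1) * (1 + r) ^ (-(N : ℝ)))) ≤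
      t ^ (-((N : ℝ) / 2)) * (N * (unitBallVolume N * Real.log (2 + t))) := by
    have := one_div_four_pi_rpow_le (N := N) ht
    gcongr
    exact (integral_decay_le_of_eq hN hs.le).trans hlog2
  have h2 : (1 + √t) ^ (-(N : ℝ)) ≤ t ^ (-((N : ℝ) / 2)) :=
    one_add_sqrt_rpow_le hN'.le le_rfl ht
  have h3 : 0 < t ^ (-((N : ℝ) / 2)) := by positivity
  nlinarith

/-- Lower bound of the heat flow on the parabolic region of size `R`. -/
theorem heat_decayData_ge_parabolic {N : ℕ} {A κ t R m : ℝ} (hκ : 0 ≤ κ) (hR : 0 < R)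
    (h1 : R ^ 2 / 4 ≤ t) (h2 : t ≤ 24 * R ^ 2) (hm : ENNReal.ofReal m ≤ decayMass N A R)
    {x : EuclideanSpace ℝ (Fin N)} (hx : ‖x‖ ≤ R) :
    ENNReal.ofReal (κ * ((96 * Real.pi) ^ (-((N : ℝ) / 2)) * Real.exp (-4) *
      (R ^ (-(N : ℝ)) * m))) ≤ heat t (decayData N A κ) x := by
  have hπ := Real.pi_pos
  have ht : 0 < t := lt_of_lt_of_le (by positivity) h1
  refine le_trans ?_ (heat_decayData_ge hκ ht hx)
  -- `96π = 4π · 24` comes from `t ≤ 24 R²`; the factor `e⁻⁴` comes from `R²/t ≤ 4`.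
  have e : (96 * Real.pi) ^ (-((N : ℝ) / 2)) * R ^ (-(N : ℝ)) =
      1 / (4 * Real.pi * (24 * R ^ 2)) ^ ((N : ℝ) / 2) := by
    rw [show 4 * Real.pi * (24 * R ^ 2) = 96 * Real.pi * R ^ 2 by ring,
      Real.mul_rpow (x := 96 * Real.pi) (by positivity) (by positivity),
      Real.rpow_neg (by positivity), Real.rpow_neg hR.le, ← Real.rpow_natCast_mul hR.le, one_div,
      mul_inv]
    congr 3; push_cast; ring
  rw [ENNReal.ofReal_mul hκ, show (96 * Real.pi) ^ (-((N : ℝ) / 2)) * Real.exp (-4) *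
      (R ^ (-(N : ℝ)) * m) = (96 * Real.pi) ^ (-((N : ℝ) / 2)) * R ^ (-(N : ℝ)) *
      Real.exp (-4) * m by ring, e, ENNReal.ofReal_mul (by positivity)]
  gcongr ENNReal.ofReal κ * (ENNReal.ofReal (?_ * ?_) * ?_)
  · gcongr
  · gcongr
    rw [div_le_iff₀ ht]
    linarith

/-! ### Upper bound: amplification on parabolic cylinders -/

theorem lintegral_sub_rpow {α a b : ℝ} (hα : 0 < α) (hab : a ≤ b) :
    ENNReal.ofReal α * ∫⁻ s in Ioo a b, ENNReal.ofReal ((b - s) ^ (α - 1)) =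
      ENNReal.ofReal ((b - a) ^ α) := by
  have hi : IntervalIntegrable (fun s => (b - s) ^ (α - 1)) volume a b := by
    have h := (intervalIntegral.intervalIntegrable_rpow' (r := α - 1) (a := b - a) (b := b - b)
      (by linarith)).comp_sub_left b
    simpa using h
  have h : ∫ s in a..b, (b - s) ^ (α - 1) = (b - a) ^ α / α := by
    rw [intervalIntegral.integral_comp_sub_left (fun x => x ^ (α - 1)), sub_self,
      integral_rpow (Or.inl (by linarith)), sub_add_cancel, Real.zero_rpow hα.ne', sub_zero]
  rw [intervalIntegral.integral_of_le hab, integral_Ioc_eq_integral_Ioo] at h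
  rw [← ofReal_integral_eq_lintegral_ofReal, h, ← ENNReal.ofReal_mul hα.le,
    mul_div_cancel₀ _ hα.ne']
  · exact ((intervalIntegrable_iff_integrableOn_Ioc_of_le hab).1 hi).mono_set Ioo_subset_Ioc_self
  · filter_upwards [ae_restrict_mem measurableSet_Ioo] with s hs
    exact Real.rpow_nonneg (by linarith [hs.2]) _

/-- On `1/2 < θ ≤ 24` the heat time `r^α θ` is at most `24 R²`, so the ball retains a fixed share of
the heat started in it, and this range of `θ` carries at least 1/4 of the first moment. All
constants are independent of `α`. -/
theorem opS_ge {N : ℕ} {α r R c : ℝ} (hα : α ∈ Ioo (0 : ℝ) 1) (hr : 0 < r)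
    (hrR : r ^ α ≤ R ^ 2)
    (hc : ∀ (t : ℝ) (x : EuclideanSpace ℝ (Fin N)), 0 < t → t ≤ 24 * R ^ 2 → ‖x‖ ≤ R →
      ENNReal.ofReal c ≤ ∫⁻ y in Metric.closedBall 0 R, ENNReal.ofReal (heatKernel t (x - y)))
    {f : EuclideanSpace ℝ (Fin N) → ℝ≥0∞} (hf : Measurable f) {M : ℝ≥0∞}
    (hM : ∀ᵐ y ∂(volume.restrict (Metric.closedBall 0 R)), M ≤ f y)
    {x : EuclideanSpace ℝ (Fin N)} (hx : ‖x‖ ≤ R) :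
    ENNReal.ofReal (1 / 4) * (ENNReal.ofReal c * M) ≤ opS α r (volume.withDensity f) x := by
  rw [opS_eq]
  calc _ ≤ (∫⁻ θ in Ioc (1 / 2) 24, ENNReal.ofReal θ ∂wrightMeasure α) *
        (ENNReal.ofReal c * M) := by
        gcongr
        exact lintegral_id_Ioc_wrightMeasure_ge hα
    _ = ∫⁻ θ in Ioc (1 / 2) 24, ENNReal.ofReal θ * (ENNReal.ofReal c * M) ∂wrightMeasure α := by
        rw [lintegral_mul_const _ (by fun_prop)]
    _ ≤ ∫⁻ θ in Ioc (1 / 2) 24, ENNReal.ofReal θ * heat (r ^ α * θ) (volume.withDensity f) x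
          ∂wrightMeasure α := by
        refine setLIntegral_mono' measurableSet_Ioc fun θ hθ => ?_
        have hθ0 : 0 < θ := by linarith [hθ.1]
        have h1 := Real.rpow_pos_of_pos hr α
        gcongr
        rw [heat_withDensity _ hf]
        calc ENNReal.ofReal c * M ≤ (∫⁻ y in Metric.closedBall 0 R,
              ENNReal.ofReal (heatKernel (r ^ α * θ) (x - y))) * M := by
              gcongr
              refine hc _ _ (by positivity) ?_ hx
              nlinarith [hθ.2]
          _ = ∫⁻ y in Metric.closedBall 0 R,
              ENNReal.ofReal (heatKernel (r ^ α * θ) (x - y)) * M := by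
              rw [lintegral_mul_const _
                (measurable_heatKernel_comp measurable_const (by fun_prop)).ennreal_ofReal]
          _ ≤ ∫⁻ y in Metric.closedBall 0 R,
              ENNReal.ofReal (heatKernel (r ^ α * θ) (x - y)) * f y := by
              refine lintegral_mono_ae ?_
              filter_upwards [hM] with y hy
              gcongr
          _ ≤ _ := setLIntegral_le_lintegral _ _
    _ ≤ _ := setLIntegral_le_lintegral _ _

/-- One step of the amplification of a lower bound on a cylinder. -/
theorem IsSolution.amplify {N : ℕ} {α p T R c t₀ t₁ m : ℝ} (hα : α ∈ Ioo (0 : ℝ) 1)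
    (hp : 0 ≤ p) (hT : T ^ α ≤ R ^ 2) (hc0 : 0 ≤ c)
    (hc : ∀ (t : ℝ) (x : EuclideanSpace ℝ (Fin N)), 0 < t → t ≤ 24 * R ^ 2 → ‖x‖ ≤ R →
      ENNReal.ofReal c ≤ ∫⁻ y in Metric.closedBall 0 R, ENNReal.ofReal (heatKernel t (x - y)))
    (h0 : 0 ≤ t₀) (h01 : t₀ < t₁) (hm : 0 ≤ m)
    {μ : Measure (EuclideanSpace ℝ (Fin N))} {u : ℝ × EuclideanSpace ℝ (Fin N) → ℝ≥0∞}
    (hu : IsSolution α p T μ u)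
    (hlow : ∀ᵐ z ∂(volume.restrict (Ioc t₀ T ×ˢ Metric.closedBall
      (0 : EuclideanSpace ℝ (Fin N)) R)), ENNReal.ofReal m ≤ u z) :
    ∀ᵐ z ∂(volume.restrict (Ioc t₁ T ×ˢ Metric.closedBall (0 : EuclideanSpace ℝ (Fin N)) R)),
      ENNReal.ofReal (c / 4 * m ^ p * (t₁ - t₀) ^ α) ≤ u z := by
  have hα0 := hα.1
  have hs : ∀ᵐ s ∂(volume.restrict (Ioc t₀ T)), ∀ᵐ y ∂(volume.restrict (Metric.closedBall
      (0 : EuclideanSpace ℝ (Fin N)) R)), ENNReal.ofReal (m ^ p) ≤ u (s, y) ^ p := by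
    rw [Measure.volume_eq_prod, ← Measure.prod_restrict] at hlow
    filter_upwards [Measure.ae_ae_of_ae_prod hlow] with s hs
    filter_upwards [hs] with y hy
    rw [← ENNReal.ofReal_rpow_of_nonneg hm hp]
    gcongr
  have hsub : Ioc t₁ T ×ˢ Metric.closedBall (0 : EuclideanSpace ℝ (Fin N)) R ⊆
      Ioc (0 : ℝ) T ×ˢ univ :=
    prod_mono (Ioc_subset_Ioc_left (by linarith)) (subset_univ _)
  filter_upwards [ae_restrict_of_ae_restrict_of_subset hsub hu.2,
    ae_restrict_mem (measurableSet_Ioc.prod measurableSet_closedBall)] with z hz hzmem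
  obtain ⟨⟨hz1, hzT⟩, hzR⟩ := hzmem
  rw [mem_closedBall_zero_iff] at hzR
  rw [hz.2]
  refine le_add_left ?_
  calc ENNReal.ofReal (c / 4 * m ^ p * (t₁ - t₀) ^ α)
      ≤ ENNReal.ofReal ((z.1 - t₀) ^ α) *
        (ENNReal.ofReal (1 / 4) * (ENNReal.ofReal c * ENNReal.ofReal (m ^ p))) := by
        rw [← ENNReal.ofReal_mul hc0, ← ENNReal.ofReal_mul (by norm_num),
          ← ENNReal.ofReal_mul (Real.rpow_nonneg (by linarith) _)]
        apply ENNReal.ofReal_le_ofReal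
        have h1 : (t₁ - t₀) ^ α ≤ (z.1 - t₀) ^ α :=
          Real.rpow_le_rpow (by linarith) (by linarith) hα0.le
        have h2 : 0 ≤ c / 4 * m ^ p := by positivity
        nlinarith
    _ = ENNReal.ofReal α * ∫⁻ s in Ioo t₀ z.1, ENNReal.ofReal ((z.1 - s) ^ (α - 1)) *
        (ENNReal.ofReal (1 / 4) * (ENNReal.ofReal c * ENNReal.ofReal (m ^ p))) := by
        rw [lintegral_mul_const _ (by fun_prop), ← mul_assoc (ENNReal.ofReal α),
          lintegral_sub_rpow hα0 (by linarith)]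
    _ ≤ ENNReal.ofReal α * ∫⁻ s in Ioo t₀ z.1, ENNReal.ofReal ((z.1 - s) ^ (α - 1)) *
        opS α (z.1 - s) (volume.withDensity fun y => u (s, y) ^ p) z.2 := by
        refine mul_le_mul_right (lintegral_mono_ae ?_) _
        have hsub2 : Ioo t₀ z.1 ⊆ Ioc t₀ T := fun s hs => ⟨hs.1, by linarith [hs.2]⟩
        filter_upwards [ae_restrict_of_ae_restrict_of_subset hsub2 hs,
          ae_restrict_mem measurableSet_Ioo] with s hs hsmem
        refine mul_le_mul_right ?_ _
        refine opS_ge hα (by linarith [hsmem.2]) ?_ hc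
          ((hu.1.comp measurable_prodMk_left).pow_const p) hs hzR
        refine le_trans (Real.rpow_le_rpow ?_ ?_ hα0.le) hT <;> linarith [hsmem.1, hsmem.2]
    _ ≤ _ := by
        refine mul_le_mul_right (lintegral_mono_set (Ioo_subset_Ioo_left h0)) _

/-- A solution forces an upper bound on the linear part. -/
theorem IsSolution.mul_rpow_lt {N : ℕ} {α p T R c m : ℝ} (hα : α ∈ Ioo (0 : ℝ) 1)
    (hp : 1 < p) (hT0 : 0 < T) (hR : 0 < R) (hT : T ^ α = R ^ 2) (hc0 : 0 < c)
    (hc : ∀ (t : ℝ) (x : EuclideanSpace ℝ (Fin N)), 0 < t → t ≤ 24 * R ^ 2 → ‖x‖ ≤ R →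
      ENNReal.ofReal c ≤ ∫⁻ y in Metric.closedBall 0 R, ENNReal.ofReal (heatKernel t (x - y)))
    (hm : 0 < m) {μ : Measure (EuclideanSpace ℝ (Fin N))}
    {u : ℝ × EuclideanSpace ℝ (Fin N) → ℝ≥0∞} (hu : IsSolution α p T μ u)
    (hlow : ∀ t ∈ Ioc (T / 2) T, ∀ x : EuclideanSpace ℝ (Fin N), ‖x‖ ≤ R →
      ENNReal.ofReal m ≤ opP α t μ x) :
    c * R ^ 2 / 32 * m ^ (p - 1) < 2 ^ (1 / (p - 1)) := by
  by_contra! hcon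
  have hα0 := hα.1
  have hp1 : 0 < p - 1 := by linarith
  -- This `q` satisfies `q^p = 2q`: each amplification gains a factor 2 beyond `q`, which pays for
  -- the halving of the time gaps.
  set q : ℝ := 2 ^ (1 / (p - 1)) with hq
  have hq1 : 1 < q := Real.one_lt_rpow (by norm_num) (by positivity)
  have hq0 : 0 < q := by linarith
  have hqp : q ^ p = q * 2 := by
    rw [show p = 1 + (p - 1) by ring, Real.rpow_add hq0, Real.rpow_one, hq,
      ← Real.rpow_mul (by norm_num), one_div_mul_cancel hp1.ne', Real.rpow_one]
  -- The starting times increase from `T/2`, where the bound on the linear part sets in, towards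
  -- `3T/4`, with gaps `T 2^(-n)/8`. The cylinder over `(3T/4, T]` is never left.
  have key : ∀ n : ℕ, ∀ᵐ z ∂(volume.restrict (Ioc (T * (3 / 4 - (1 / 2) ^ n / 4)) T ×ˢ
      Metric.closedBall (0 : EuclideanSpace ℝ (Fin N)) R)), ENNReal.ofReal (m * q ^ n) ≤ u z := by
    intro n
    induction n with
    | zero =>
      have hsub : Ioc (T * (3 / 4 - (1 / 2) ^ 0 / 4)) T ×ˢ
          Metric.closedBall (0 : EuclideanSpace ℝ (Fin N)) R ⊆ Ioc (0 : ℝ) T ×ˢ univ :=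
        prod_mono (Ioc_subset_Ioc_left (by norm_num; linarith)) (subset_univ _)
      filter_upwards [ae_restrict_of_ae_restrict_of_subset hsub hu.2,
        ae_restrict_mem (measurableSet_Ioc.prod measurableSet_closedBall)] with z hz hzmem
      obtain ⟨⟨hz1, hzT⟩, hzR⟩ := hzmem
      rw [mem_closedBall_zero_iff] at hzR
      rw [hz.2, pow_zero, mul_one]
      refine le_add_right (hlow _ ⟨?_, hzT⟩ _ hzR)
      norm_num at hz1
      linarith
    | succ n ih =>
      have hn : (1 / 2 : ℝ) ^ n ≤ 1 := pow_le_one₀ (by norm_num) (by norm_num)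
      have hn0 : (0 : ℝ) < (1 / 2 : ℝ) ^ n := by positivity
      have hstep := hu.amplify hα (by linarith) hT.le hc0.le hc
        (t₀ := T * (3 / 4 - (1 / 2) ^ n / 4)) (t₁ := T * (3 / 4 - (1 / 2) ^ (n + 1) / 4))
        (mul_nonneg hT0.le (by linarith))
        (by rw [pow_succ]; exact mul_lt_mul_of_pos_left (by linarith) hT0)
        (by positivity) ih
      filter_upwards [hstep] with z hz
      refine le_trans (ENNReal.ofReal_le_ofReal ?_) hz
      have e1 : T * (3 / 4 - (1 / 2) ^ (n + 1) / 4) - T * (3 / 4 - (1 / 2) ^ n / 4) =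
          T * ((1 / 2) ^ n / 8) := by rw [pow_succ]; ring
      -- `x ≤ x^α` on `(0,1]`; this removes `α` from the gap factor, apart from `T^α = R²`.
      have e2 : (1 / 2 : ℝ) ^ n / 8 ≤ ((1 / 2 : ℝ) ^ n / 8) ^ α := by
        have := Real.rpow_le_rpow_of_exponent_ge (x := (1 / 2 : ℝ) ^ n / 8) (by positivity)
          (by linarith) hα.2.le
        rwa [Real.rpow_one] at this
      have e3 : (m * q ^ n) ^ p = m * m ^ (p - 1) * (q ^ n * 2 ^ n) := by
        rw [Real.mul_rpow hm.le (by positivity), ← Real.rpow_natCast_mul hq0.le, mul_comm (n : ℝ),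
          Real.rpow_mul_natCast hq0.le, hqp, mul_pow]
        congr 1
        rw [show p = 1 + (p - 1) by ring, Real.rpow_add hm, Real.rpow_one]
        ring_nf
      rw [e1, Real.mul_rpow hT0.le (by positivity), e3, hT]
      have hmp : 0 < m ^ (p - 1) := by positivity
      have h2n : (2 : ℝ) ^ n * (1 / 2 : ℝ) ^ n = 1 := by rw [← mul_pow]; norm_num
      calc m * q ^ (n + 1) = m * q ^ n * q := by rw [pow_succ]; ring
        _ ≤ m * q ^ n * (c * R ^ 2 / 32 * m ^ (p - 1)) := by gcongr
        _ = c / 4 * (m * m ^ (p - 1) * (q ^ n * 2 ^ n)) * (R ^ 2 * ((1 / 2) ^ n / 8)) := by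
            linear_combination (-(m * q ^ n * (c * R ^ 2 / 32 * m ^ (p - 1)))) * h2n
        _ ≤ _ := by gcongr
  -- All the lower bounds hold together on this set of positive measure, so the solution would be
  -- infinite there.
  set S := Ioc (T * (3 / 4)) T ×ˢ Metric.closedBall (0 : EuclideanSpace ℝ (Fin N)) R with hS
  have hall : ∀ᵐ z ∂(volume.restrict S), ∀ n : ℕ, ENNReal.ofReal (m * q ^ n) ≤ u z := by
    rw [ae_all_iff]
    intro n
    refine ae_restrict_of_ae_restrict_of_subset (prod_mono (Ioc_subset_Ioc_left ?_) le_rfl) (key n)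
    have : (0 : ℝ) < (1 / 2 : ℝ) ^ n := by positivity
    gcongr
    linarith
  have hfin : ∀ᵐ z ∂(volume.restrict S), u z < ∞ := by
    have hsub : S ⊆ Ioc (0 : ℝ) T ×ˢ univ :=
      prod_mono (Ioc_subset_Ioc_left (by positivity)) (subset_univ _)
    filter_upwards [ae_restrict_of_ae_restrict_of_subset hsub hu.2] with z hz using hz.1
  have hfalse : ∀ᵐ z ∂(volume.restrict S), False := by
    filter_upwards [hall, hfin] with z h1 h2
    obtain ⟨n, hn⟩ := pow_unbounded_of_one_lt ((u z).toReal / m) hq1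
    rw [div_lt_iff₀ hm] at hn
    have := (ENNReal.ofReal_le_iff_le_toReal h2.ne).1 (h1 n)
    linarith
  rw [ae_iff] at hfalse
  simp only [not_false_eq_true, ofPred_true, Measure.restrict_apply_univ] at hfalse
  rw [hS, Measure.volume_eq_prod, Measure.prod_prod, mul_eq_zero] at hfalse
  rcases hfalse with h | h
  · rw [Real.volume_Ioc, ENNReal.ofReal_eq_zero] at h
    linarith
  · exact (Metric.measure_closedBall_pos _ _ hR).ne' h

/-- The necessary condition for the solvability on `[0,T]`, on the scale `R = T^{α/2}`. -/
theorem exists_mul_le_of_isSolution (N : ℕ) {p A : ℝ} (hp : 1 < p) :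
    ∃ C : ℝ, 0 < C ∧ ∀ α ∈ Ioo (0 : ℝ) 1, ∀ κ T R m : ℝ, 0 < κ → 0 < T → 0 < R → T ^ α = R ^ 2 →
      0 < m → ENNReal.ofReal m ≤ decayMass N A R →
      (∃ u, IsSolution α p T (decayData N A κ) u) →
      κ * m * R ^ (2 / (p - 1) - N) ≤ C := by
  obtain ⟨c, hc0, hc⟩ := exists_lintegral_closedBall_heatKernel_ge N
  have hp1 : 0 < p - 1 := by linarith
  have hπ := Real.pi_pos
  set K := (96 * Real.pi) ^ (-((N : ℝ) / 2)) * Real.exp (-4) with hK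
  have hK0 : 0 < K := by positivity
  set Q : ℝ := 32 * 2 ^ (1 / (p - 1)) / c with hQ
  have hQ0 : 0 < Q := by positivity
  refine ⟨Q ^ (1 / (p - 1)) * (96 / K), by positivity, ?_⟩
  rintro α hα κ T R m hκ hT0 hR hT hm hmR ⟨u, hu⟩
  have hα0 := hα.1
  have hlow : ∀ t ∈ Ioc (T / 2) T, ∀ x : EuclideanSpace ℝ (Fin N), ‖x‖ ≤ R →
      ENNReal.ofReal (κ * (K * (R ^ (-(N : ℝ)) * m)) * (1 / 96)) ≤
        opP α t (decayData N A κ) x := by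
    intro t ht x hx
    have ht0 : 0 < t := by linarith [ht.1]
    have hup : t ^ α ≤ R ^ 2 := hT ▸ Real.rpow_le_rpow ht0.le ht.2 hα0.le
    -- With `θ` in `(1/2, 24]` and `t` in `(T/2, T]`, the heat times `t^α θ` lie in `[R²/4, 24 R²]`,
    -- the window of `heat_decayData_ge_parabolic`. The factor `1/96` is the mass of `h_α` on that
    -- range of `θ`.
    have hdown : R ^ 2 / 2 ≤ t ^ α := by
      calc R ^ 2 / 2 = R ^ 2 * (1 / 2) ^ (1 : ℝ) := by rw [Real.rpow_one]; ring
        _ ≤ R ^ 2 * (1 / 2) ^ α := by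
          gcongr ?_ * ?_
          exact Real.rpow_le_rpow_of_exponent_ge (by norm_num) (by norm_num) hα.2.le
        _ = (T / 2) ^ α := by
          rw [← hT, ← Real.mul_rpow hT0.le (by norm_num)]; congr 1; ring
        _ ≤ t ^ α := Real.rpow_le_rpow (by positivity) ht.1.le hα0.le
    rw [opP_eq, ENNReal.ofReal_mul (by positivity)]
    calc _ ≤ ENNReal.ofReal (κ * (K * (R ^ (-(N : ℝ)) * m))) *
          wrightMeasure α (Ioc (1 / 2) 24) := by
          gcongr
          exact wrightMeasure_Ioc_ge hα
      _ = ∫⁻ _ in Ioc (1 / 2) 24, ENNReal.ofReal (κ * (K * (R ^ (-(N : ℝ)) * m)))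
            ∂wrightMeasure α := by rw [setLIntegral_const]
      _ ≤ ∫⁻ θ in Ioc (1 / 2) 24, heat (t ^ α * θ) (decayData N A κ) x ∂wrightMeasure α := by
          refine setLIntegral_mono' measurableSet_Ioc fun θ hθ => ?_
          refine heat_decayData_ge_parabolic hκ.le hR ?_ ?_ hmR hx
          · nlinarith [hθ.1, sq_nonneg R]
          · nlinarith [hθ.1, hθ.2, sq_nonneg R]
      _ ≤ _ := setLIntegral_le_lintegral _ _
  have hRN : 0 < R ^ (-(N : ℝ)) := by positivity
  set m₀ := κ * (K * (R ^ (-(N : ℝ)) * m)) * (1 / 96) with hm₀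
  have hm0 : 0 < m₀ := by positivity
  have h := hu.mul_rpow_lt hα hp hT0 hR hT hc0 (fun t x ht h1 h2 => hc R t x hR ht h1 h2) hm0 hlow
  have h1 : (m₀ * R ^ (2 / (p - 1))) ^ (p - 1) ≤ Q := by
    rw [Real.mul_rpow hm0.le (by positivity), ← Real.rpow_mul hR.le, div_mul_cancel₀ _ hp1.ne',
      hQ, le_div_iff₀ hc0, Real.rpow_two]
    linarith
  have h2 : m₀ * R ^ (2 / (p - 1)) ≤ Q ^ (1 / (p - 1)) := by
    have := Real.rpow_le_rpow (by positivity) h1 (z := 1 / (p - 1)) (by positivity)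
    rwa [← Real.rpow_mul (by positivity), mul_one_div_cancel hp1.ne', Real.rpow_one] at this
  calc κ * m * R ^ (2 / (p - 1) - N) = m₀ * R ^ (2 / (p - 1)) * (96 / K) := by
        rw [sub_eq_add_neg, Real.rpow_add hR, hm₀]
        field_simp
    _ ≤ _ := by gcongr

/-! ### The integral equation and its monotone iteration -/

theorem measurable_opP {N : ℕ} (α : ℝ) (μ : Measure (EuclideanSpace ℝ (Fin N))) [SFinite μ] :
    Measurable fun z : ℝ × EuclideanSpace ℝ (Fin N) => opP α z.1 μ z.2 := by
  simp only [opP_eq]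
  exact Measurable.lintegral_prod_right'
    (f := fun w : (ℝ × EuclideanSpace ℝ (Fin N)) × ℝ => heat (w.1.1 ^ α * w.2) μ w.1.2)
    (measurable_heat_comp μ (by fun_prop) (by fun_prop))

/-- The kernel of the Duhamel term of the time-fractional heat equation. -/
def fracKernel {N : ℕ} (α : ℝ) (z : ℝ × EuclideanSpace ℝ (Fin N)) : ℝ≥0∞ :=
  ENNReal.ofReal α * (ENNReal.ofReal (z.1 ^ (α - 1)) *
    ∫⁻ η, ENNReal.ofReal η * ENNReal.ofReal (heatKernel (z.1 ^ α * η) z.2) ∂wrightMeasure α)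

theorem measurable_fracKernel {N : ℕ} (α : ℝ) :
    Measurable (fracKernel α : ℝ × EuclideanSpace ℝ (Fin N) → ℝ≥0∞) := by
  unfold fracKernel
  refine measurable_const.mul (Measurable.mul (by fun_prop) ?_)
  refine Measurable.lintegral_prod_right'
    (f := fun w : (ℝ × EuclideanSpace ℝ (Fin N)) × ℝ =>
      ENNReal.ofReal w.2 * ENNReal.ofReal (heatKernel (w.1.1 ^ α * w.2) w.1.2)) ?_
  exact Measurable.mul (by fun_prop)
    (measurable_heatKernel_comp (by fun_prop) (by fun_prop)).ennreal_ofReal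

/-- The weight of the point `q` in the Duhamel term at the point `z`. -/
def duhamelWeight {N : ℕ} (α : ℝ) (z q : ℝ × EuclideanSpace ℝ (Fin N)) : ℝ≥0∞ :=
  if q.1 ∈ Ioo 0 z.1 then fracKernel α (z - q) else 0

theorem measurable_duhamelWeight {N : ℕ} (α : ℝ) :
    Measurable fun w : (ℝ × EuclideanSpace ℝ (Fin N)) × (ℝ × EuclideanSpace ℝ (Fin N)) =>
      duhamelWeight α w.1 w.2 := by
  unfold duhamelWeight
  refine Measurable.ite ?_ ((measurable_fracKernel α).comp
    (measurable_fst.sub measurable_snd)) measurable_const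
  exact (measurableSet_lt measurable_const measurable_snd.fst).inter
    (measurableSet_lt measurable_snd.fst measurable_fst.fst)

/-- The right-hand side of the integral equation. -/
def mildMap {N : ℕ} (α p : ℝ) (μ : Measure (EuclideanSpace ℝ (Fin N)))
    (u : ℝ × EuclideanSpace ℝ (Fin N) → ℝ≥0∞) (z : ℝ × EuclideanSpace ℝ (Fin N)) : ℝ≥0∞ :=
  opP α z.1 μ z.2 + ∫⁻ q, duhamelWeight α z q * u q ^ p

theorem opS_withDensity {N : ℕ} (α r : ℝ) {f : EuclideanSpace ℝ (Fin N) → ℝ≥0∞}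
    (hf : Measurable f) (x : EuclideanSpace ℝ (Fin N)) :
    opS α r (volume.withDensity f) x =
      ∫⁻ y, (∫⁻ η, ENNReal.ofReal η * ENNReal.ofReal (heatKernel (r ^ α * η) (x - y))
        ∂wrightMeasure α) * f y := by
  have hm : Measurable fun w : ℝ × EuclideanSpace ℝ (Fin N) =>
      ENNReal.ofReal w.1 * ENNReal.ofReal (heatKernel (r ^ α * w.1) (x - w.2)) :=
    Measurable.mul (by fun_prop)
      (measurable_heatKernel_comp (by fun_prop) (by fun_prop)).ennreal_ofReal
  rw [opS_eq]
  calc _ = ∫⁻ η, (∫⁻ y, ENNReal.ofReal η * ENNReal.ofReal (heatKernel (r ^ α * η) (x - y)) * f y)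
        ∂wrightMeasure α := by
        refine lintegral_congr fun η => ?_
        rw [heat_withDensity _ hf, ← lintegral_const_mul' _ _ ENNReal.ofReal_ne_top]
        exact lintegral_congr fun y => (mul_assoc _ _ _).symm
    _ = ∫⁻ y, ∫⁻ η, ENNReal.ofReal η * ENNReal.ofReal (heatKernel (r ^ α * η) (x - y)) * f y
        ∂wrightMeasure α :=
        lintegral_lintegral_swap (hm.mul (hf.comp measurable_snd)).aemeasurable
    _ = _ := by
        refine lintegral_congr fun y => ?_
        exact lintegral_mul_const _ (hm.comp (measurable_id.prodMk measurable_const))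

/-- Tonelli. Writing the Duhamel term as one space-time integral makes measurability, monotonicity
and monotone convergence direct. -/
theorem mildMap_eq {N : ℕ} (α p : ℝ) (μ : Measure (EuclideanSpace ℝ (Fin N)))
    {u : ℝ × EuclideanSpace ℝ (Fin N) → ℝ≥0∞} (hu : Measurable u)
    (z : ℝ × EuclideanSpace ℝ (Fin N)) :
    mildMap α p μ u z = opP α z.1 μ z.2 + ENNReal.ofReal α *
      ∫⁻ s in Ioo (0 : ℝ) z.1, ENNReal.ofReal ((z.1 - s) ^ (α - 1)) *
        opS α (z.1 - s) (volume.withDensity fun y => u (s, y) ^ p) z.2 := by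
  have hm : Measurable fun q : ℝ × EuclideanSpace ℝ (Fin N) =>
      duhamelWeight α z q * u q ^ p :=
    ((measurable_duhamelWeight α).comp (measurable_const.prodMk measurable_id)).mul
      (hu.pow_const p)
  rw [mildMap]
  congr 1
  rw [Measure.volume_eq_prod, lintegral_prod _ hm.aemeasurable,
    ← lintegral_const_mul' _ _ ENNReal.ofReal_ne_top, ← lintegral_indicator measurableSet_Ioo]
  refine lintegral_congr fun s => ?_
  have hus : Measurable fun y => u (s, y) ^ p := (hu.comp measurable_prodMk_left).pow_const p
  by_cases hs : s ∈ Ioo 0 z.1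
  · rw [indicator_of_mem hs, opS_withDensity _ _ hus,
      ← lintegral_const_mul' _ _ ENNReal.ofReal_ne_top,
      ← lintegral_const_mul' _ _ ENNReal.ofReal_ne_top]
    refine lintegral_congr fun y => ?_
    simp only [duhamelWeight, if_pos hs, fracKernel, Prod.fst_sub, Prod.snd_sub, mul_assoc]
  · rw [indicator_of_notMem hs]
    simp only [duhamelWeight, if_neg hs, zero_mul, lintegral_zero]

theorem measurable_mildMap {N : ℕ} (α p : ℝ) (μ : Measure (EuclideanSpace ℝ (Fin N))) [SFinite μ]
    {u : ℝ × EuclideanSpace ℝ (Fin N) → ℝ≥0∞} (hu : Measurable u) :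
    Measurable (mildMap α p μ u) := by
  refine (measurable_opP α μ).add ?_
  exact Measurable.lintegral_prod_right'
    (f := fun w : (ℝ × EuclideanSpace ℝ (Fin N)) × (ℝ × EuclideanSpace ℝ (Fin N)) =>
      duhamelWeight α w.1 w.2 * u w.2 ^ p)
    ((measurable_duhamelWeight α).mul ((hu.comp measurable_snd).pow_const p))

/-- `mildMap` at `z` is monotone, and sees only the values almost everywhere before `z`. -/
theorem mildMap_le_mildMap {N : ℕ} {α p : ℝ} (hp : 0 ≤ p)
    (μ : Measure (EuclideanSpace ℝ (Fin N))) {u v : ℝ × EuclideanSpace ℝ (Fin N) → ℝ≥0∞}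
    {z : ℝ × EuclideanSpace ℝ (Fin N)}
    (h : ∀ᵐ q : ℝ × EuclideanSpace ℝ (Fin N), q.1 ∈ Ioo 0 z.1 → u q ≤ v q) :
    mildMap α p μ u z ≤ mildMap α p μ v z := by
  refine add_le_add le_rfl (lintegral_mono_ae ?_)
  filter_upwards [h] with q hq
  by_cases hs : q.1 ∈ Ioo 0 z.1
  · gcongr
    exact hq hs
  · simp only [duhamelWeight, if_neg hs, zero_mul, le_refl]

/-- The monotone iteration for the integral equation. -/
def mildIterate {N : ℕ} (α p : ℝ) (μ : Measure (EuclideanSpace ℝ (Fin N))) :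
    ℕ → ℝ × EuclideanSpace ℝ (Fin N) → ℝ≥0∞
  | 0 => 0
  | n + 1 => mildMap α p μ (mildIterate α p μ n)

theorem measurable_mildIterate {N : ℕ} (α p : ℝ) (μ : Measure (EuclideanSpace ℝ (Fin N)))
    [SFinite μ] (n : ℕ) : Measurable (mildIterate α p μ n) := by
  induction n with
  | zero => exact measurable_const
  | succ n ih => exact measurable_mildMap α p μ ih

theorem monotone_mildIterate {N : ℕ} {α p : ℝ} (hp : 0 ≤ p)
    (μ : Measure (EuclideanSpace ℝ (Fin N))) : Monotone (mildIterate α p μ) := by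
  refine monotone_nat_of_le_succ fun n => ?_
  induction n with
  | zero => exact fun _ => zero_le
  | succ n ih =>
    exact fun z => mildMap_le_mildMap hp μ (ae_of_all _ fun q _ => ih q)

/-- Monotone convergence: the limit of the iteration is a fixed point everywhere, possibly with
infinite values. Finiteness comes later from a supersolution. -/
theorem mildMap_iSup {N : ℕ} {α p : ℝ} (hp : 0 < p)
    (μ : Measure (EuclideanSpace ℝ (Fin N))) [SFinite μ] (z : ℝ × EuclideanSpace ℝ (Fin N)) :
    mildMap α p μ (fun q => ⨆ n, mildIterate α p μ n q) z = ⨆ n, mildIterate α p μ n z := by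
  have hmono := monotone_mildIterate (α := α) hp.le μ
  have e : ∀ q, duhamelWeight α z q * (⨆ n, mildIterate α p μ n q) ^ p =
      ⨆ n, duhamelWeight α z q * mildIterate α p μ n q ^ p := by
    intro q
    rw [← ENNReal.mul_iSup]
    congr 1
    exact (ENNReal.orderIsoRpow p hp).map_iSup _
  have h1 : mildMap α p μ (fun q => ⨆ n, mildIterate α p μ n q) z =
      ⨆ n, mildIterate α p μ (n + 1) z := by
    simp only [mildMap, e, mildIterate]
    rw [lintegral_iSup, ENNReal.add_iSup]
    · intro n
      exact ((measurable_duhamelWeight α).comp (measurable_const.prodMk measurable_id)).mul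
        ((measurable_mildIterate α p μ n).pow_const p)
    · intro i j hij q
      have := hmono hij q
      simp only
      gcongr
  rw [h1]
  exact Monotone.iSup_nat_add (f := fun n => mildIterate α p μ n z) (fun i j hij => hmono hij z) 1

/-- A finite supersolution yields the minimal solution. -/
theorem exists_isMinimalSolution {N : ℕ} {α p T : ℝ} (hp : 0 < p)
    (μ : Measure (EuclideanSpace ℝ (Fin N))) [SFinite μ]
    {w : ℝ × EuclideanSpace ℝ (Fin N) → ℝ≥0∞}
    (hfin : ∀ z : ℝ × EuclideanSpace ℝ (Fin N), z.1 ∈ Ioc 0 T → w z < ∞)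
    (hw : ∀ z : ℝ × EuclideanSpace ℝ (Fin N), z.1 ∈ Ioc 0 T → mildMap α p μ w z ≤ w z) :
    ∃ u, IsMinimalSolution α p T μ u := by
  have hle : ∀ (n : ℕ) (z : ℝ × EuclideanSpace ℝ (Fin N)), z.1 ∈ Ioc 0 T →
      mildIterate α p μ n z ≤ w z := by
    intro n
    induction n with
    | zero => exact fun z _ => zero_le
    | succ n ih =>
      intro z hz
      refine le_trans (mildMap_le_mildMap hp.le μ (ae_of_all _ fun q hq => ?_)) (hw z hz)
      exact ih q ⟨hq.1, hq.2.le.trans hz.2⟩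
  have hSm : MeasurableSet (Ioc (0 : ℝ) T ×ˢ (univ : Set (EuclideanSpace ℝ (Fin N)))) :=
    measurableSet_Ioc.prod MeasurableSet.univ
  have hum : Measurable fun q => ⨆ n, mildIterate α p μ n q :=
    Measurable.iSup (measurable_mildIterate α p μ)
  refine ⟨fun q => ⨆ n, mildIterate α p μ n q, ⟨hum, ?_⟩, ?_⟩
  · filter_upwards [ae_restrict_mem hSm] with z hz
    refine ⟨(iSup_le fun n => hle n z hz.1).trans_lt (hfin z hz.1), ?_⟩
    rw [← mildMap_eq α p μ hum, mildMap_iSup hp]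
  · intro v hv
    -- A competing solution satisfies its equation only almost everywhere, so the comparison is
    -- carried out almost everywhere at each level; the map ignores null sets of its argument.
    have hlev : ∀ n : ℕ, ∀ᵐ z ∂(volume.restrict
        (Ioc (0 : ℝ) T ×ˢ (univ : Set (EuclideanSpace ℝ (Fin N))))),
        mildIterate α p μ n z ≤ v z := by
      intro n
      induction n with
      | zero => exact ae_of_all _ fun z => zero_le
      | succ n ih =>
        rw [ae_restrict_iff' hSm] at ih
        filter_upwards [hv.2, ae_restrict_mem hSm] with z hz hzmem
        rw [hz.2, ← mildMap_eq α p μ hv.1]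
        refine mildMap_le_mildMap hp.le μ ?_
        filter_upwards [ih] with q hq hqz
        exact hq ⟨⟨hqz.1, hqz.2.le.trans hzmem.1.2⟩, mem_univ _⟩
    filter_upwards [ae_all_iff.2 hlev] with z hz using iSup_le hz

/-! ### Lower bound: supersolutions by subordination -/

/-- The superposition `∫ h_α(θ) F(t^α θ) e^{t^α θ Δ} μ dθ`. -/
def subordinate {N : ℕ} (α : ℝ) (μ : Measure (EuclideanSpace ℝ (Fin N))) (F : ℝ → ℝ≥0∞)
    (z : ℝ × EuclideanSpace ℝ (Fin N)) : ℝ≥0∞ :=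
  ∫⁻ θ, F (z.1 ^ α * θ) * heat (z.1 ^ α * θ) μ z.2 ∂wrightMeasure α

theorem measurable_subordinate {N : ℕ} (α : ℝ) (μ : Measure (EuclideanSpace ℝ (Fin N))) [SFinite μ]
    {F : ℝ → ℝ≥0∞} (hF : Measurable F) : Measurable (subordinate α μ F) := by
  refine Measurable.lintegral_prod_right'
    (f := fun w : (ℝ × EuclideanSpace ℝ (Fin N)) × ℝ =>
      F (w.1.1 ^ α * w.2) * heat (w.1.1 ^ α * w.2) μ w.1.2) ?_
  exact (hF.comp (by fun_prop)).mul (measurable_heat_comp μ (by fun_prop) (by fun_prop))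

/-- Tonelli and the semigroup law: the heat flow shifts every heat time by `r` and leaves the weight
`F` unchanged. -/
theorem heat_subordinate {N : ℕ} (α : ℝ) (μ : Measure (EuclideanSpace ℝ (Fin N))) [SFinite μ]
    {F : ℝ → ℝ≥0∞} (hF : Measurable F) {r s : ℝ} (hr : 0 < r) (hs : 0 < s)
    (x : EuclideanSpace ℝ (Fin N)) :
    heat r (volume.withDensity fun y => subordinate α μ F (s, y)) x =
      ∫⁻ θ, F (s ^ α * θ) * heat (r + s ^ α * θ) μ x ∂wrightMeasure α := by
  have hg : Measurable fun y => subordinate α μ F (s, y) :=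
    (measurable_subordinate α μ hF).comp measurable_prodMk_left
  have hk : Measurable fun y : EuclideanSpace ℝ (Fin N) =>
      ENNReal.ofReal (heatKernel r (x - y)) :=
    (measurable_heatKernel_comp measurable_const (by fun_prop)).ennreal_ofReal
  have hm : Measurable fun w : EuclideanSpace ℝ (Fin N) × ℝ =>
      F (s ^ α * w.2) * heat (s ^ α * w.2) μ w.1 :=
    (hF.comp (by fun_prop)).mul (measurable_heat_comp μ (by fun_prop) (by fun_prop))
  rw [heat_withDensity r hg]
  calc _ = ∫⁻ y, ∫⁻ θ, ENNReal.ofReal (heatKernel r (x - y)) *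
          (F (s ^ α * θ) * heat (s ^ α * θ) μ y) ∂wrightMeasure α := by
        refine lintegral_congr fun y => ?_
        rw [lintegral_const_mul' _ _ ENNReal.ofReal_ne_top]
        rfl
    _ = ∫⁻ θ, (∫⁻ y, ENNReal.ofReal (heatKernel r (x - y)) *
          (F (s ^ α * θ) * heat (s ^ α * θ) μ y)) ∂wrightMeasure α :=
        lintegral_lintegral_swap ((hk.comp measurable_fst).mul hm).aemeasurable
    _ = _ := by
        refine lintegral_congr_ae ?_
        filter_upwards [ae_pos_wrightMeasure α] with θ hθ
        have hs' := Real.rpow_pos_of_pos hs α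
        have hh : Measurable fun y => heat (s ^ α * θ) μ y :=
          measurable_heat_comp μ measurable_const measurable_id
        rw [← heat_heat μ hr (by positivity), heat_withDensity r hh]
        exact (lintegral_congr fun y => mul_left_comm _ _ _).trans
          (lintegral_const_mul _ (hk.mul hh))

/-- Subordination turns a supersolution of the heat equation into one of the time-fractional
equation. -/
theorem mildMap_subordinate_le {N : ℕ} {α p T : ℝ} (hα : α ∈ Ioo (0 : ℝ) 1)
    (μ : Measure (EuclideanSpace ℝ (Fin N))) [SFinite μ] {F G : ℝ → ℝ≥0∞} (hF : Measurable F)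
    (hG : Measurable G) (hFG : ∀ τ : ℝ, 0 < τ → 1 + ∫⁻ σ in Ioo 0 τ, F σ ≤ G τ)
    (hpow : ∀ z : ℝ × EuclideanSpace ℝ (Fin N), z.1 ∈ Ioc 0 T →
      subordinate α μ G z ^ p ≤ subordinate α μ F z)
    (z : ℝ × EuclideanSpace ℝ (Fin N)) (hz : z.1 ∈ Ioc 0 T) :
    mildMap α p μ (subordinate α μ G) z ≤ subordinate α μ G z := by
  obtain ⟨t, x⟩ := z
  obtain ⟨ht, htT⟩ := hz
  have hGm := measurable_subordinate α μ hG
  have hH : Measurable fun τ => heat τ μ x := measurable_heat_comp μ measurable_id measurable_const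
  have hΦ : Measurable fun w : ℝ × ℝ => F w.2 * heat (w.1 + w.2) μ x :=
    (hF.comp measurable_snd).mul (hH.comp (by fun_prop))
  have hHt : Measurable fun θ => heat (t ^ α * θ) μ x := hH.comp (by fun_prop)
  rw [mildMap_eq α p μ hGm]
  simp only at ht htT ⊢
  calc _ ≤ opP α t μ x + ENNReal.ofReal α * ∫⁻ s in Ioo 0 t, ENNReal.ofReal ((t - s) ^ (α - 1)) *
        ∫⁻ η, ENNReal.ofReal η * ∫⁻ θ, F (s ^ α * θ) * heat ((t - s) ^ α * η + s ^ α * θ) μ x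
          ∂wrightMeasure α ∂wrightMeasure α := by
        refine add_le_add le_rfl (mul_le_mul_right
          (setLIntegral_mono' measurableSet_Ioo fun s hs => mul_le_mul_right ?_ _) _)
        have hts : 0 < t - s := by linarith [hs.2]
        rw [opS_eq]
        refine lintegral_mono_ae ?_
        filter_upwards [ae_pos_wrightMeasure α] with η hη
        have := Real.rpow_pos_of_pos hts α
        rw [← heat_subordinate α μ hF (by positivity) hs.1]
        refine mul_le_mul_right (lintegral_mono' (withDensity_mono (ae_of_all _ fun y => ?_))
          le_rfl) _
        exact hpow (s, y) ⟨hs.1, hs.2.le.trans htT⟩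
    -- The composition rule for `Φ(σ', σ) = F(σ) e^((σ'+σ)Δ) μ(x)`: the two heat times add up to
    -- `t^α θ`, so afterwards only `F` depends on `σ`.
    _ = (∫⁻ θ, heat (t ^ α * θ) μ x ∂wrightMeasure α) +
          ∫⁻ θ, (∫⁻ σ in Ioo 0 (t ^ α * θ), F σ * heat (t ^ α * θ - σ + σ) μ x)
            ∂wrightMeasure α := by
        rw [opP_eq, ← lintegral_duhamel hα ht hΦ]
    _ = ∫⁻ θ, (heat (t ^ α * θ) μ x + ∫⁻ σ in Ioo 0 (t ^ α * θ),
          F σ * heat (t ^ α * θ - σ + σ) μ x) ∂wrightMeasure α := by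
        rw [lintegral_add_left hHt]
    _ ≤ subordinate α μ G (t, x) := by
        refine lintegral_mono_ae ?_
        filter_upwards [ae_pos_wrightMeasure α] with θ hθ
        have := Real.rpow_pos_of_pos ht α
        simp only [sub_add_cancel]
        rw [lintegral_mul_const _ hF]
        calc _ = (1 + ∫⁻ σ in Ioo 0 (t ^ α * θ), F σ) * heat (t ^ α * θ) μ x := by
              rw [add_mul, one_mul]
          _ ≤ _ := by
              gcongr
              exact hFG _ (by positivity)

/-- A weighted Jensen inequality. -/
theorem lintegral_rpow_le_of_rpow_le {X : Type*} [MeasurableSpace X] {ν : Measure X} {p : ℝ}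
    (hp : 1 < p) {f g k : X → ℝ≥0∞} (hg : AEMeasurable g ν) (hk : AEMeasurable k ν)
    (h : ∀ᵐ x ∂ν, f x ^ p ≤ g x * k x ^ (p - 1)) :
    (∫⁻ x, f x ∂ν) ^ p ≤ (∫⁻ x, g x ∂ν) * (∫⁻ x, k x ∂ν) ^ (p - 1) := by
  have hp0 : 0 < p := by linarith
  have hp1 : 0 < p - 1 := by linarith
  have hpq : p.HolderConjugate (p / (p - 1)) := Real.HolderConjugate.conjExponent hp
  have h1 : ∫⁻ x, f x ∂ν ≤
      (∫⁻ x, g x ∂ν) ^ (1 / p) * (∫⁻ x, k x ∂ν) ^ (1 / (p / (p - 1))) := by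
    -- Taking the `p`-th root of the hypothesis gives `f ≤ g^(1/p) k^((p-1)/p)`; Hölder with
    -- exponents `p` and `p/(p-1)` follows.
    calc ∫⁻ x, f x ∂ν ≤ ∫⁻ x, ((fun x => g x ^ (1 / p)) * fun x => k x ^ ((p - 1) / p)) x ∂ν := by
          refine lintegral_mono_ae ?_
          filter_upwards [h] with x hx
          rw [← ENNReal.le_rpow_inv_iff hp0, ENNReal.mul_rpow_of_nonneg _ _ (by positivity),
            ← ENNReal.rpow_mul] at hx
          simpa only [Pi.mul_apply, div_eq_mul_inv, one_mul] using hx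
      _ ≤ _ := by
          refine (ENNReal.lintegral_mul_le_Lp_mul_Lq ν hpq (hg.pow_const _)
            (hk.pow_const _)).trans_eq ?_
          simp only [← ENNReal.rpow_mul, one_div_mul_cancel hp0.ne']
          rw [show (p - 1) / p * (p / (p - 1)) = 1 by field_simp]
          simp only [ENNReal.rpow_one]
  calc (∫⁻ x, f x ∂ν) ^ p
      ≤ ((∫⁻ x, g x ∂ν) ^ (1 / p) * (∫⁻ x, k x ∂ν) ^ (1 / (p / (p - 1)))) ^ p := by gcongr
    _ = _ := by
        rw [ENNReal.mul_rpow_of_nonneg _ _ hp0.le, ← ENNReal.rpow_mul, ← ENNReal.rpow_mul,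
          one_div_mul_cancel hp0.ne', ENNReal.rpow_one]
        congr 2
        field_simp

/-- The fundamental theorem of calculus for `exp((σ/τ₀)^γ)`, which equals 1 at 0. It provides the
pair of weights required by `mildMap_subordinate_le`, with equality. -/
theorem lintegral_deriv_exp_rpow {γ τ₀ τ : ℝ} (hγ : 0 < γ) (hτ₀ : 0 < τ₀) (hτ : 0 < τ) :
    1 + ∫⁻ σ in Ioo 0 τ, ENNReal.ofReal
        (γ * σ ^ (γ - 1) * τ₀ ^ (-γ) * Real.exp ((σ / τ₀) ^ γ)) =
      ENNReal.ofReal (Real.exp ((τ / τ₀) ^ γ)) := by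
  have hcont : ContinuousOn (fun σ : ℝ => Real.exp ((σ / τ₀) ^ γ)) (Icc 0 τ) := by
    refine (Real.continuous_exp.comp ?_).continuousOn
    exact (Real.continuous_rpow_const hγ.le).comp (continuous_id.div_const _)
  have hderiv : ∀ σ ∈ Ioo 0 τ, HasDerivAt (fun σ : ℝ => Real.exp ((σ / τ₀) ^ γ))
      (γ * σ ^ (γ - 1) * τ₀ ^ (-γ) * Real.exp ((σ / τ₀) ^ γ)) σ := by
    intro σ hσ
    have hσ0 := hσ.1
    have h := (((hasDerivAt_id σ).div_const τ₀).rpow_const (p := γ)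
      (Or.inl (by simp only [id]; positivity))).exp
    convert! h using 1
    simp only [id]
    rw [Real.div_rpow hσ0.le hτ₀.le, Real.div_rpow hσ0.le hτ₀.le, Real.rpow_neg hτ₀.le,
      Real.rpow_sub_one hτ₀.ne']
    field_simp
  have hnn : ∀ σ ∈ Ioo 0 τ,
      0 ≤ γ * σ ^ (γ - 1) * τ₀ ^ (-γ) * Real.exp ((σ / τ₀) ^ γ) := by
    intro σ hσ
    have hσ0 := hσ.1
    positivity
  -- For `γ < 1` the derivative is singular at 0; its integrability follows from its sign and the
  -- continuity of the primitive.
  have hint := intervalIntegral.integrableOn_deriv_of_nonneg hcont hderiv hnn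
  have hftc := intervalIntegral.integral_eq_sub_of_hasDerivAt_of_le hτ.le hcont hderiv
    ((intervalIntegrable_iff_integrableOn_Ioc_of_le hτ.le).2 hint)
  rw [intervalIntegral.integral_of_le hτ.le, integral_Ioc_eq_integral_Ioo, zero_div,
    Real.zero_rpow hγ.ne', Real.exp_zero] at hftc
  rw [← ofReal_integral_eq_lintegral_ofReal (hint.mono_set Ioo_subset_Ioc_self), hftc,
    ← ENNReal.ofReal_one, ← ENNReal.ofReal_add zero_le_one, add_sub_cancel]
  · have : 0 ≤ (τ / τ₀) ^ γ := by positivity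
    linarith [Real.one_le_exp this]
  · filter_upwards [ae_restrict_mem measurableSet_Ioo] with σ hσ using hnn σ hσ

/-- Lower bound of the life span by the decay of the heat flow of the initial value. -/
theorem le_lifespan {N : ℕ} {α p a B M τ₀ γ : ℝ} (hα : α ∈ Ioo (0 : ℝ) 1) (hp : 1 < p)
    (hγ : γ = 1 - (p - 1) * (a / 2)) (hγ0 : 0 < γ) (hγ1 : γ ≤ 1) (hB : 0 < B) (hτ₀ : 0 < τ₀)
    (μ : Measure (EuclideanSpace ℝ (Fin N))) [SFinite μ]
    (hM : ∀ τ : ℝ, 0 < τ → ∀ x, heat τ μ x ≤ ENNReal.ofReal M)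
    (hH : ∀ τ : ℝ, 0 < τ → ∀ x,
      heat τ μ x ≤ ENNReal.ofReal (B * Real.exp (2 * (τ / τ₀)) * τ ^ (-(a / 2))))
    (hcond : (Real.exp 1 * B * (2 * Real.exp (7 ^ (1 / α)))) ^ (p - 1) * τ₀ ^ γ ≤ γ) :
    ENNReal.ofReal (τ₀ ^ (1 / α)) ≤ lifespan α p μ := by
  have hα0 := hα.1
  have hp1 : 0 < p - 1 := by linarith
  set T := τ₀ ^ (1 / α) with hT
  have hT0 : 0 < T := by positivity
  have hTα : T ^ α = τ₀ := by
    rw [hT, ← Real.rpow_mul hτ₀.le, one_div_mul_cancel hα0.ne', Real.rpow_one]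
  set E := 2 * Real.exp (7 ^ (1 / α)) with hE
  have hE0 : 0 < E := by positivity
  set F : ℝ → ℝ≥0∞ := fun σ => ENNReal.ofReal
    (γ * σ ^ (γ - 1) * τ₀ ^ (-γ) * Real.exp ((σ / τ₀) ^ γ)) with hF
  set G : ℝ → ℝ≥0∞ := fun τ => ENNReal.ofReal (Real.exp ((τ / τ₀) ^ γ)) with hG
  have hFm : Measurable F := by fun_prop
  have hGm : Measurable G := by fun_prop
  -- Heat times beyond `τ₀` occur because `θ` is unbounded; linear growth of the exponent lets
  -- exponential moments of `h_α` control them.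
  have hexp : ∀ τ : ℝ, 0 < τ → (τ / τ₀) ^ γ ≤ 1 + τ / τ₀ := by
    intro τ hτ
    have h0 : 0 ≤ τ / τ₀ := by positivity
    rcases le_total (τ / τ₀) 1 with h | h
    · linarith [Real.rpow_le_one h0 h hγ0.le]
    · have := Real.rpow_le_rpow_of_exponent_le h hγ1
      rw [Real.rpow_one] at this
      linarith
  have hscale : ∀ t ∈ Ioc 0 T, ∀ θ : ℝ, 0 < θ → 0 < t ^ α * θ ∧ t ^ α * θ / τ₀ ≤ θ := by
    intro t ht θ hθ
    have h1 := Real.rpow_pos_of_pos ht.1 α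
    have h2 : t ^ α ≤ τ₀ := hTα ▸ Real.rpow_le_rpow ht.1.le ht.2 hα0.le
    refine ⟨by positivity, ?_⟩
    rw [div_le_iff₀ hτ₀, mul_comm θ]
    gcongr
  have hfin : ∀ z : ℝ × EuclideanSpace ℝ (Fin N), z.1 ∈ Ioc 0 T → subordinate α μ G z < ∞ := by
    intro z hz
    calc subordinate α μ G z
        ≤ ∫⁻ θ, ENNReal.ofReal (Real.exp 1) * ENNReal.ofReal (Real.exp (1 * θ)) *
            ENNReal.ofReal M ∂wrightMeasure α := by
          refine lintegral_mono_ae ?_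
          filter_upwards [ae_pos_wrightMeasure α] with θ hθ
          obtain ⟨h1, h2⟩ := hscale z.1 hz θ hθ
          gcongr
          · rw [← ENNReal.ofReal_mul (Real.exp_pos 1).le, ← Real.exp_add]
            refine ENNReal.ofReal_le_ofReal (Real.exp_le_exp.2 ?_)
            linarith [hexp _ h1]
          · exact hM _ h1 _
      _ < ∞ := by
          rw [lintegral_mul_const _ (by fun_prop), lintegral_const_mul _ (by fun_prop)]
          exact ENNReal.mul_lt_top (ENNReal.mul_lt_top ENNReal.ofReal_lt_top
            ((lintegral_exp_wrightMeasure_le hα zero_le_one).trans_lt ENNReal.ofReal_lt_top))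
            ENNReal.ofReal_lt_top
  have hpow : ∀ z : ℝ × EuclideanSpace ℝ (Fin N), z.1 ∈ Ioc 0 T →
      subordinate α μ G z ^ p ≤ subordinate α μ F z := by
    intro z hz
    set k := E ^ (-(p - 1)) with hk
    have hk0 : 0 < k := by positivity
    have hcond' : (Real.exp 1 * B) ^ (p - 1) ≤ k * (γ * τ₀ ^ (-γ)) := by
      rw [hk, Real.rpow_neg hE0.le, Real.rpow_neg hτ₀.le]
      rw [Real.mul_rpow (by positivity) hE0.le] at hcond
      have p1 : 0 < E ^ (p - 1) := by positivity
      have p2 : 0 < τ₀ ^ γ := by positivity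
      field_simp
      linarith
    -- The pointwise hypothesis of the weighted Jensen inequality. The exponential `exp(3θ)`
    -- collects one `θ` from `G` and two from the bound on the heat flow; its integral is at most
    -- `E`, since `2 · 3 + 1 = 7`, and `k` is chosen to cancel `E^(p-1)`.
    have hpt : ∀ᵐ θ ∂wrightMeasure α,
        (G (z.1 ^ α * θ) * heat (z.1 ^ α * θ) μ z.2) ^ p ≤
          (ENNReal.ofReal k * (F (z.1 ^ α * θ) * heat (z.1 ^ α * θ) μ z.2)) *
            ENNReal.ofReal (Real.exp (3 * θ)) ^ (p - 1) := by
      filter_upwards [ae_pos_wrightMeasure α] with θ hθ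
      obtain ⟨h1, h2⟩ := hscale z.1 hz θ hθ
      set τ := z.1 ^ α * θ with hτ
      have hb := hH τ h1 z.2
      set H := heat τ μ z.2
      have e1 : ∀ y : ℝ≥0∞, y ^ p = y * y ^ (p - 1) := by
        intro y
        have := ENNReal.rpow_add_of_nonneg (x := y) 1 (p - 1) zero_le_one hp1.le
        rwa [add_sub_cancel, ENNReal.rpow_one] at this
      have e2 : (Real.exp ((τ / τ₀) ^ γ)) ^ (p - 1) *
          (B * Real.exp (2 * (τ / τ₀)) * τ ^ (-(a / 2))) ^ (p - 1) ≤
          k * (γ * τ ^ (γ - 1) * τ₀ ^ (-γ)) * Real.exp (3 * θ) ^ (p - 1) := by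
        -- The definition of `γ` makes the decay of the heat flow match the power `τ^(γ-1)` in
        -- `F/G`.
        have hτa : (τ ^ (-(a / 2))) ^ (p - 1) = τ ^ (γ - 1) := by
          rw [← Real.rpow_mul h1.le, hγ]; congr 1; ring
        calc _ ≤ (Real.exp 1 * Real.exp (τ / τ₀)) ^ (p - 1) *
              (B * Real.exp (2 * (τ / τ₀)) * τ ^ (-(a / 2))) ^ (p - 1) := by
              gcongr
              rw [← Real.exp_add]
              exact Real.exp_le_exp.2 (hexp τ h1)
          _ = (Real.exp 1 * B) ^ (p - 1) * τ ^ (γ - 1) * Real.exp (3 * (τ / τ₀)) ^ (p - 1) := by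
              rw [← hτa, ← Real.mul_rpow (by positivity) (by positivity),
                ← Real.mul_rpow (by positivity) (by positivity),
                ← Real.mul_rpow (by positivity) (by positivity)]
              congr 1
              rw [show 3 * (τ / τ₀) = τ / τ₀ + 2 * (τ / τ₀) by ring, Real.exp_add (τ / τ₀)]
              ring
          _ ≤ (k * (γ * τ₀ ^ (-γ))) * τ ^ (γ - 1) * Real.exp (3 * θ) ^ (p - 1) := by
              gcongr
          _ = _ := by ring
      calc (G τ * H) ^ p = G τ * H * (G τ ^ (p - 1) * H ^ (p - 1)) := by
            rw [ENNReal.mul_rpow_of_nonneg _ _ (by linarith), e1 (G τ), e1 H]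
            ring
        _ ≤ G τ * H * (G τ ^ (p - 1) *
            ENNReal.ofReal (B * Real.exp (2 * (τ / τ₀)) * τ ^ (-(a / 2))) ^ (p - 1)) := by
            gcongr
        _ ≤ G τ * H * ENNReal.ofReal
            (k * (γ * τ ^ (γ - 1) * τ₀ ^ (-γ)) * Real.exp (3 * θ) ^ (p - 1)) := by
            gcongr
            rw [hG, ENNReal.ofReal_rpow_of_nonneg (by positivity) hp1.le,
              ENNReal.ofReal_rpow_of_nonneg (by positivity) hp1.le,
              ← ENNReal.ofReal_mul (by positivity)]
            exact ENNReal.ofReal_le_ofReal e2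
        _ = _ := by
            simp only [hG, hF]
            rw [ENNReal.ofReal_rpow_of_nonneg (by positivity) hp1.le,
              ENNReal.ofReal_mul (by positivity), ENNReal.ofReal_mul (by positivity),
              ENNReal.ofReal_mul (q := Real.exp ((τ / τ₀) ^ γ)) (by positivity)]
            ring
    have hmeas : Measurable fun θ => F (z.1 ^ α * θ) * heat (z.1 ^ α * θ) μ z.2 :=
      (hFm.comp (by fun_prop)).mul (measurable_heat_comp μ (by fun_prop) measurable_const)
    refine (lintegral_rpow_le_of_rpow_le hp (hmeas.const_mul _).aemeasurable (by fun_prop)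
      hpt).trans ?_
    rw [lintegral_const_mul _ hmeas]
    calc _ ≤ ENNReal.ofReal k * subordinate α μ F z * ENNReal.ofReal E ^ (p - 1) := by
          gcongr
          · exact le_rfl
          · refine (lintegral_exp_wrightMeasure_le hα (by norm_num)).trans_eq ?_
            rw [hE]; norm_num
      _ = subordinate α μ F z := by
          rw [ENNReal.ofReal_rpow_of_nonneg hE0.le hp1.le, mul_right_comm,
            ← ENNReal.ofReal_mul hk0.le, hk, ← Real.rpow_add hE0, neg_add_cancel, Real.rpow_zero,
            ENNReal.ofReal_one, one_mul]
  have hsuper := mildMap_subordinate_le hα μ hFm hGm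
    (fun τ hτ => (lintegral_deriv_exp_rpow hγ0 hτ₀ hτ).le) hpow
  exact le_sSup ⟨T, hT0, rfl, exists_isMinimalSolution (by linarith) μ hfin hsuper⟩

/-! ### Assembly of the two bounds -/

/-- The constants become `c(α)^(1/α)` and `C^(1/α)`. Continuity at `α = 1`, where `c` is still
positive, keeps them away from 0 and ∞. -/
theorem simeqSmall_of_rpow {T : ℝ → ℝ → ℝ≥0∞} {F : ℝ → ℝ → ℝ} {f c : ℝ → ℝ} {C κ₀ : ℝ}
    (hκ₀ : κ₀ ∈ Ioo (0 : ℝ) 1) (hc : ∀ α ∈ Ioc (0 : ℝ) 1, 0 < c α) (hcc : ContinuousAt c 1)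
    (hC : 0 < C) (hf : ∀ κ ∈ Ioo 0 κ₀, 0 ≤ f κ)
    (hF : ∀ α ∈ Ioo (0 : ℝ) 1, ∀ κ ∈ Ioo 0 κ₀, F α κ = f κ ^ (1 / α))
    (hlow : ∀ α ∈ Ioo (0 : ℝ) 1, ∀ κ ∈ Ioo 0 κ₀,
      ENNReal.ofReal ((c α * f κ) ^ (1 / α)) ≤ T α κ)
    (hup : ∀ α ∈ Ioo (0 : ℝ) 1, ∀ κ ∈ Ioo 0 κ₀,
      T α κ ≤ ENNReal.ofReal ((C * f κ) ^ (1 / α))) : SimeqSmall T F := by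
  have hc1 := hc 1 ⟨zero_lt_one, le_rfl⟩
  have hinv : ContinuousAt (fun α : ℝ => 1 / α) 1 :=
    continuousAt_const.div continuousAt_id one_ne_zero
  refine ⟨κ₀, hκ₀, fun α => c α ^ (1 / α), fun α => C ^ (1 / α), fun α hα =>
    ⟨Real.rpow_pos_of_pos (hc α ⟨hα.1, hα.2.le⟩) _, Real.rpow_pos_of_pos hC _⟩,
    ⟨c 1 / 2, C + 1, by positivity, ?_⟩, fun α hα κ hκ => ?_⟩
  · have h1 : Tendsto (fun α => c α ^ (1 / α)) (𝓝 1) (𝓝 (c 1)) := by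
      have := hcc.rpow hinv (Or.inl hc1.ne')
      simpa [ContinuousAt] using this
    have h2 : Tendsto (fun α : ℝ => C ^ (1 / α)) (𝓝 1) (𝓝 C) := by
      have := (continuousAt_const (y := C)).rpow hinv (Or.inl hC.ne')
      simpa [ContinuousAt] using this
    filter_upwards [nhdsWithin_le_nhds (h1.eventually (lt_mem_nhds (half_lt_self hc1))),
      nhdsWithin_le_nhds (h2.eventually (gt_mem_nhds (lt_add_one C)))] with α ha hb
    exact ⟨ha.le, hb.le⟩
  · rw [hF α hα κ hκ, ← Real.mul_rpow (hc α ⟨hα.1, hα.2.le⟩).le (hf κ hκ),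
      ← Real.mul_rpow hC.le (hf κ hκ)]
    exact ⟨hlow α hα κ hκ, hup α hα κ hκ⟩

/-- The life span is comparable to `Y(κ)^{1/(αβ)}` if `Y(κ)` controls the decay of the heat flow of
the initial value and the size of the solvable time intervals. -/
theorem simeqSmall_lifespan {N : ℕ} {p A a β κ₀ L C : ℝ} {Y : ℝ → ℝ} {F : ℝ → ℝ → ℝ}
    (hp : 1 < p) (hA : 0 < A) (ha : 0 ≤ a) (hβ : β = 1 / (p - 1) - a / 2) (hβ0 : 0 < β)
    (hκ₀ : κ₀ ∈ Ioo (0 : ℝ) 1) (hL : 0 < L) (hY : ∀ κ ∈ Ioo 0 κ₀, 1 ≤ Y κ)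
    (hF : ∀ α ∈ Ioo (0 : ℝ) 1, ∀ κ ∈ Ioo 0 κ₀, F α κ = Y κ ^ (α * β)⁻¹)
    (hheat : ∀ κ ∈ Ioo 0 κ₀, ∀ τ₀ : ℝ, 0 < τ₀ → τ₀ ≤ Y κ ^ (1 / β) → ∃ B : ℝ, 0 < B ∧
      B * Y κ ≤ L ∧ ∀ τ : ℝ, 0 < τ → ∀ x : EuclideanSpace ℝ (Fin N),
        heat τ (decayData N A κ) x ≤
          ENNReal.ofReal (B * Real.exp (2 * (τ / τ₀)) * τ ^ (-(a / 2))))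
    (hsol : ∀ α ∈ Ioo (0 : ℝ) 1, ∀ κ ∈ Ioo 0 κ₀, ∀ T R : ℝ, 0 < T → 1 < R → T ^ α = R ^ 2 →
      (∃ u, IsSolution α p T (decayData N A κ) u) → R ^ (2 * β) ≤ C * Y κ) :
    SimeqSmall (fun α κ => lifespan α p (decayData N A κ)) F := by
  have hp1 : 0 < p - 1 := by linarith
  set γ := (p - 1) * β with hγ
  have hγ0 : 0 < γ := by positivity
  have hγ' : γ = 1 - (p - 1) * (a / 2) := by rw [hγ, hβ]; field_simp
  have hγ1 : γ ≤ 1 := by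
    rw [hγ']
    have : 0 ≤ (p - 1) * (a / 2) := by positivity
    linarith
  -- The second entry gives the smallness condition of `le_lifespan` once `B Y(κ) ≤ L`; the first
  -- keeps `τ₀` below `Y(κ)^(1/β)`, where the decay hypothesis is available.
  set d := min 1 (γ ^ (1 / (p - 1)) / (Real.exp 1 * L)) with hd
  have hd0 : 0 < d := lt_min one_pos (by positivity)
  have hd1 : d ≤ 1 := min_le_left _ _
  have hd2 : Real.exp 1 * L * d ≤ γ ^ (1 / (p - 1)) := by
    have := min_le_right 1 (γ ^ (1 / (p - 1)) / (Real.exp 1 * L))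
    rw [← hd, le_div_iff₀ (by positivity)] at this
    linarith
  set E : ℝ → ℝ := fun α => 2 * Real.exp (7 ^ (1 / α)) with hE
  have hE1 : ∀ α, 1 ≤ E α := fun α => by
    have := Real.one_le_exp (x := (7 : ℝ) ^ (1 / α)) (by positivity)
    simp only [hE]
    linarith
  have hE0 : ∀ α, 0 < E α := fun α => by linarith [hE1 α]
  have hEc : ContinuousAt E 1 := by
    refine continuousAt_const.mul (Real.continuous_exp.continuousAt.comp ?_)
    exact continuousAt_const.rpow (continuousAt_const.div continuousAt_id one_ne_zero)
      (Or.inl (by norm_num))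
  have hmul : ∀ x y : ℝ, 0 ≤ x → 0 ≤ y → x ^ (1 / β) * y ^ (1 / β) = (x * y) ^ (1 / β) :=
    fun x y hx hy => (Real.mul_rpow hx hy).symm
  refine simeqSmall_of_rpow (f := fun κ => Y κ ^ (1 / β)) (c := fun α => (d / E α) ^ (1 / β))
    (C := (max 1 C) ^ (1 / β)) hκ₀ (fun α _ => ?_) ?_ (by positivity) (fun κ hκ => ?_)
    (fun α hα κ hκ => ?_) (fun α hα κ hκ => ?_) (fun α hα κ hκ => ?_)
  · have := hE0 α
    positivity
  · exact (continuousAt_const.div hEc (hE0 1).ne').rpow continuousAt_const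
      (Or.inr (by positivity))
  · have := hY κ hκ
    positivity
  · have := hY κ hκ
    have := hα.1
    rw [hF α hα κ hκ, ← Real.rpow_mul (by linarith)]
    congr 1
    field_simp
  · have hYκ := hY κ hκ
    have hEα := hE0 α
    have hY0 : 0 < Y κ := by linarith
    rw [hmul _ _ (by positivity) hY0.le]
    set τ₀ := (d / E α * Y κ) ^ (1 / β) with hτ₀
    have hτ₀0 : 0 < τ₀ := by positivity
    have hle : d / E α ≤ 1 := by
      rw [div_le_one hEα]
      linarith [hE1 α]
    have hτ₀Y : τ₀ ≤ Y κ ^ (1 / β) := by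
      rw [hτ₀]
      gcongr
      exact mul_le_of_le_one_left hY0.le hle
    obtain ⟨B, hB, hBL, hH⟩ := hheat κ hκ τ₀ hτ₀0 hτ₀Y
    have : SFinite (decayData N A κ) := by unfold decayData; infer_instance
    refine le_lifespan hα hp hγ' hγ0 hγ1 hB hτ₀0 (decayData N A κ)
      (fun τ hτ x => heat_decayData_le_self hA hκ.1.le hτ x) hH ?_
    have e1 : τ₀ ^ γ = (d / E α * Y κ) ^ (p - 1) := by
      rw [hτ₀, ← Real.rpow_mul (by positivity), hγ]
      congr 1
      field_simp
    rw [e1, ← Real.mul_rpow (by positivity) (by positivity)]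
    calc _ ≤ (γ ^ (1 / (p - 1))) ^ (p - 1) := by
          refine Real.rpow_le_rpow (by positivity) (le_trans ?_ hd2) hp1.le
          calc _ = Real.exp 1 * (B * Y κ) * d := by
                simp only [hE] at hEα ⊢
                field_simp
            _ ≤ _ := by gcongr
      _ = γ := by rw [← Real.rpow_mul hγ0.le, one_div_mul_cancel hp1.ne', Real.rpow_one]
  · have hYκ := hY κ hκ
    have hY0 : 0 < Y κ := by linarith
    have hα0 := hα.1
    have hC1 : 1 ≤ max 1 C := le_max_left _ _
    rw [hmul _ _ (by positivity) hY0.le]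
    refine sSup_le ?_
    rintro _ ⟨T, hT, rfl, u, hu, -⟩
    apply ENNReal.ofReal_le_ofReal
    have hTR : T ^ α = (T ^ (α / 2)) ^ 2 := by
      rw [← Real.rpow_mul_natCast hT.le]; congr 1; push_cast; ring
    have hR0 : 0 < T ^ (α / 2) := by positivity
    have hR : (T ^ (α / 2)) ^ (2 * β) ≤ max 1 C * Y κ := by
      -- For `R ≤ 1` there is no information on the mass, but the bound is trivial since `Y(κ) ≥ 1`;
      -- this is why the constant is `max 1 C`.
      rcases lt_or_ge 1 (T ^ (α / 2)) with h | h
      · refine (hsol α hα κ hκ T _ hT h hTR ⟨u, hu⟩).trans ?_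
        gcongr
        exact le_max_right _ _
      · refine (Real.rpow_le_one hR0.le h (by positivity)).trans ?_
        nlinarith
    have e : T = ((T ^ (α / 2)) ^ (2 * β)) ^ (1 / β * (1 / α)) := by
      rw [← Real.rpow_mul hT.le, ← Real.rpow_mul hT.le]
      conv_lhs => rw [← Real.rpow_one T]
      congr 1
      field_simp
    rw [← Real.rpow_mul (by positivity), e]
    gcongr

theorem simeqSmall_lifespan_of_ne {N : ℕ} (hN : 1 ≤ N) {p A : ℝ} (hp : 1 < p) (hA : 0 < A)
    (hAN : A ≠ N) (hβ : 0 < 1 / (p - 1) - min A N / 2) :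
    SimeqSmall (fun α κ => lifespan α p (decayData N A κ))
      (fun α κ => κ ^ (-(α / (p - 1) - α / 2 * min A N)⁻¹)) := by
  obtain ⟨L, hL, hheat⟩ := exists_heat_decayData_le hN hA hAN
  obtain ⟨C, hC, hsol⟩ := exists_mul_le_of_isSolution N (A := A) hp
  obtain ⟨c, hc, hmass⟩ := exists_decayMass_ge (N := N) hA
  refine simeqSmall_lifespan (a := min A N) (κ₀ := 1 / 2) (Y := fun κ => κ⁻¹) (C := C / c) hp hA
    (le_min hA.le (Nat.cast_nonneg N)) rfl hβ ⟨by norm_num, by norm_num⟩ hL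
    (fun κ hκ => ?_) (fun α hα κ hκ => ?_) (fun κ hκ τ₀ hτ₀ _ => ?_)
    (fun α hα κ hκ T R hT hR hTR hu => ?_)
  · rw [one_le_inv₀ hκ.1]
    linarith [hκ.2]
  · rw [Real.inv_rpow hκ.1.le, Real.rpow_neg hκ.1.le]
    congr 3
    ring
  · have hκ0 := hκ.1
    refine ⟨κ * L, by positivity, by field_simp; exact le_rfl, fun τ hτ x =>
      (hheat κ τ hκ.1.le hτ x).trans (ENNReal.ofReal_le_ofReal ?_)⟩
    exact mul_le_mul_of_nonneg_right (le_mul_of_one_le_right (by positivity)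
      (Real.one_le_exp (by positivity))) (by positivity)
  · have hκ0 := hκ.1
    have hR0 : 0 < R := by linarith
    have h := hsol α hα κ T R _ hκ.1 hT hR0 hTR (by positivity) (hmass R hR.le) hu
    have e : κ * (c * R ^ ((N : ℝ) - min A N)) * R ^ (2 / (p - 1) - N) =
        κ * c * R ^ (2 * (1 / (p - 1) - min A N / 2)) := by
      rw [show 2 * (1 / (p - 1) - min A (N : ℝ) / 2) =
        (N - min A N) + (2 / (p - 1) - N) by ring, Real.rpow_add hR0]
      ring
    rw [e] at h
    rw [← div_eq_mul_inv, div_div, le_div_iff₀ (by positivity)]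
    linarith

/-- `2 + τ ≤ (2 + τ₀)(1 + τ/τ₀)`, and `log(2+τ₀) ≥ 1/2` turns the additive error `τ/τ₀` into a
factor. The logarithm is thus frozen at `τ₀`, at the cost of the exponential allowed in
`le_lifespan`. -/
theorem log_two_add_le_mul_exp {τ τ₀ : ℝ} (hτ : 0 < τ) (hτ₀ : 0 < τ₀) :
    Real.log (2 + τ) ≤ Real.log (2 + τ₀) * Real.exp (2 * (τ / τ₀)) := by
  have h1 : Real.log (2 + τ) ≤ Real.log ((2 + τ₀) * (1 + τ / τ₀)) := by
    refine Real.log_le_log (by positivity) ?_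
    have : τ₀ * (τ / τ₀) = τ := by field_simp
    have : 0 < τ / τ₀ := by positivity
    nlinarith
  rw [Real.log_mul (by positivity) (by positivity)] at h1
  have h2 : Real.log (1 + τ / τ₀) ≤ τ / τ₀ := by
    have := Real.log_le_sub_one_of_pos (x := 1 + τ / τ₀) (by positivity)
    linarith
  have h3 : 1 / 2 ≤ Real.log (2 + τ₀) := by
    have := Real.log_le_log (x := 2) (y := 2 + τ₀) (by norm_num) (by linarith)
    have := Real.log_two_gt_d9
    linarith
  have h4 := Real.add_one_le_exp (2 * (τ / τ₀))
  have h5 : 0 < τ / τ₀ := by positivity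
  nlinarith

theorem log_le_half {z : ℝ} (hz : 0 < z) : Real.log z ≤ z / 2 := by
  have h := Real.log_le_sub_one_of_pos (x := z / 2) (by positivity)
  rw [Real.log_div hz.ne' (by norm_num)] at h
  have := Real.log_two_lt_d9
  linarith

theorem simeqSmall_lifespan_of_eq {N : ℕ} (hN : 1 ≤ N) {p : ℝ} (hp : 1 < p)
    (hβ : 0 < 1 / (p - 1) - (N : ℝ) / 2) :
    SimeqSmall (fun α κ => lifespan α p (decayData N N κ))
      (fun α κ => (κ⁻¹ / Real.log κ⁻¹) ^ (α / (p - 1) - α * N / 2)⁻¹) := by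
  have hN0 : (0 : ℝ) < N := by exact_mod_cast hN
  obtain ⟨L, hL, hheat⟩ := exists_heat_decayData_le_log hN
  obtain ⟨C, hC, hsol⟩ := exists_mul_le_of_isSolution N (A := N) hp
  obtain ⟨c, hc, hmass⟩ := exists_decayMass_ge_log hN
  set β := 1 / (p - 1) - (N : ℝ) / 2 with hβdef
  have hy : ∀ κ ∈ Ioo 0 (Real.exp (-1)), 1 < Real.log κ⁻¹ := by
    intro κ hκ
    rw [Real.log_inv]
    have := Real.log_lt_log hκ.1 hκ.2
    rw [Real.log_exp] at this
    linarith
  refine simeqSmall_lifespan (a := N) (κ₀ := Real.exp (-1)) (Y := fun κ => κ⁻¹ / Real.log κ⁻¹)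
    (L := L * (2 + 1 / β)) (C := max 1 (4 * β * C / c)) hp hN0 hN0.le hβdef hβ
    ⟨Real.exp_pos _, Real.exp_lt_one_iff.2 (by norm_num)⟩ (by positivity)
    (fun κ hκ => ?_) (fun α hα κ hκ => ?_) (fun κ hκ τ₀ hτ₀ hτY => ?_)
    (fun α hα κ hκ T R hT hR hTR hu => ?_)
  · have h1 := hy κ hκ
    have hκ0 := inv_pos.2 hκ.1
    rw [one_le_div (by linarith)]
    linarith [Real.log_le_sub_one_of_pos hκ0]
  · congr 2
    rw [hβdef]
    ring
  · have h1 := hy κ hκ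
    have hκ0 := hκ.1
    -- Since `τ₀` is at most a power of `κ⁻¹`, its logarithm is comparable with `log κ⁻¹`, which
    -- cancels the denominator of `Y(κ)`.
    have hlog : Real.log (2 + τ₀) ≤ (2 + 1 / β) * Real.log κ⁻¹ := by
      have hone : 1 ≤ κ⁻¹ := by
        linarith [Real.log_le_sub_one_of_pos (inv_pos.2 hκ0)]
      have h2 : τ₀ ≤ κ⁻¹ ^ (1 / β) := by
        refine hτY.trans ?_
        gcongr
        exact div_le_self (inv_pos.2 hκ0).le h1.le
      have h3 : 1 ≤ κ⁻¹ ^ (1 / β) := Real.one_le_rpow hone (by positivity)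
      have h4 : Real.log (2 + τ₀) ≤ Real.log (3 * κ⁻¹ ^ (1 / β)) :=
        Real.log_le_log (by positivity) (by linarith)
      rw [Real.log_mul (by norm_num) (by positivity), Real.log_rpow (inv_pos.2 hκ0)] at h4
      have h5 : Real.log 3 ≤ 2 := by
        linarith [Real.log_le_sub_one_of_pos (x := 3) (by norm_num)]
      nlinarith
    have hlog0 : 0 < Real.log (2 + τ₀) := Real.log_pos (by linarith)
    refine ⟨κ * (L * Real.log (2 + τ₀)), by positivity, ?_, fun τ hτ x =>
      (hheat κ τ hκ0.le hτ x).trans (ENNReal.ofReal_le_ofReal ?_)⟩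
    · have h0 : 0 < Real.log κ⁻¹ := by linarith
      rw [← mul_div_assoc, div_le_iff₀ h0]
      calc κ * (L * Real.log (2 + τ₀)) * κ⁻¹ = L * Real.log (2 + τ₀) := by field_simp
        _ ≤ L * ((2 + 1 / β) * Real.log κ⁻¹) := by gcongr
        _ = _ := by ring
    · refine mul_le_mul_of_nonneg_right ?_ (by positivity)
      rw [mul_assoc κ, mul_assoc L]
      refine mul_le_mul_of_nonneg_left (mul_le_mul_of_nonneg_left ?_ hL.le) hκ0.le
      exact log_two_add_le_mul_exp hτ hτ₀
  · have h1 := hy κ hκ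
    have hκ0 := hκ.1
    have hR0 : 0 < R := by linarith
    have hlogR : 0 < Real.log R := Real.log_pos hR
    have hz : 0 < Real.log κ⁻¹ := by linarith
    have hX : 0 < κ⁻¹ / Real.log κ⁻¹ := by positivity
    have h := hsol α hα κ T R _ hκ.1 hT hR0 hTR (by positivity) (hmass R hR.le) hu
    rw [show 2 / (p - 1) - (N : ℝ) = 2 * β by rw [hβdef]; ring] at h
    -- The solvability condition contains `log R` and has to be restated with `log κ⁻¹`. Either the
    -- claim holds with constant 1, or `R^(2β) ≥ κ⁻¹ / log κ⁻¹`; then `log log κ⁻¹ ≤ (log κ⁻¹)/2`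
    -- gives `log κ⁻¹ ≤ 4β log R`.
    rcases le_total (R ^ (2 * β)) (κ⁻¹ / Real.log κ⁻¹) with hle | hge
    · exact hle.trans (le_mul_of_one_le_left hX.le (le_max_left _ _))
    · have h2 := Real.log_le_log hX hge
      rw [Real.log_div (by positivity) hz.ne', Real.log_rpow hR0] at h2
      have h3 := log_le_half hz
      have h4 : Real.log κ⁻¹ ≤ 4 * β * Real.log R := by linarith
      have hRp : 0 < R ^ (2 * β) := by positivity
      refine le_trans ?_ (mul_le_mul_of_nonneg_right (le_max_right 1 (4 * β * C / c)) hX.le)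
      have h5 : κ * c * R ^ (2 * β) * Real.log κ⁻¹ ≤ 4 * β * C := by
        calc κ * c * R ^ (2 * β) * Real.log κ⁻¹
            ≤ κ * c * R ^ (2 * β) * (4 * β * Real.log R) := by gcongr
          _ = 4 * β * (κ * (c * Real.log R) * R ^ (2 * β)) := by ring
          _ ≤ 4 * β * C := by gcongr
      rw [div_mul_div_comm, le_div_iff₀ (by positivity)]
      calc R ^ (2 * β) * (c * Real.log κ⁻¹)
          = κ * c * R ^ (2 * β) * Real.log κ⁻¹ * κ⁻¹ := by field_simp
        _ ≤ _ := by gcongr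

end

end TimeFractional

theorem mainTheorem11 (N : ℕ) (hN : 1 ≤ N) (p A : ℝ) (hp : 1 < p) (hA : 0 < A)
    (h : p < 1 + 2 / (N : ℝ) ∨ A < 2 / (p - 1)) :
    (A ≠ N → TimeFractional.SimeqSmall
      (fun α κ => TimeFractional.lifespan α p (TimeFractional.decayData N A κ))
      (fun α κ => κ ^ (-(α / (p - 1) - α / 2 * min A N)⁻¹))) ∧
    (A = N → TimeFractional.SimeqSmall
      (fun α κ => TimeFractional.lifespan α p (TimeFractional.decayData N A κ))
      (fun α κ => (κ⁻¹ / Real.log κ⁻¹) ^ (α / (p - 1) - α * N / 2)⁻¹)) := by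
  have hN0 : (0 : ℝ) < N := by exact_mod_cast hN
  have hp1 : 0 < p - 1 := by linarith
  -- Each alternative says that one of `N` and `A` is below `2/(p-1)`; only the minimum matters.
  have hβ : 0 < 1 / (p - 1) - min A N / 2 := by
    rw [sub_pos, div_lt_div_iff₀ two_pos hp1]
    rcases h with h | h
    · have h1 : p - 1 < 2 / N := by linarith
      rw [lt_div_iff₀ hN0] at h1
      nlinarith [min_le_right A (N : ℝ)]
    · rw [lt_div_iff₀ hp1] at h
      nlinarith [min_le_left A (N : ℝ)]
  refine ⟨fun hAN => TimeFractional.simeqSmall_lifespan_of_ne hN hp hA hAN hβ, ?_⟩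
  rintro rfl
  rw [min_self] at hβ
  exact TimeFractional.simeqSmall_lifespan_of_eq hN hp hβ
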